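/- Let $k$ be a field and let $\mathcal Z$ be the quiver with vertex set $\mathbb Z$ and, for each $i\in\mathbb Z$, two arrows $\alpha^i\colon i\to i+1$ and $\alpha_i\colon i+1\to i$. Let $\mathfrak v=(V_i,v_i,v^i)_{i\in\mathbb Z}$ be a representation of $\mathcal Z$ in finite-dimensional $k$-vector spaces, with $v^i\colon V_i\to V_{i+1}$ and $v_i\colon V_{i+1}\to V_i$; let $v^i_j\colon V_i\to V_j$ be the composition of these maps along the direct path from $i$ to $j$. Assume that $\mathfrak v$ is - exact: $\ker(v^i)=\mathrm{Im}(v_i)$ and $\ker(v_i)=\mathrm{Im}(v^i)$ for each $i$ (so all $V_i$ have the same dimension $r$); - a colinked chain: $v_iv^i=0$, $v^iv_i=0$ and $\mathrm{Im}(v_i)+\mathrm{Im}(v^{i-1})=V_i$ for each $i$; - of finite cosupport: there is a finite set $H\subseteq\mathbb Z$ (a cosupport) such that for each $i\in\mathbb Z$ the map $v^i_j$ is injective for some $j\in H$. Let $\mathbb{LP}(\mathfrak v)$ be the linked projective space of $\mathfrak v$, parameterizing the subrepresentations of $\mathfrak v$ of pure dimension $1$. It is the closed subscheme $$\mathbb{LP}_H(\mathfrak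 v)=\Big\{([x_i])_{i\in H}\ \Big|\ v^i_j(x_i)\wedge x_j=0\text{ for all }i,j\in H\Big\}\subseteq\prod_{i\in H}\mathbb P(V_i)$$ for any finite interval $H\subset\mathbb Z$ which is a cosupport of $\mathfrak v$, where $\mathbb P(V_i)$ is the space of lines in $V_i$ and the product is over $k$. For $\bm a\colon\{\alpha^i,\alpha_i\mid i\in\mathbb Z\}\to\{0,1\}$, let $\mathbb{LP}(\mathfrak v)_{\bm a}\subseteq\mathbb{LP}(\mathfrak v)$ be the set of points whose corresponding subrepresentation $\mathfrak w$ (of $\mathfrak v$ with scalars extended to the residue field of the point) satisfies, for every arrow $\alpha$: $w_\alpha=0$ if and only if $\bm a(\alpha)=0$. Call $\bm a$ exact if $(\bm a(\alpha^i),\bm a(\alpha_i))$ is $(0,1)$ or $(1,0)$ for each $i\in\mathbb Z$. Then: 1. $\mathbb{LP}(\mathfrak v)$ is generically reduced, that is, it has a dense open subscheme which is reduced. 2. $\mathbb{LP}(\mathfrak v)$ has pure dimension $r-1$: every irreducible component has dimension $r-1$. 3. Every irreducible component of $\mathbb{LP}(\mathfrak v)$, with its reduced structure, is rational over $k$, that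 is, birational over $k$ to an affine space. 4. The irreducible components of $\mathbb{LP}(\mathfrak v)$ are exactly the closures $\overline{\mathbb{LP}(\mathfrak v)_{\bm a}}$ of the nonempty strata $\mathbb{LP}(\mathfrak v)_{\bm a}$ for $\bm a$ exact. -/

import Mathlib

open CategoryTheory CategoryTheory.Limits AlgebraicGeometry TopologicalSpace
open scoped TensorProduct

universe u w

/-! ### Representations of the bi-infinite quiver with arrows `i ⇄ i + 1` -/

/-- The arrows of the quiver with vertex set `ℤ`: for each `i` an arrow `up i : i → i + 1`
and an arrow `down i : i + 1 → i`. -/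
inductive ZArrow : Type
  | up (i : ℤ) : ZArrow
  | down (i : ℤ) : ZArrow

/-- A function on the arrows with values in `{0, 1}` is exact if its values at the pair of
arrows `(up i, down i)` are `(0, 1)` or `(1, 0)`, for each `i`. -/
def ZArrow.IsExact (a : ZArrow → Fin 2) : Prop :=
  ∀ i : ℤ, (a (.up i) = 0 ∧ a (.down i) = 1) ∨ (a (.up i) = 1 ∧ a (.down i) = 0)

/-- A representation of the quiver in finite-dimensional vector spaces over `k`. -/
structure ZRep (k : Type u) [Field k] where
  V : ℤ → Type w
  [addCommGroup : ∀ i, AddCommGroup (V i)]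
  [module : ∀ i, Module k (V i)]
  [finiteDimensional : ∀ i, FiniteDimensional k (V i)]
  up : ∀ i, V i →ₗ[k] V (i + 1)
  down : ∀ i, V (i + 1) →ₗ[k] V i

namespace ZRep

attribute [instance] addCommGroup module finiteDimensional

section Basic

variable {k : Type u} [Field k] (v : ZRep.{u, w} k)

/-- The identity map, for two equal indices. -/
def idMap (i j : ℤ) (h : i = j) : v.V i →ₗ[k] v.V j :=
  h ▸ LinearMap.id

/-- The composition of the `n` upward maps from `i` to `j = i + n`. -/
def upMap : ∀ (n : ℕ) (i j : ℤ), j = i + n → (v.V i →ₗ[k] v.V j)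
  | 0, i, j, h => v.idMap i j (by simp [h])
  | n + 1, i, j, h => (upMap n (i + 1) j (by rw [h]; push_cast; ring)).comp (v.up i)

/-- The composition of the `n` downward maps from `i = j + n` to `j`. -/
def downMap : ∀ (n : ℕ) (i j : ℤ), i = j + n → (v.V i →ₗ[k] v.V j)
  | 0, i, j, h => v.idMap i j (by simp [h])
  | n + 1, i, j, h => (v.down j).comp (downMap n i (j + 1) (by rw [h]; push_cast; ring))

/-- The composition of the maps along the direct path from `i` to `j`. -/
def pathMap (i j : ℤ) : v.V i →ₗ[k] v.V j :=
  if h : i ≤ j then v.upMap (j - i).toNat i j (by omega)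
  else v.downMap (i - j).toNat i j (by omega)

/-- Every vector space of the representation has dimension `r`. -/
def HasPureDim (r : ℕ) : Prop :=
  ∀ i, Module.finrank k (v.V i) = r

def IsSpecialChain : Prop :=
  ∀ i, (v.down i).comp (v.up i) = 0 ∧ (v.up i).comp (v.down i) = 0

/-- A colinked chain: a special chain in which, at each vertex `i + 1`, the images of the two
incoming maps span. -/
def IsColinkedChain : Prop :=
  v.IsSpecialChain ∧
    ∀ i, LinearMap.range (v.down (i + 1)) ⊔ LinearMap.range (v.up i) = ⊤

def IsExact : Prop :=
  ∀ i, LinearMap.ker (v.up i) = LinearMap.range (v.down i) ∧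
    LinearMap.ker (v.down i) = LinearMap.range (v.up i)

/-- `H` is a cosupport: each vertex `i` maps injectively to some vertex of `H`. -/
def HasCosupport (H : Set ℤ) : Prop :=
  ∀ i, ∃ j ∈ H, Function.Injective (v.pathMap i j)

def HasFiniteCosupport : Prop :=
  ∃ H : Set ℤ, H.Finite ∧ v.HasCosupport H

theorem hasFiniteCosupport_iff_exists_Icc :
    v.HasFiniteCosupport ↔ ∃ m n : ℤ, v.HasCosupport (Finset.Icc m n : Finset ℤ) := by
  constructor
  · rintro ⟨H, hH, hc⟩
    obtain ⟨m, hm⟩ := hH.bddBelow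
    obtain ⟨n, hn⟩ := hH.bddAbove
    refine ⟨m, n, fun i => ?_⟩
    obtain ⟨j, hj, h⟩ := hc i
    exact ⟨j, by simpa using ⟨hm hj, hn hj⟩, h⟩
  · rintro ⟨m, n, h⟩
    exact ⟨_, Finset.finite_toSet _, h⟩

/-- A family of subspaces is a subrepresentation if it is stable under all the maps. -/
def IsSubrep (W : ∀ i, Submodule k (v.V i)) : Prop :=
  ∀ i, (W i).map (v.up i) ≤ W (i + 1) ∧ (W (i + 1)).map (v.down i) ≤ W i

/-- The set of subrepresentations of pure dimension `1`. -/
def LP : Set (∀ i, Submodule k (v.V i)) :=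
  {W | v.IsSubrep W ∧ ∀ i, Module.finrank k (W i) = 1}

open Classical in
/-- The function on the arrows attached to a subrepresentation: it is `0` exactly at the arrows
whose induced map is zero. -/
noncomputable def arrowFun (W : ∀ i, Submodule k (v.V i)) : ZArrow → Fin 2
  | .up i => if (W i).map (v.up i) = ⊥ then 0 else 1
  | .down i => if (W (i + 1)).map (v.down i) = ⊥ then 0 else 1

/-- Extension of scalars. -/
noncomputable def baseChange (K : Type u) [Field K] [Algebra k K] : ZRep.{u, max u w} K where
  V i := K ⊗[k] v.V i
  up i := (v.up i).baseChange K
  down i := (v.down i).baseChange K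

end Basic

end ZRep

/-! ### Projective spaces and coordinates -/

section Proj

attribute [local instance] MvPolynomial.gradedAlgebra

variable (k : Type u) [Field k]

/-- The projective space of lines in `k ^ n`, with homogeneous coordinates `X b`. -/
noncomputable def ProjSp (n : ℕ) : Scheme.{u} :=
  Proj (MvPolynomial.homogeneousSubmodule (Fin n) k)

namespace ProjSp

/-- The structure morphism. -/
noncomputable def toSpec (n : ℕ) : ProjSp k n ⟶ Spec (.of k) :=
  Proj.toSpecZero (MvPolynomial.homogeneousSubmodule (Fin n) k) ≫
    Spec.map (CommRingCat.ofHom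
      (algebraMap k (MvPolynomial.homogeneousSubmodule (Fin n) k 0)))

variable {k}

/-- The open set where the coordinate `X c` does not vanish. -/
noncomputable def chart {n : ℕ} (c : Fin n) : (ProjSp k n).Opens :=
  Proj.basicOpen (MvPolynomial.homogeneousSubmodule (Fin n) k) (MvPolynomial.X c)

/-- The function `X b / X c` on the open set where `X c` does not vanish. -/
noncomputable def ratio {n : ℕ} (c b : Fin n) : Γ(ProjSp k n, chart c) :=
  (Proj.awayToSection (MvPolynomial.homogeneousSubmodule (Fin n) k) (MvPolynomial.X c)).hom
    (HomogeneousLocalization.Away.mk (MvPolynomial.homogeneousSubmodule (Fin n) k)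
      (d := 1) (MvPolynomial.isHomogeneous_X k c) 1 (MvPolynomial.X b)
      (MvPolynomial.isHomogeneous_X k b))

/-- For a morphism `g` from `X` to projective space and an open `U` mapped into the locus where
`X c ≠ 0`, the vector of functions `(X b / X c)_b` on `U`. -/
noncomputable def coord {X : Scheme.{u}} {n : ℕ} (g : X ⟶ ProjSp k n) (c : Fin n)
    (U : X.Opens) (h : U ≤ g ⁻¹ᵁ chart c) (b : Fin n) : Γ(X, U) :=
  (X.presheaf.map (homOfLE h).op).hom ((g.app (chart c)).hom (ratio c b))

/-- The scalars of `k`, as functions on an open set of a `k`-scheme. -/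
noncomputable def scalar {X : Scheme.{u}} (s : X ⟶ Spec (.of k)) (U : X.Opens) :
    k →+* Γ(X, U) :=
  ((Scheme.ΓSpecIso (.of k)).inv ≫ s.appTop ≫ X.presheaf.map (homOfLE le_top).op).hom

/-- The residue field at a point of a `k`-scheme, as a `k`-algebra. -/
noncomputable abbrev residueAlgebra {X : Scheme.{u}} (s : X ⟶ Spec (.of k)) (x : X) :
    Algebra k (X.residueField x) :=
  ((X.evaluation ⊤ x trivial).hom.comp (scalar s ⊤)).toAlgebra

end ProjSp

end Proj

/-! ### The linked projective space -/

namespace ZRep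

variable {k : Type u} [Field k] (v : ZRep.{u, w} k) (H : Finset ℤ)

/-- The product over `k` of the projective spaces `ℙ(V i)` of lines in `V i`, for `i ∈ H`. The
homogeneous coordinates on `ℙ(V i)` are those of the basis `Module.finBasis k (v.V i)`. -/
noncomputable def prodProj : Scheme.{u} :=
  widePullback (Spec (.of k)) (fun i : H => ProjSp k (Module.finrank k (v.V i)))
    (fun i => ProjSp.toSpec k (Module.finrank k (v.V i)))

noncomputable def prodProjToSpec : v.prodProj H ⟶ Spec (.of k) :=
  WidePullback.base _

/-- The projection to `ℙ(V i)`. -/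
noncomputable def prodProjπ (i : H) : v.prodProj H ⟶ ProjSp k (Module.finrank k (v.V i)) :=
  WidePullback.π _ i

/-- The coordinate vector `x_i` on an open `U` where the coordinate with index `c` of `V i` does
not vanish (normalized to have coordinate `1` at `c`), mapped to `V j` along the path from `i`
to `j`. -/
noncomputable def pathCoord (i j : H) (c : Fin (Module.finrank k (v.V i)))
    (U : (v.prodProj H).Opens) (h : U ≤ v.prodProjπ H i ⁻¹ᵁ ProjSp.chart c)
    (b : Fin (Module.finrank k (v.V j))) : Γ(v.prodProj H, U) :=
  ∑ e, ProjSp.scalar (v.prodProjToSpec H) U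
      (LinearMap.toMatrix (Module.finBasis k (v.V i)) (Module.finBasis k (v.V j))
        (v.pathMap i j) b e) *
    ProjSp.coord (v.prodProjπ H i) c U h e

/-- The ideal sheaf of the closed subscheme where the image of `x_i` along the path from `i` to
`j` is proportional to `x_j`. On an affine open on which some coordinate of `x_i` and some
coordinate of `x_j` do not vanish, it is generated by the `2 × 2` minors of the matrix with
these two columns; this does not depend on the choice of the coordinates. No condition is put
on other affine opens: `ofIdeals` is the largest ideal sheaf contained in the given family. -/
noncomputable def pairIdeal (i j : H) : (v.prodProj H).IdealSheafData :=
  .ofIdeals fun U =>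
    ⨅ (c : Fin (Module.finrank k (v.V i))) (d : Fin (Module.finrank k (v.V j)))
      (hc : U.1 ≤ v.prodProjπ H i ⁻¹ᵁ ProjSp.chart c)
      (hd : U.1 ≤ v.prodProjπ H j ⁻¹ᵁ ProjSp.chart d),
    Ideal.span (Set.range fun b : Fin (Module.finrank k (v.V j)) ×
        Fin (Module.finrank k (v.V j)) =>
      v.pathCoord H i j c U.1 hc b.1 * ProjSp.coord (v.prodProjπ H j) d U.1 hd b.2 -
        v.pathCoord H i j c U.1 hc b.2 * ProjSp.coord (v.prodProjπ H j) d U.1 hd b.1)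

/-- The closed subscheme of the product of the `ℙ(V i)`, `i ∈ H`, cut out by the equations
`v_{i → j}(x_i) ∧ x_j = 0` for all `i, j ∈ H`. When `H` is a finite interval which is a
cosupport of a pure special chain, this is the linked projective space. -/
noncomputable def LPScheme : Scheme.{u} :=
  (⨆ (i : H) (j : H), v.pairIdeal H i j).subscheme

noncomputable def LPι : v.LPScheme H ⟶ v.prodProj H :=
  (⨆ (i : H) (j : H), v.pairIdeal H i j).subschemeι

noncomputable def LPToSpec : v.LPScheme H ⟶ Spec (.of k) :=
  v.LPι H ≫ v.prodProjToSpec H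

noncomputable def LPπ (i : H) : v.LPScheme H ⟶ ProjSp k (Module.finrank k (v.V i)) :=
  v.LPι H ≫ v.prodProjπ H i

/-- The representation obtained by extending scalars to the residue field at a point. -/
noncomputable def atPoint (x : v.LPScheme H) :
    ZRep.{u, max u w} ((v.LPScheme H).residueField x) :=
  letI := ProjSp.residueAlgebra (v.LPToSpec H) x
  v.baseChange ((v.LPScheme H).residueField x)

/-- The line in `κ(x) ⊗ V i`, for `i ∈ H`, parameterized by the point `x`. It is spanned by
the vector with coordinates `(X b / X c)(x)`, for any `c` with `X c ≠ 0` at `x`. -/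
noncomputable def tautLine (x : v.LPScheme H) (i : H) :
    Submodule ((v.LPScheme H).residueField x) ((v.atPoint H x).V i) :=
  letI := ProjSp.residueAlgebra (v.LPToSpec H) x
  Submodule.span ((v.LPScheme H).residueField x)
    {z : (v.LPScheme H).residueField x ⊗[k] v.V i |
      ∃ (c : Fin (Module.finrank k (v.V i))) (hc : x ∈ v.LPπ H i ⁻¹ᵁ ProjSp.chart c),
        z = ∑ b, ((v.LPScheme H).evaluation (v.LPπ H i ⁻¹ᵁ ProjSp.chart c) x hc).hom
            (ProjSp.coord (v.LPπ H i) c _ le_rfl b) ⊗ₜ[k] Module.finBasis k (v.V i) b}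

/-- The stratum of a function `a` on the arrows: the set of points `x` of the linked projective
space such that the one-dimensional subrepresentation of `κ(x) ⊗ v` (over the whole quiver)
given by `x` has `a` as attached function. -/
def stratum (a : ZArrow → Fin 2) : Set (v.LPScheme H) :=
  {x | ∃ W ∈ (v.atPoint H x).LP,
    (∀ i : H, W i = v.tautLine H x i) ∧ (v.atPoint H x).arrowFun W = a}

end ZRep

namespace AlgebraicGeometry.Scheme

/-- There is a dense open subscheme which is reduced. -/
def IsGenericallyReduced (X : Scheme.{u}) : Prop :=
  ∃ U : X.Opens, Dense (U : Set X) ∧ IsReduced U.toScheme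

/-- Every irreducible component has (Krull) dimension `d`. -/
def HasPureDimension (X : Scheme.{u}) (d : WithBot ℕ∞) : Prop :=
  ∀ Z ∈ irreducibleComponents X, topologicalKrullDim Z = d

/-- Every irreducible component, with its reduced structure, is rational over `S`: it is
birational over `S` to an affine space. -/
def HasRationalComponents {X S : Scheme.{u}} (s : X ⟶ S) : Prop :=
  ∀ Z : Closeds X, (Z : Set X) ∈ irreducibleComponents X →
    IsRationalOver ((IdealSheafData.vanishingIdeal Z).subschemeι ≫ s)

end AlgebraicGeometry.Scheme

/-! The representation is a direct sum of `r` chains of rank one. Each has a peak vertex `t b` in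
`[m, n]`: arrows pointing towards the peak are the identity and arrows pointing away from it are
zero (`exists_coordinates`). The peaks come from the socles, the vectors killed by both outgoing
maps. Exactness and the colinked condition make the dimensions of the socles telescope to `r`, and
following the direct paths from a vertex into all the socles is injective.

In these coordinates a point is a family of vectors `y i`, `m ≤ i ≤ n`, with scalars `l i`, `μ i`
that relate neighbours and satisfy `l i * μ i = 0`. Fix a direction `d` for every edge. Where the
maps along `d` are nonzero, the family is determined up to rescaling by a single vector `z`: `y i`
is `z` truncated to those `b` for which all edges between `i` and `t b` point from `i` towards `t b`
(`ChainRel.exists_eq_reach`). Such points form an open set `Coords.flow d`, covered by cells that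
are open subschemes of an affine space of dimension `r - 1`, namely the space of vectors `z` with
one coordinate normalized (`Coords.exists_algEquiv`, `Coords.exists_param`). Whether a functional
vanishes at the generic point of a cell depends only on `d`, so all nonempty cells of one flow share
their generic point (`Coords.exists_genericPoint_flow`).

Every generic point of the scheme lies in some `Coords.flow d`. If both maps across an edge vanished
at a generic point with residue field `K`, adding a multiple of `X • y (e + 1)` to the vectors on
one side of the edge would give a point over `K[[X]]` that specializes to it and has a nonzero map
there, contradicting minimality (`ChainRel.deform`, `Coords.exists_notMem_of_minimalPrimes`). The
components are therefore the closures of the nonempty flow sets, and reducedness, dimension and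
rationality are read off on the cells. Finally `Coords.flow d` is the stratum of an exact function,
whose values outside `[m, n)` are forced (`Coords.stratum_eq_flow`).

All this takes place over rings and not only on points, because the scheme may be non-reduced off
the flow sets. `exists_hom_LPScheme` gives the universal property of the scheme, and `chartMap`
identifies the locus where prescribed coordinates are invertible with the spectrum of the ring
`ChartRing` of normalized solutions. -/

namespace ZRep

/-! ### Decomposition of the representation into chains of rank one -/

section Coordinates

variable {k : Type u} [Field k] (v : ZRep.{u, w} k)

theorem pathMap_self (i : ℤ) : v.pathMap i i = LinearMap.id := by
  have h : (i - i).toNat = 0 := by simp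
  rw [pathMap, dif_pos le_rfl]
  generalize_proofs pf
  revert pf
  rw [h]
  intro pf
  rfl

theorem pathMap_of_lt {i j : ℤ} (h : i < j) :
    v.pathMap i j = (v.pathMap (i + 1) j).comp (v.up i) := by
  have h' : (j - i).toNat = (j - (i + 1)).toNat + 1 := by omega
  rw [pathMap, dif_pos h.le, pathMap, dif_pos (by omega)]
  generalize_proofs pf pf'
  revert pf
  rw [h']
  intro pf
  rfl

theorem pathMap_of_gt {i j : ℤ} (h : j < i) :
    v.pathMap i j = (v.down j).comp (v.pathMap i (j + 1)) := by
  have h' : (i - j).toNat = (i - (j + 1)).toNat + 1 := by omega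
  rw [pathMap, dif_neg (by omega)]
  by_cases h2 : i = j + 1
  · subst h2
    rw [pathMap_self]
    generalize_proofs pf
    revert pf
    rw [h']
    simp only [sub_self, Int.toNat_zero]
    intro pf
    rfl
  · rw [pathMap, dif_neg (by omega)]
    generalize_proofs pf pf'
    revert pf
    rw [h']
    intro pf
    rfl

theorem pathMap_succ (i : ℤ) : v.pathMap i (i + 1) = v.up i := by
  rw [pathMap_of_lt v (by omega), pathMap_self, LinearMap.id_comp]

theorem pathMap_pred (i : ℤ) : v.pathMap (i + 1) i = v.down i := by
  rw [pathMap_of_gt v (by omega), pathMap_self, LinearMap.comp_id]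

theorem pathMap_comp_down {i j : ℤ} (h : j ≤ i) :
    v.pathMap (i + 1) j = (v.pathMap i j).comp (v.down i) := by
  obtain ⟨n, rfl⟩ : ∃ n : ℕ, j = i - n := ⟨(i - j).toNat, by omega⟩
  clear h
  induction n with
  | zero =>
    rw [Nat.cast_zero, sub_zero, pathMap_self, pathMap_pred, LinearMap.id_comp]
  | succ n ih =>
    have e : i - ((n + 1 : ℕ) : ℤ) + 1 = i - n := by push_cast; ring
    rw [← e] at ih
    rw [pathMap_of_gt v (by omega), pathMap_of_gt v (i := i) (by omega), ih,
      LinearMap.comp_assoc]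

variable {v} (hsp : v.IsSpecialChain)
include hsp

/-- If the target lies below `i + 1`, the continued path turns back at once, and the composition of
the two opposite maps is zero. -/
theorem IsSpecialChain.pathMap_up {i j : ℤ} (x : v.V i) :
    v.pathMap (i + 1) j (v.up i x) = if i + 1 ≤ j then v.pathMap i j x else 0 := by
  split_ifs with h
  · rw [pathMap_of_lt v (i := i) (by omega)]; rfl
  · rw [pathMap_comp_down v (by omega), LinearMap.comp_apply]
    have := LinearMap.congr_fun (hsp i).1 x
    rw [LinearMap.comp_apply, LinearMap.zero_apply] at this
    rw [this, map_zero]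

theorem IsSpecialChain.pathMap_down {i j : ℤ} (x : v.V (i + 1)) :
    v.pathMap i j (v.down i x) = if j ≤ i then v.pathMap (i + 1) j x else 0 := by
  split_ifs with h
  · rw [pathMap_comp_down v (by omega)]; rfl
  · rw [pathMap_of_lt v (by omega), LinearMap.comp_apply]
    have := LinearMap.congr_fun (hsp i).2 x
    rw [LinearMap.comp_apply, LinearMap.zero_apply] at this
    rw [this, map_zero]

omit hsp

theorem HasCosupport.up_injective {m n : ℤ}
    (hc : v.HasCosupport (Finset.Icc m n : Finset ℤ)) {i : ℤ} (hi : i < m) :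
    Function.Injective (v.up i) := by
  obtain ⟨j, hj, h⟩ := hc i
  simp only [Finset.coe_Icc, Set.mem_Icc] at hj
  rw [pathMap_of_lt v (by omega)] at h
  exact Function.Injective.of_comp h

theorem HasCosupport.down_injective {m n : ℤ}
    (hc : v.HasCosupport (Finset.Icc m n : Finset ℤ)) {i : ℤ} (hi : n ≤ i) :
    Function.Injective (v.down i) := by
  obtain ⟨j, hj, h⟩ := hc (i + 1)
  simp only [Finset.coe_Icc, Set.mem_Icc] at hj
  rw [pathMap_comp_down v (by omega)] at h
  exact Function.Injective.of_comp h

theorem HasCosupport.le {m n : ℤ}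
    (hc : v.HasCosupport (Finset.Icc m n : Finset ℤ)) : m ≤ n := by
  obtain ⟨j, hj, -⟩ := hc 0
  simp only [Finset.coe_Icc, Set.mem_Icc] at hj
  omega

variable (v) in
/-- The socle at a vertex: the vectors killed by both outgoing maps. -/
noncomputable def socle (i : ℤ) : Submodule k (v.V i) :=
  LinearMap.ker (v.up i) ⊓ LinearMap.ker (v.pathMap i (i - 1))

theorem mem_socle_succ {i : ℤ} {x : v.V (i + 1)} :
    x ∈ v.socle (i + 1) ↔ v.up (i + 1) x = 0 ∧ v.down i x = 0 := by
  rw [socle]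
  have : i + 1 - 1 = i := by ring
  rw [this, pathMap_pred]
  simp

theorem socle_eq_bot {m n : ℤ} (hc : v.HasCosupport (Finset.Icc m n : Finset ℤ)) {i : ℤ}
    (hi : i < m ∨ n < i) : v.socle i = ⊥ := by
  obtain ⟨i, rfl⟩ : ∃ j, i = j + 1 := ⟨i - 1, by ring⟩
  rw [eq_bot_iff]
  intro x hx
  rw [mem_socle_succ] at hx
  rcases hi with hi | hi
  · exact hc.up_injective hi (by simpa using hx.1)
  · exact hc.down_injective (i := i) (by omega) (by simpa using hx.2)

/-- Beyond the cosupport the maps pointing inwards are injective, so by exactness the maps pointing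
outwards have zero image. -/
theorem IsExact.up_eq_zero (he : v.IsExact) {m n : ℤ}
    (hc : v.HasCosupport (Finset.Icc m n : Finset ℤ)) {i : ℤ} (hi : n ≤ i) : v.up i = 0 := by
  rw [← LinearMap.range_eq_bot, ← (he i).2, LinearMap.ker_eq_bot]
  exact hc.down_injective hi

theorem IsExact.down_eq_zero (he : v.IsExact) {m n : ℤ}
    (hc : v.HasCosupport (Finset.Icc m n : Finset ℤ)) {i : ℤ} (hi : i < m) : v.down i = 0 := by
  rw [← LinearMap.range_eq_bot, ← (he i).1, LinearMap.ker_eq_bot]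
  exact hc.up_injective hi

/-- By exactness the socle is the intersection of the images of the two incoming maps. These images
span, which gives its dimension, and rank-nullity turns the rank of `down (i + 1)` into `r` minus
the rank of `up (i + 1)`. -/
theorem finrank_socle (he : v.IsExact) (hcl : v.IsColinkedChain) {r : ℕ} (hr : v.HasPureDim r)
    (i : ℤ) : Module.finrank k (v.socle (i + 1)) + Module.finrank k (LinearMap.range (v.up (i + 1)))
      = Module.finrank k (LinearMap.range (v.up i)) := by
  have h1 : v.socle (i + 1) = LinearMap.range (v.down (i + 1)) ⊓ LinearMap.range (v.up i) := by
    ext x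
    rw [mem_socle_succ, ← (he (i + 1)).1, ← (he i).2]
    rfl
  have h2 := Submodule.finrank_sup_add_finrank_inf_eq
    (LinearMap.range (v.down (i + 1))) (LinearMap.range (v.up i))
  rw [hcl.2 i, finrank_top, hr, ← h1, ← (he (i + 1)).1] at h2
  have h3 := LinearMap.finrank_range_add_finrank_ker (v.up (i + 1))
  rw [hr] at h3
  omega

/-- The sum telescopes from the rank of the injective map `up (m - 1)`, which is `r`, down to the
rank of `up n`, which is zero. -/
theorem sum_finrank_socle (he : v.IsExact) (hcl : v.IsColinkedChain) {r : ℕ}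
    (hr : v.HasPureDim r) {m n : ℤ} (hc : v.HasCosupport (Finset.Icc m n : Finset ℤ)) :
    ∑ i : Finset.Icc m n, Module.finrank k (v.socle i) = r := by
  have key : ∀ l : ℕ, ∑ i ∈ Finset.Icc m (m - 1 + l), Module.finrank k (v.socle i) +
      Module.finrank k (LinearMap.range (v.up (m - 1 + l))) = r := by
    intro l
    induction l with
    | zero =>
      simp only [Nat.cast_zero, add_zero]
      rw [Finset.Icc_eq_empty (by omega), Finset.sum_empty, zero_add,
        LinearMap.finrank_range_of_inj (hc.up_injective (by omega)), hr]
    | succ l ih =>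
      have e : m - 1 + ((l + 1 : ℕ) : ℤ) = m - 1 + l + 1 := by push_cast; ring
      have e2 : Finset.Icc m (m - 1 + l + 1) =
          insert (m - 1 + l + 1) (Finset.Icc m (m - 1 + (l : ℤ))) := by
        ext; simp only [Finset.mem_Icc, Finset.mem_insert]; omega
      rw [e, e2, Finset.sum_insert (by simp), ← ih,
        ← finrank_socle he hcl hr (m - 1 + l)]
      omega
  have hmn := hc.le
  have := key (n - (m - 1)).toNat
  rw [show m - 1 + ((n - (m - 1)).toNat : ℤ) = n by omega, he.up_eq_zero hc le_rfl,
    LinearMap.range_zero, finrank_bot, add_zero] at this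
  rw [← this]
  exact Finset.sum_coe_sort (Finset.Icc m n) (fun i => Module.finrank k (v.socle i))

/-- Coordinates in which every map of the representation keeps some coordinates and kills the
others: the coordinate with index `b` is carried towards the vertex `t b`. -/
theorem exists_coordinates (he : v.IsExact) (hcl : v.IsColinkedChain) {r : ℕ}
    (hr : v.HasPureDim r) {m n : ℤ} (hc : v.HasCosupport (Finset.Icc m n : Finset ℤ)) :
    ∃ (t : Fin r → ℤ) (ξ : ∀ i, v.V i ≃ₗ[k] (Fin r → k)),
      (∀ b, m ≤ t b ∧ t b ≤ n) ∧
      (∀ i x b, ξ (i + 1) (v.up i x) b = if i < t b then ξ i x b else 0) ∧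
      (∀ i x b, ξ i (v.down i x) b = if t b ≤ i then ξ (i + 1) x b else 0) := by
  have hsp := hcl.1
  -- `φ i` is a linear retraction of `V i` onto its socle. The coordinates of a vector will be the
  -- retractions of its images along the direct paths to all vertices of the interval.
  choose φ hφ using fun i => LinearMap.exists_leftInverse_of_injective (v.socle i).subtype
    (Submodule.ker_subtype _)
  have hφ' : ∀ i, ∀ x ∈ v.socle i, x ≠ 0 → φ i x ≠ 0 := by
    intro i x hx hx0 h
    have := LinearMap.congr_fun (hφ i) ⟨x, hx⟩
    simp only [LinearMap.comp_apply, Submodule.subtype_apply, LinearMap.id_apply] at this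
    rw [h] at this
    exact hx0 (congrArg Subtype.val this).symm
  have hmem : ∀ i, ∀ x ∈ v.socle i, x ≠ 0 → i ∈ Finset.Icc m n := by
    intro i x hx hx0
    by_contra hi
    rw [socle_eq_bot hc (by simp only [Finset.mem_Icc] at hi; omega)] at hx
    exact hx0 (by simpa using hx)
  let Φ : ∀ i, v.V i →ₗ[k] (∀ j : Finset.Icc m n, v.socle j) :=
    fun i => LinearMap.pi fun j => (φ j).comp (v.pathMap i j)
  -- Push `x` upwards until the next map kills it, which happens at `n` at the latest. The last
  -- nonzero image is also killed by the downward map, as it comes from below, so it lies in a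
  -- socle, where `φ` is injective.
  have hup : ∀ (l : ℕ) (i : ℤ), n ≤ i + l → ∀ x, v.up i x ≠ 0 →
      ∃ j : Finset.Icc m n, φ j (v.pathMap i j x) ≠ 0 := by
    intro l
    induction l with
    | zero =>
      intro i hi x hx
      rw [he.up_eq_zero hc (by simpa using hi)] at hx
      exact absurd rfl hx
    | succ l ih =>
      intro i hi x hx
      by_cases h : v.up (i + 1) (v.up i x) = 0
      · have hs : v.up i x ∈ v.socle (i + 1) := by
          rw [mem_socle_succ]
          exact ⟨h, LinearMap.congr_fun (hsp i).1 x⟩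
        refine ⟨⟨i + 1, hmem _ _ hs hx⟩, ?_⟩
        rw [pathMap_succ]
        exact hφ' _ _ hs hx
      · obtain ⟨j, hj⟩ := ih (i + 1) (by push_cast at hi; omega) _ h
        rw [hsp.pathMap_up] at hj
        split_ifs at hj with hh
        · exact ⟨j, hj⟩
        · exact absurd (map_zero _) hj
  have hdown : ∀ (l : ℕ) (i : ℤ), i < m + l → ∀ x, v.down i x ≠ 0 →
      ∃ j : Finset.Icc m n, φ j (v.pathMap (i + 1) j x) ≠ 0 := by
    intro l
    induction l with
    | zero =>
      intro i hi x hx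
      rw [he.down_eq_zero hc (by simpa using hi)] at hx
      exact absurd rfl hx
    | succ l ih =>
      intro i hi x hx
      obtain ⟨i, rfl⟩ : ∃ j, i = j + 1 := ⟨i - 1, by ring⟩
      by_cases h : v.down i (v.down (i + 1) x) = 0
      · have hs : v.down (i + 1) x ∈ v.socle (i + 1) := by
          rw [mem_socle_succ]
          exact ⟨LinearMap.congr_fun (hsp (i + 1)).2 x, h⟩
        refine ⟨⟨i + 1, hmem _ _ hs hx⟩, ?_⟩
        rw [pathMap_pred]
        exact hφ' _ _ hs hx
      · obtain ⟨j, hj⟩ := ih i (by push_cast at hi; omega) _ h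
        rw [hsp.pathMap_down] at hj
        split_ifs at hj with hh
        · exact ⟨j, hj⟩
        · exact absurd (map_zero _) hj
  have hinj : ∀ i, Function.Injective (Φ i) := by
    intro i
    rw [← LinearMap.ker_eq_bot, eq_bot_iff]
    intro x hx
    by_contra hx0
    have hx0 : x ≠ 0 := hx0
    have hall : ∀ j : Finset.Icc m n, φ j (v.pathMap i j x) = 0 := fun j => congrFun hx j
    obtain ⟨i, rfl⟩ : ∃ j, i = j + 1 := ⟨i - 1, by ring⟩
    by_cases h1 : v.up (i + 1) x = 0
    · by_cases h2 : v.down i x = 0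
      · have hs : x ∈ v.socle (i + 1) := mem_socle_succ.2 ⟨h1, h2⟩
        have := hall ⟨i + 1, hmem _ _ hs hx0⟩
        rw [pathMap_self] at this
        exact hφ' _ _ hs hx0 this
      · obtain ⟨j, hj⟩ := hdown (i + 1 - m).toNat i (by omega) x h2
        exact hj (hall j)
    · obtain ⟨j, hj⟩ := hup (n - (i + 1)).toNat (i + 1) (by omega) x h1
      exact hj (hall j)
  -- Source and target have the same dimension, so injectivity of `Φ i` suffices.
  have hrank : Module.finrank k (∀ j : Finset.Icc m n, v.socle j) = r := by
    rw [Module.finrank_pi_fintype, sum_finrank_socle he hcl hr hc]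
  let E : ∀ i, v.V i ≃ₗ[k] (∀ j : Finset.Icc m n, v.socle j) := fun i =>
    LinearEquiv.ofInjectiveOfFinrankEq (Φ i) (hinj i) (by rw [hr, hrank])
  let β := Pi.basis (fun j : Finset.Icc m n => Module.finBasis k (v.socle j))
  have hcard : Fintype.card (Σ j : Finset.Icc m n, Fin (Module.finrank k (v.socle j))) = r := by
    rw [← hrank, Module.finrank_eq_card_basis β]
  let e := Fintype.equivFinOfCardEq hcard
  refine ⟨fun b => (e.symm b).1, fun i => E i ≪≫ₗ (β.reindex e).equivFun, ?_, ?_, ?_⟩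
  · intro b
    exact Finset.mem_Icc.1 (e.symm b).1.2
  · intro i x b
    have : E (i + 1) (v.up i x) (e.symm b).1 =
        if i < (e.symm b).1 then E i x (e.symm b).1 else 0 := by
      change φ _ (v.pathMap _ _ _) = if _ then φ _ (v.pathMap _ _ _) else 0
      rw [hsp.pathMap_up, apply_ite (φ _), map_zero]
      rfl
    simp only [LinearEquiv.trans_apply, Module.Basis.equivFun_apply,
        Module.Basis.repr_reindex_apply, β,
      Pi.basis_repr, this]
    split_ifs <;> simp
  · intro i x b
    have : E i (v.down i x) (e.symm b).1 =
        if ((e.symm b).1 : ℤ) ≤ i then E (i + 1) x (e.symm b).1 else 0 := by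
      change φ _ (v.pathMap _ _ _) = if _ then φ _ (v.pathMap _ _ _) else 0
      rw [hsp.pathMap_down, apply_ite (φ _), map_zero]
    simp only [LinearEquiv.trans_apply, Module.Basis.equivFun_apply,
        Module.Basis.repr_reindex_apply, β,
      Pi.basis_repr, this]
    split_ifs <;> simp

end Coordinates

end ZRep

/-! ### The equations in adapted coordinates, over an arbitrary ring -/

namespace LinkedChain

/-- On a coordinate carried towards the vertex `s`, the direct path from `i` to `j` is nonzero. -/
def Carries (s i j : ℤ) : Prop := (i ≤ j ∧ j ≤ s) ∨ (j ≤ i ∧ s ≤ j)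

instance (s i j : ℤ) : Decidable (Carries s i j) := inferInstanceAs (Decidable (_ ∨ _))

/-- The flow with directions `d` (where `d e` tells if the arrow between `e` and `e + 1` goes up)
leads from `i` to `s`. -/
def Reach (d : ℤ → Bool) (s i : ℤ) : Prop :=
  (∀ e, i ≤ e → e < s → d e = true) ∧ (∀ e, s ≤ e → e < i → d e = false)

theorem reach_self (d : ℤ → Bool) (s : ℤ) : Reach d s s :=
  ⟨fun e h h' => absurd h (by omega), fun e h h' => absurd h (by omega)⟩

/-- When the edge above `i` points up, the flow from `i + 1` cannot return to `i`. It reaches only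
vertices above `i`, and the flow from `i` reaches these through that edge. -/
theorem reach_succ_iff {d : ℤ → Bool} {s i : ℤ} (h : d i = true) :
    Reach d s (i + 1) ↔ i < s ∧ Reach d s i := by
  constructor
  · rintro ⟨h1, h2⟩
    have his : i < s := by
      by_contra hc
      have := h2 i (by omega) (by omega)
      simp [h] at this
    refine ⟨his, fun e he he' => ?_, fun e he he' => absurd he (by omega)⟩
    rcases eq_or_lt_of_le he with rfl | he
    · exact h
    · exact h1 e he he'
  · rintro ⟨his, h1, h2⟩
    exact ⟨fun e he he' => h1 e (by omega) he', fun e he he' => absurd he (by omega)⟩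

theorem reach_iff_succ {d : ℤ → Bool} {s i : ℤ} (h : d i = false) :
    Reach d s i ↔ s ≤ i ∧ Reach d s (i + 1) := by
  constructor
  · rintro ⟨h1, h2⟩
    have his : s ≤ i := by
      by_contra hc
      have := h1 i le_rfl (by omega)
      simp [h] at this
    refine ⟨his, fun e he he' => absurd he (by omega), fun e he he' => ?_⟩
    rcases eq_or_lt_of_le (Int.lt_add_one_iff.1 he') with rfl | he'
    · exact h
    · exact h2 e he he'
  · rintro ⟨his, h1, h2⟩
    exact ⟨fun e he he' => absurd he (by omega), fun e he he' => h2 e he (by omega)⟩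

section Ring

variable {A : Type*} [CommRing A] {r : ℕ} {t : Fin r → ℤ} {m n : ℤ}

/-- The vectors `y i`, `m ≤ i ≤ n`, are stable under the maps of the chain, with given scalars. -/
structure ChainRel (t : Fin r → ℤ) (m n : ℤ) (y : ℤ → Fin r → A) (l μ : ℤ → A) : Prop where
  up : ∀ i, m ≤ i → i < n → ∀ b, (if i < t b then y i b else 0) = l i * y (i + 1) b
  down : ∀ i, m ≤ i → i < n → ∀ b, (if t b ≤ i then y (i + 1) b else 0) = μ i * y i b

/-- The vectors `y i`, `m ≤ i ≤ n`, satisfy the equations of the linked projective space. -/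
def Minors (t : Fin r → ℤ) (m n : ℤ) (y : ℤ → Fin r → A) : Prop :=
  ∀ i j, m ≤ i → i ≤ n → m ≤ j → j ≤ n → ∀ b b',
    (if Carries (t b) i j then y i b else 0) * y j b' =
      (if Carries (t b') i j then y i b' else 0) * y j b

def Unimodular (m n : ℤ) (y : ℤ → Fin r → A) : Prop :=
  ∀ i, m ≤ i → i ≤ n → ∃ c : Fin r → A, ∑ b, c b * y i b = 1

variable {y : ℤ → Fin r → A} {l μ : ℤ → A}

/-- The factor is the product of the `l` or of the `μ` along the direct path. -/
theorem ChainRel.exists_path (h : ChainRel t m n y l μ) (i j : ℤ) (hi : m ≤ i) (hi' : i ≤ n)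
    (hj : m ≤ j) (hj' : j ≤ n) :
    ∃ c : A, ∀ b, (if Carries (t b) i j then y i b else 0) = c * y j b := by
  rcases le_total i j with hij | hij
  · obtain ⟨q, rfl⟩ : ∃ q : ℕ, j = i + q := ⟨(j - i).toNat, by omega⟩
    clear hij
    induction q with
    | zero => exact ⟨1, fun b => by simp [Carries, le_total]⟩
    | succ q ih =>
      push_cast at hj hj' ⊢
      obtain ⟨c, hc⟩ := ih (by omega) (by omega)
      refine ⟨c * l (i + q), fun b => ?_⟩
      have h1 := h.up (i + q) (by omega) (by omega) b
      rw [← add_assoc, mul_assoc, ← h1, mul_ite, mul_zero, ← hc]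
      have : Carries (t b) i (i + q + 1) ↔ i + q < t b ∧ Carries (t b) i (i + q) := by
        unfold Carries; omega
      simp only [this, ite_and]
  · obtain ⟨q, rfl⟩ : ∃ q : ℕ, j = i - q := ⟨(i - j).toNat, by omega⟩
    clear hij
    induction q with
    | zero => exact ⟨1, fun b => by simp [Carries, le_total]⟩
    | succ q ih =>
      push_cast at hj hj' ⊢
      obtain ⟨c, hc⟩ := ih (by omega) (by omega)
      refine ⟨c * μ (i - (q + 1)), fun b => ?_⟩
      have h1 := h.down (i - (q + 1)) (by omega) (by omega) b
      rw [show i - ((q : ℤ) + 1) + 1 = i - q by ring] at h1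
      rw [mul_assoc, ← h1, mul_ite, mul_zero, ← hc]
      have : Carries (t b) i (i - (q + 1)) ↔ t b ≤ i - (q + 1) ∧ Carries (t b) i (i - q) := by
        unfold Carries; omega
      simp only [this, ite_and]

theorem ChainRel.minors (h : ChainRel t m n y l μ) : Minors t m n y := by
  intro i j hi hi' hj hj' b b'
  obtain ⟨c, hc⟩ := h.exists_path i j hi hi' hj hj'
  rw [hc, hc]
  ring

/-- Applying to `x` the linear form that takes the value `1` at `y` gives the factor; no division is
needed, so this works over any ring. -/
theorem exists_proportional {x y : Fin r → A} (hu : ∃ c : Fin r → A, ∑ b, c b * y b = 1)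
    (h : ∀ b b', x b * y b' = x b' * y b) : ∃ a : A, ∀ b, x b = a * y b := by
  obtain ⟨c, hc⟩ := hu
  refine ⟨∑ b', c b' * x b', fun b => ?_⟩
  calc x b = ∑ b', c b' * y b' * x b := by rw [← Finset.sum_mul, hc, one_mul]
    _ = _ := by
      rw [Finset.sum_mul]
      refine Finset.sum_congr rfl fun b' _ => ?_
      linear_combination c b' * h b b'

/-- Only the minors between neighbouring vertices are used. With `ChainRel.minors` it follows that,
for unimodular families, the equations for all pairs of vertices are equivalent to stability under
the arrows. -/
theorem Minors.exists_chainRel (h : Minors t m n y) (hu : Unimodular m n y) :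
    ∃ l μ : ℤ → A, ChainRel t m n y l μ := by
  have h1 : ∀ i, ∃ a : A, m ≤ i → i < n → ∀ b, (if i < t b then y i b else 0) =
      a * y (i + 1) b := by
    intro i
    by_cases hi : m ≤ i ∧ i < n
    · obtain ⟨a, ha⟩ := exists_proportional (hu (i + 1) (by omega) (by omega))
        (h i (i + 1) (by omega) (by omega) (by omega) (by omega))
      refine ⟨a, fun _ _ b => ?_⟩
      rw [← ha]
      have : Carries (t b) i (i + 1) ↔ i < t b := by unfold Carries; omega
      simp only [this]
    · exact ⟨0, fun h1 h2 => absurd ⟨h1, h2⟩ hi⟩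
  have h2 : ∀ i, ∃ a : A, m ≤ i → i < n → ∀ b, (if t b ≤ i then y (i + 1) b else 0) =
      a * y i b := by
    intro i
    by_cases hi : m ≤ i ∧ i < n
    · obtain ⟨a, ha⟩ := exists_proportional (hu i (by omega) (by omega))
        (h (i + 1) i (by omega) (by omega) (by omega) (by omega))
      refine ⟨a, fun _ _ b => ?_⟩
      rw [← ha]
      have : Carries (t b) (i + 1) i ↔ t b ≤ i := by unfold Carries; omega
      simp only [this]
    · exact ⟨0, fun h1 h2 => absurd ⟨h1, h2⟩ hi⟩
  choose l hl using h1
  choose μ hμ using h2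
  exact ⟨l, μ, hl, hμ⟩

/-- No coordinate survives both arrows, since one needs `i < t b` and the other `t b ≤ i`. The
product thus kills every entry of a unimodular vector. -/
theorem ChainRel.mul_eq_zero (h : ChainRel t m n y l μ) (hu : Unimodular m n y) {i : ℤ}
    (hi : m ≤ i) (hi' : i < n) : l i * μ i = 0 := by
  obtain ⟨c, hc⟩ := hu i hi hi'.le
  have : ∀ b, l i * μ i * y i b = 0 := by
    intro b
    rw [mul_assoc, ← h.down i hi hi' b]
    split_ifs with hb
    · rw [← h.up i hi hi' b, if_neg (by omega)]
    · rw [mul_zero]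
  calc l i * μ i = ∑ b, c b * (l i * μ i * y i b) := by
        rw [← mul_one (l i * μ i)]
        conv_lhs => rw [← hc, Finset.mul_sum]
        exact Finset.sum_congr rfl fun b _ => by ring
    _ = 0 := by simp [this]

theorem exists_units_succ (ρ : ℤ → Aˣ) (m : ℤ) :
    ∃ a : ℤ → Aˣ, ∀ i, m ≤ i → a (i + 1) = a i * ρ i := by
  refine ⟨fun i => ∏ q ∈ Finset.range (i - m).toNat, ρ (m + q), fun i hi => ?_⟩
  have : (i + 1 - m).toNat = (i - m).toNat + 1 := by omega
  simp only [this]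
  rw [Finset.prod_range_succ, show m + ((i - m).toNat : ℤ) = i by omega]

open Classical in
/-- A stable family of vectors whose maps are nonzero along the flow `d` is given by one vector
`z`, up to rescaling. -/
theorem ChainRel.exists_eq_reach (h : ChainRel t m n y l μ) (ht : ∀ b, m ≤ t b ∧ t b ≤ n)
    {d : ℤ → Bool} (hl : ∀ i, m ≤ i → i < n → d i = true → IsUnit (l i))
    (hμ : ∀ i, m ≤ i → i < n → d i = false → IsUnit (μ i)) :
    ∃ (a : ℤ → Aˣ) (z : Fin r → A), ∀ i, m ≤ i → i ≤ n → ∀ b,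
      y i b = a i * (if Reach d (t b) i then z b else 0) := by
  -- `ρ i` is the ratio of the scales at `i + 1` and `i` for which the map along the flow becomes an
  -- identity with truncation: the inverse of `l i` on an upward edge, `μ i` on a downward one.
  have hρ : ∀ i, ∃ ρ : Aˣ, m ≤ i → i < n → (d i = true → l i = ↑ρ⁻¹) ∧ (d i = false → μ i = ρ) := by
    intro i
    by_cases hi : m ≤ i ∧ i < n
    · cases hd : d i with
      | true =>
        obtain ⟨ρ, hρ⟩ := hl i hi.1 hi.2 hd
        exact ⟨ρ⁻¹, fun _ _ => ⟨fun _ => by rw [inv_inv, hρ], by simp⟩⟩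
      | false =>
        obtain ⟨ρ, hρ⟩ := hμ i hi.1 hi.2 hd
        exact ⟨ρ, fun _ _ => ⟨by simp, fun _ => hρ.symm⟩⟩
    · exact ⟨1, fun h1 h2 => absurd ⟨h1, h2⟩ hi⟩
  choose ρ hρ using hρ
  obtain ⟨a, ha⟩ := exists_units_succ ρ m
  have hT : ∀ i, m ≤ i → i < n → d i = true → ∀ b,
      (↑(a (i + 1))⁻¹ : A) * y (i + 1) b = if i < t b then (↑(a i)⁻¹ : A) * y i b else 0 := by
    intro i hi hi' hd b
    have h1 := h.up i hi hi' b
    rw [((hρ i hi hi').1 hd)] at h1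
    rw [ha i hi, mul_inv, Units.val_mul, mul_assoc, ← h1, mul_ite, mul_zero]
  have hF : ∀ i, m ≤ i → i < n → d i = false → ∀ b,
      (↑(a i)⁻¹ : A) * y i b = if t b ≤ i then (↑(a (i + 1))⁻¹ : A) * y (i + 1) b else 0 := by
    intro i hi hi' hd b
    have h1 := h.down i hi hi' b
    rw [((hρ i hi hi').2 hd)] at h1
    have h2 : (↑(a (i + 1))⁻¹ : A) * (if t b ≤ i then y (i + 1) b else 0) = ↑(a i)⁻¹ * y i b := by
      rw [h1, ha i hi, mul_inv, Units.val_mul, mul_assoc, Units.inv_mul_cancel_left]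
    rw [← h2, mul_ite, mul_zero]
  -- The coordinate `b` is never truncated at its own peak, so `z b` is read there.
  refine ⟨a, fun b => (↑(a (t b))⁻¹ : A) * y (t b) b, ?_⟩
  -- Induction on the distance from the peak `t b`: crossing an edge that points towards the peak
  -- keeps the rescaled coordinate, and crossing one that points away from it makes it zero.
  have key : ∀ b i, m ≤ i → i ≤ n → (↑(a i)⁻¹ : A) * y i b =
      if Reach d (t b) i then (↑(a (t b))⁻¹ : A) * y (t b) b else 0 := by
    intro b i hi hi'
    obtain ⟨htm, htn⟩ := ht b
    rcases le_total (t b) i with hij | hij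
    · obtain ⟨q, rfl⟩ : ∃ q : ℕ, i = t b + q := ⟨(i - t b).toNat, by omega⟩
      clear hij
      induction q with
      | zero => simp [reach_self]
      | succ q ih =>
        push_cast at hi hi' ⊢
        have ih := ih (by omega) (by omega)
        rw [← add_assoc]
        cases hd : d (t b + q) with
        | true =>
          rw [hT _ (by omega) (by omega) hd, if_neg (by omega), if_neg]
          rw [reach_succ_iff hd]
          omega
        | false =>
          have h1 := hF _ (by omega) (by omega) hd b
          rw [if_pos (by omega)] at h1
          rw [← h1, ih]
          have : Reach d (t b) (t b + q) ↔ Reach d (t b) (t b + q + 1) := by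
            rw [reach_iff_succ hd]
            exact and_iff_right (by omega)
          simp only [this]
    · obtain ⟨q, rfl⟩ : ∃ q : ℕ, i = t b - q := ⟨(t b - i).toNat, by omega⟩
      clear hij
      induction q with
      | zero => simp [reach_self]
      | succ q ih =>
        push_cast at hi hi' ⊢
        have ih := ih (by omega) (by omega)
        have e : t b - ((q : ℤ) + 1) + 1 = t b - q := by ring
        cases hd : d (t b - ((q : ℤ) + 1)) with
        | false =>
          rw [hF _ (by omega) (by omega) hd, if_neg (by omega), if_neg]
          rw [reach_iff_succ hd]
          omega
        | true =>
          have h1 := hT _ (by omega) (by omega) hd b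
          rw [if_pos (by omega)] at h1
          rw [← h1, e, ih]
          have : Reach d (t b) (t b - q) ↔ Reach d (t b) (t b - (q + 1)) := by
            rw [← e, reach_succ_iff hd]
            exact and_iff_right (by omega)
          simp only [this]
  intro i hi hi' b
  rw [← key b i hi hi', Units.mul_inv_cancel_left]

open Classical in
-- Converse of `ChainRel.exists_eq_reach`: any vector `z` gives a stable family. Along the flow the
-- arrow truncates and rescales; against the flow it is zero, because no coordinate present at its
-- source survives it.
theorem chainRel_of_eq_reach {d : ℤ → Bool} {a : ℤ → Aˣ} {z : Fin r → A}
    (h : ∀ i, m ≤ i → i ≤ n → ∀ b, y i b = a i * (if Reach d (t b) i then z b else 0)) :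
    ChainRel t m n y (fun i => if d i = true then ↑(a i * (a (i + 1))⁻¹) else 0)
      (fun i => if d i = true then 0 else ↑(a (i + 1) * (a i)⁻¹)) where
  up i hi hi' b := by
    rw [h i hi hi'.le, h (i + 1) (by omega) (by omega)]
    by_cases hd : d i = true
    · rw [if_pos hd, Units.val_mul, mul_assoc, Units.inv_mul_cancel_left]
      simp only [reach_succ_iff hd, ite_and]
      split_ifs <;> simp
    · rw [if_neg hd, zero_mul]
      have hd : d i = false := by simpa using hd
      simp only [reach_iff_succ hd, ite_and]
      split_ifs
      · omega
      all_goals simp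
  down i hi hi' b := by
    rw [h i hi hi'.le, h (i + 1) (by omega) (by omega)]
    by_cases hd : d i = true
    · rw [if_pos hd, zero_mul]
      simp only [reach_succ_iff hd, ite_and]
      split_ifs
      · omega
      all_goals simp
    · rw [if_neg hd, Units.val_mul, mul_assoc, Units.inv_mul_cancel_left]
      have hd : d i = false := by simpa using hd
      simp only [reach_iff_succ hd, ite_and]
      split_ifs <;> simp

open Classical in
-- Uniqueness of `z` up to one global unit. Across each edge, an invertible coordinate present at
-- both ends forces the ratio of the two scales to be the same at both vertices.
theorem exists_unit_of_eq_reach (ht : ∀ b, m ≤ t b ∧ t b ≤ n) {d : ℤ → Bool} {a a' : ℤ → Aˣ}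
    {z z' : Fin r → A}
    (h : ∀ i, m ≤ i → i ≤ n → ∀ b, a i * (if Reach d (t b) i then z b else 0) =
      a' i * (if Reach d (t b) i then z' b else 0))
    (hb : ∀ i, m ≤ i → i < n → ∃ b, Reach d (t b) i ∧ Reach d (t b) (i + 1) ∧ IsUnit (z b)) :
    ∃ s : Aˣ, ∀ b, z' b = s * z b := by
  have key : ∀ q : ℕ, m + q ≤ n → a (m + q) * (a' (m + q))⁻¹ = a m * (a' m)⁻¹ := by
    intro q
    induction q with
    | zero => simp
    | succ q ih =>
      intro hq
      push_cast at hq ⊢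
      rw [← ih (by omega), ← add_assoc]
      obtain ⟨b, h1, h2, ⟨ζ, hζ⟩⟩ := hb (m + q) (by omega) (by omega)
      have e1 := h (m + q) (by omega) (by omega) b
      have e2 := h (m + q + 1) (by omega) (by omega) b
      rw [if_pos h1, if_pos h1] at e1
      rw [if_pos h2, if_pos h2] at e2
      rw [← div_eq_mul_inv, ← div_eq_mul_inv, div_eq_div_iff_mul_eq_mul]
      ext
      rw [← ζ.mul_left_inj, Units.val_mul, Units.val_mul, hζ]
      linear_combination (a' (m + q) : A) * e2 - (a' (m + q + 1) : A) * e1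
  refine ⟨a m * (a' m)⁻¹, fun b => ?_⟩
  have e1 := h (t b) (ht b).1 (ht b).2 b
  rw [if_pos (reach_self _ _), if_pos (reach_self _ _)] at e1
  have := key (t b - m).toNat (by have := ht b; omega)
  rw [show m + ((t b - m).toNat : ℤ) = t b by have := ht b; omega] at this
  rw [← this, Units.val_mul, mul_right_comm, e1, mul_right_comm, Units.mul_inv, one_mul]

/-- If both maps between `e` and `e + 1` are zero, then a stable family of vectors can be deformed
so that the upward map becomes nonzero. -/
theorem ChainRel.deform {B : Type*} [CommRing B] [Algebra A B]
    (h : ChainRel t m n y l μ) (hlμ : ∀ i, m ≤ i → i < n → l i * μ i = 0) {e : ℤ}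
    (he : m ≤ e) (he' : e < n) (hl : l e = 0) (hμ : μ e = 0) (s : B) :
    ∃ (κ : ℤ → A) (l' μ' : ℤ → B), κ e = 1 ∧
      ChainRel t m n (fun i b => algebraMap A B (y i b) +
        (if i ≤ e then s * algebraMap A B (κ i * y (e + 1) b) else 0)) l' μ' := by
  -- The term added at `i` must be compatible with the upward maps below `e`, which forces `κ i = l
  -- i * κ (i + 1)`; the start is `κ e = 1`.
  let κ : ℤ → A := fun i => ∏ j ∈ Finset.Ico i e, l j
  have hκe : κ e = 1 := by simp [κ]
  have hκ : ∀ i, i < e → κ i = l i * κ (i + 1) := by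
    intro i hi
    have : Finset.Ico i e = insert i (Finset.Ico (i + 1) e) := by
      ext; simp only [Finset.mem_Ico, Finset.mem_insert]; omega
    simp only [κ]
    rw [this, Finset.prod_insert (by simp)]
  have hκμ : ∀ i, m ≤ i → i ≤ e → κ i * μ i = 0 := by
    intro i hi hi'
    rcases eq_or_lt_of_le hi' with rfl | hi'
    · rw [hμ, mul_zero]
    · rw [hκ i hi', mul_right_comm, hlμ i hi (by omega), zero_mul]
  -- As `μ e = 0`, the vector at `e + 1` only involves peaks above `e`. The upward maps up to `e`
  -- therefore do not truncate the added term, and the downward maps below `e` kill it.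
  have hsupp : ∀ b, t b ≤ e → y (e + 1) b = 0 := by
    intro b hb
    have := h.down e he he' b
    rwa [if_pos hb, hμ, zero_mul] at this
  -- Only one scalar changes: that of the upward map at `e`, from zero to `s`.
  refine ⟨κ, fun i => if i = e then s else algebraMap A B (l i), fun i => algebraMap A B (μ i), hκe,
    ⟨fun i hi hi' b => ?_, fun i hi hi' b => ?_⟩⟩
  · have h1 := h.up i hi hi' b
    apply_fun algebraMap A B at h1
    rw [apply_ite (algebraMap A B), map_zero, map_mul] at h1
    rcases lt_trichotomy i e with hie | hie | hie
    · rw [if_pos hie.le, if_neg hie.ne, if_pos (show i + 1 ≤ e by omega), mul_add, ← h1, hκ i hie]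
      by_cases hb : i < t b
      · simp only [if_pos hb, map_mul]; ring
      · simp only [if_neg hb, hsupp b (by omega), mul_zero, map_zero, add_zero]
    · rw [hie, if_pos le_rfl, if_pos rfl, if_neg (show ¬ e + 1 ≤ e by omega), hκe, add_zero,
        one_mul]
      rw [hie, hl, map_zero, zero_mul] at h1
      by_cases hb : e < t b
      · rw [if_pos hb] at h1 ⊢
        rw [h1, zero_add]
      · rw [if_neg hb, hsupp b (by omega), map_zero, mul_zero]
    · rw [if_neg (show ¬ i ≤ e by omega), if_neg hie.ne', if_neg (show ¬ i + 1 ≤ e by omega),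
        add_zero, add_zero, h1]
  · have h1 := h.down i hi hi' b
    apply_fun algebraMap A B at h1
    rw [apply_ite (algebraMap A B), map_zero, map_mul] at h1
    by_cases hie : i ≤ e
    · have h2 := congrArg (algebraMap A B) (hκμ i hi hie)
      rw [map_mul, map_zero] at h2
      have h3 : algebraMap A B (μ i) * (s * algebraMap A B (κ i * y (e + 1) b)) = 0 := by
        rw [map_mul]
        linear_combination s * algebraMap A B (y (e + 1) b) * h2
      rw [if_pos hie, mul_add, ← h1, h3, add_zero]
      by_cases hb : t b ≤ i
      · rw [if_pos hb, if_pos hb, hsupp b (by omega)]; simp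
      · rw [if_neg hb, if_neg hb]
    · rw [if_neg hie, if_neg (show ¬ i + 1 ≤ e by omega), add_zero, add_zero, h1]

end Ring

end LinkedChain

namespace ZRep

variable {k : Type u} [Field k] {v : ZRep.{u, w} k}

open LinkedChain in
theorem coordinates_pathMap {r : ℕ} {t : Fin r → ℤ} {ξ : ∀ i, v.V i ≃ₗ[k] (Fin r → k)}
    (hup : ∀ i x b, ξ (i + 1) (v.up i x) b = if i < t b then ξ i x b else 0)
    (hdown : ∀ i x b, ξ i (v.down i x) b = if t b ≤ i then ξ (i + 1) x b else 0)
    (i j : ℤ) (x : v.V i) (b : Fin r) :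
    ξ j (v.pathMap i j x) b = if Carries (t b) i j then ξ i x b else 0 := by
  rcases le_total i j with hij | hij
  · obtain ⟨q, hq⟩ : ∃ q : ℕ, j = i + q := ⟨(j - i).toNat, by omega⟩
    clear hij
    induction q generalizing i with
    | zero =>
      obtain rfl : j = i := by simpa using hq
      rw [if_pos (by unfold Carries; omega), pathMap_self, LinearMap.id_apply]
    | succ q ih =>
      rw [pathMap_of_lt v (by omega), LinearMap.comp_apply,
        ih _ _ (by rw [hq]; push_cast; ring), hup, ← ite_and]
      congr 1
      apply propext
      unfold Carries
      omega
  · obtain ⟨q, rfl⟩ : ∃ q : ℕ, j = i - q := ⟨(i - j).toNat, by omega⟩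
    clear hij
    induction q with
    | zero =>
      rw [if_pos (by unfold Carries; omega), Nat.cast_zero, sub_zero, pathMap_self,
        LinearMap.id_apply]
    | succ q ih =>
      have e : i - ((q + 1 : ℕ) : ℤ) + 1 = i - q := by push_cast; ring
      rw [← e] at ih
      rw [pathMap_of_gt v (by omega), LinearMap.comp_apply, hdown, ih, ← ite_and]
      congr 1
      apply propext
      unfold Carries
      omega

end ZRep

/-! ### Values of functionals and change of basis -/

namespace LinkedChain

section Eval

variable {k : Type*} [Field k] {V V' : Type*} [AddCommGroup V] [Module k V] [AddCommGroup V']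
  [Module k V'] {ι ι' : Type*} [Fintype ι] [Fintype ι'] {A B : Type*} [CommRing A] [CommRing B]

/-- The value of a linear functional at a vector with coordinates `x` in an extension of the
scalars. -/
noncomputable def ev (σ : k →+* A) (β : Module.Basis ι k V) (φ : V →ₗ[k] k) (x : ι → A) : A :=
  ∑ b, σ (φ (β b)) * x b

theorem ev_coord (σ : k →+* A) (β : Module.Basis ι k V) (x : ι → A) (b : ι) :
    ev σ β (β.coord b) x = x b := by
  classical
  simp [ev, Finsupp.single_apply]

theorem ev_ev (σ : k →+* A) (β : Module.Basis ι k V) (β' : Module.Basis ι' k V) (φ : V →ₗ[k] k)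
    (x : ι → A) : ev σ β' φ (fun e => ev σ β (β'.coord e) x) = ev σ β φ x := by
  simp only [ev, Finset.mul_sum, ← mul_assoc, ← map_mul]
  rw [Finset.sum_comm]
  refine Finset.sum_congr rfl fun b _ => ?_
  rw [← Finset.sum_mul, ← map_sum]
  congr 2
  conv_rhs => rw [← β'.sum_repr (β b), map_sum]
  refine Finset.sum_congr rfl fun e _ => ?_
  rw [map_smul, smul_eq_mul, mul_comm]
  rfl

theorem ev_mul (σ : k →+* A) (β : Module.Basis ι k V) (φ : V →ₗ[k] k) (a : A) (x : ι → A) :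
    ev σ β φ (fun b => a * x b) = a * ev σ β φ x := by
  simp only [ev, Finset.mul_sum]
  exact Finset.sum_congr rfl fun b _ => by ring

theorem map_ev (f : A →+* B) (σ : k →+* A) (β : Module.Basis ι k V) (φ : V →ₗ[k] k) (x : ι → A) :
    f (ev σ β φ x) = ev (f.comp σ) β φ (fun b => f (x b)) := by
  simp [ev]

theorem ev_eq_sum (σ : k →+* A) (β : Module.Basis ι k V) (β' : Module.Basis ι' k V)
    (φ : V →ₗ[k] k) (x : ι → A) :
    ev σ β φ x = ∑ e, σ (φ (β' e)) * ev σ β (β'.coord e) x :=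
  (ev_ev σ β β' φ x).symm

/-- The vanishing of the `2 × 2` minors formed by the image of a vector and a vector does not
depend on the basis. -/
theorem minors_iff (σ : k →+* A) (β : Module.Basis ι k V) {κ κ' : Type*} [Fintype κ] [Fintype κ']
    (β' : Module.Basis ι' k V') (γ : Module.Basis κ k V') (γ' : Module.Basis κ' k V')
    (f : V →ₗ[k] V') (x : ι → A) (y : ι' → A)
    (h : ∀ b b', ev σ β (γ.coord b ∘ₗ f) x * ev σ β' (γ.coord b') y =
      ev σ β (γ.coord b' ∘ₗ f) x * ev σ β' (γ.coord b) y) (b b' : κ') :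
    ev σ β (γ'.coord b ∘ₗ f) x * ev σ β' (γ'.coord b') y =
      ev σ β (γ'.coord b' ∘ₗ f) x * ev σ β' (γ'.coord b) y := by
  have key : ∀ φ : V' →ₗ[k] k, ev σ β (φ ∘ₗ f) x =
      ∑ e, σ (φ (γ e)) * ev σ β (γ.coord e ∘ₗ f) x := by
    intro φ
    simp only [ev, Finset.mul_sum]
    rw [Finset.sum_comm]
    refine Finset.sum_congr rfl fun b _ => ?_
    simp only [← mul_assoc, ← map_mul]
    rw [← Finset.sum_mul, ← map_sum]
    congr 2
    conv_lhs => rw [LinearMap.comp_apply, ← γ.sum_repr (f (β b)), map_sum]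
    refine Finset.sum_congr rfl fun e _ => ?_
    rw [map_smul, smul_eq_mul, mul_comm]
    rfl
  -- Each product in the new basis is a bilinear combination of products in the old one. After
  -- exchanging the two summation indices the hypothesis matches them term by term.
  rw [key, key (γ'.coord b'), ev_eq_sum σ β' γ, ev_eq_sum σ β' γ, Finset.sum_mul_sum,
    Finset.sum_mul_sum, Finset.sum_comm]
  refine Finset.sum_congr rfl fun e _ => Finset.sum_congr rfl fun e' _ => ?_
  linear_combination σ (γ'.coord b (γ e')) * σ (γ'.coord b' (γ e)) * h e' e

end Eval

end LinkedChain

/-! ### The coordinate ring of a chart and its minimal primes -/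

namespace ZRep

open LinkedChain

section Chart

variable {k : Type u} [Field k] (v : ZRep.{u, w} k)

/-- Coordinates on a representation in which the maps keep some of the coordinates and kill the
others. -/
structure Coords (r : ℕ) (m n : ℤ) where
  t : Fin r → ℤ
  basis : ∀ i, Module.Basis (Fin r) k (v.V i)
  le_t : ∀ b, m ≤ t b ∧ t b ≤ n
  up : ∀ i x b, (basis (i + 1)).coord b (v.up i x) = if i < t b then (basis i).coord b x else 0
  down : ∀ i x b, (basis i).coord b (v.down i x) =
    if t b ≤ i then (basis (i + 1)).coord b x else 0
  path : ∀ i j x b, (basis j).coord b (v.pathMap i j x) =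
    if Carries (t b) i j then (basis i).coord b x else 0

variable {v} in
theorem exists_coords (he : v.IsExact) (hcl : v.IsColinkedChain) {r : ℕ}
    (hr : v.HasPureDim r) {m n : ℤ} (hc : v.HasCosupport (Finset.Icc m n : Finset ℤ)) :
    Nonempty (v.Coords r m n) := by
  obtain ⟨t, ξ, ht, hup, hdown⟩ := exists_coordinates he hcl hr hc
  exact ⟨⟨t, fun i => .ofEquivFun (ξ i), ht, hup, hdown, coordinates_pathMap hup hdown⟩⟩

variable (H : Finset ℤ)

/-- The choice of a coordinate at each vertex of `H`. -/
abbrev Chart := ∀ i : H, Fin (Module.finrank k (v.V i))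

variable {v H} {A B : Type*} [CommRing A] [CommRing B]

/-- The value of a functional at a vector given by its coordinates in the standard basis. -/
noncomputable abbrev stdEv (σ : k →+* A) {i : ℤ} (φ : v.V i →ₗ[k] k)
    (x : Fin (Module.finrank k (v.V i)) → A) : A :=
  ev σ (Module.finBasis k (v.V i)) φ x

/-- Vectors over `A` satisfying the equations of the linked projective space, normalized as
prescribed by `c`. -/
structure IsPoint (σ : k →+* A) (c : Chart v H)
    (x : ∀ i : H, Fin (Module.finrank k (v.V i)) → A) : Prop where
  apply_eq_one : ∀ i, x i (c i) = 1
  minors : ∀ i j : H, ∀ b b', stdEv σ ((Module.finBasis k (v.V j)).coord b ∘ₗ v.pathMap i j) (x i) *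
    x j b' = stdEv σ ((Module.finBasis k (v.V j)).coord b' ∘ₗ v.pathMap i j) (x i) * x j b

theorem IsPoint.map {σ : k →+* A} {c : Chart v H}
    {x : ∀ i : H, Fin (Module.finrank k (v.V i)) → A} (h : IsPoint σ c x) (f : A →+* B) :
    IsPoint (f.comp σ) c (fun i e => f (x i e)) where
  apply_eq_one i := by rw [h.apply_eq_one, map_one]
  minors i j b b' := by
    have := congrArg f (h.minors i j b b')
    simpa only [map_mul, map_ev] using this

/-- The ideal of the equations of the linked projective space on a chart. -/
noncomputable def chartIdeal (c : Chart v H) :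
    Ideal (MvPolynomial (Σ i : H, Fin (Module.finrank k (v.V i))) k) :=
  Ideal.span (Set.range (fun i : H => MvPolynomial.X ⟨i, c i⟩ - 1) ∪
    Set.range (fun p : Σ ij : H × H, Fin (Module.finrank k (v.V ij.2)) ×
        Fin (Module.finrank k (v.V ij.2)) =>
      stdEv MvPolynomial.C ((Module.finBasis k (v.V p.1.2)).coord p.2.1 ∘ₗ v.pathMap p.1.1 p.1.2)
          (fun e => MvPolynomial.X ⟨p.1.1, e⟩) * MvPolynomial.X ⟨p.1.2, p.2.2⟩ -
        stdEv MvPolynomial.C ((Module.finBasis k (v.V p.1.2)).coord p.2.2 ∘ₗ v.pathMap p.1.1 p.1.2)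
          (fun e => MvPolynomial.X ⟨p.1.1, e⟩) * MvPolynomial.X ⟨p.1.2, p.2.1⟩))

/-- The coordinate ring of the linked projective space on a chart. -/
def ChartRing (c : Chart v H) : Type u :=
  MvPolynomial (Σ i : H, Fin (Module.finrank k (v.V i))) k ⧸ chartIdeal c

noncomputable instance (c : Chart v H) : CommRing (ChartRing c) :=
  inferInstanceAs (CommRing (_ ⧸ chartIdeal c))

noncomputable instance (c : Chart v H) : Algebra k (ChartRing c) :=
  inferInstanceAs (Algebra k (_ ⧸ chartIdeal c))

noncomputable def chartMk (c : Chart v H) :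
    MvPolynomial (Σ i : H, Fin (Module.finrank k (v.V i))) k →ₐ[k] ChartRing c :=
  Ideal.Quotient.mkₐ k (chartIdeal c)

theorem chartMk_surjective (c : Chart v H) : Function.Surjective (chartMk c) :=
  Ideal.Quotient.mk_surjective

theorem chartMk_eq_zero {c : Chart v H} {a} (h : a ∈ chartIdeal c) : chartMk c a = 0 :=
  Ideal.Quotient.eq_zero_iff_mem.2 h

/-- The coordinates of the universal vectors. -/
noncomputable def gen (c : Chart v H) (i : H) (e : Fin (Module.finrank k (v.V i))) : ChartRing c :=
  chartMk c (MvPolynomial.X ⟨i, e⟩)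

theorem gen_isPoint (c : Chart v H) : IsPoint (algebraMap k (ChartRing c)) c (gen c) where
  apply_eq_one i := by
    rw [gen, ← sub_eq_zero, ← map_one (chartMk c), ← map_sub]
    exact chartMk_eq_zero (Ideal.subset_span (Or.inl ⟨i, rfl⟩))
  minors i j b b' := by
    have := chartMk_eq_zero (Ideal.subset_span (Or.inr ⟨⟨(i, j), (b, b')⟩, rfl⟩) :
      _ ∈ chartIdeal c)
    rw [map_sub, map_mul, map_mul, sub_eq_zero, ← AlgHom.coe_toRingHom, map_ev, map_ev] at this
    have hσ : (chartMk c).toRingHom.comp MvPolynomial.C = algebraMap k (ChartRing c) :=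
      (chartMk c).comp_algebraMap
    simpa only [hσ] using! this

/-- With `chartRing_hom_ext`, this is the universal property of `ChartRing c`: its homomorphisms to
`A` are the normalized solutions over `A`, so isomorphisms of rings can be built by manipulating
vectors. -/
noncomputable def chartLift {σ : k →+* A} {c : Chart v H}
    {x : ∀ i : H, Fin (Module.finrank k (v.V i)) → A} (h : IsPoint σ c x) : ChartRing c →+* A :=
  Ideal.Quotient.lift (chartIdeal c) (MvPolynomial.eval₂Hom σ (fun p : Σ i : H,
      Fin (Module.finrank k (v.V i)) => x p.1 p.2)) (by
    have : chartIdeal c ≤ RingHom.ker (MvPolynomial.eval₂Hom σ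
        (fun p : Σ i : H, Fin (Module.finrank k (v.V i)) => x p.1 p.2)) := by
      rw [chartIdeal, Ideal.span_le]
      rintro _ (⟨i, rfl⟩ | ⟨⟨⟨i, j⟩, ⟨b, b'⟩⟩, rfl⟩)
      · simp [RingHom.mem_ker, h.apply_eq_one]
      · rw [SetLike.mem_coe, RingHom.mem_ker, map_sub, map_mul, map_mul, map_ev, map_ev,
          sub_eq_zero]
        have hσ : (MvPolynomial.eval₂Hom σ
          (fun p : Σ i : H, Fin (Module.finrank k (v.V i)) => x p.1 p.2)).comp MvPolynomial.C =
              σ := by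
          ext; simp
        simpa only [hσ, MvPolynomial.eval₂Hom_X'] using h.minors i j b b'
    exact fun a ha => this ha)

@[simp]
theorem chartLift_gen {σ : k →+* A} {c : Chart v H}
    {x : ∀ i : H, Fin (Module.finrank k (v.V i)) → A} (h : IsPoint σ c x) (i : H) (e) :
    chartLift h (gen c i e) = x i e := by
  exact MvPolynomial.eval₂Hom_X' σ (fun p : Σ i : H,
      Fin (Module.finrank k (v.V i)) => x p.1 p.2) ⟨i, e⟩

@[simp]
theorem chartLift_algebraMap {σ : k →+* A} {c : Chart v H}
    {x : ∀ i : H, Fin (Module.finrank k (v.V i)) → A} (h : IsPoint σ c x) (a : k) :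
    chartLift h (algebraMap k _ a) = σ a := by
  exact MvPolynomial.eval₂Hom_C σ (fun p : Σ i : H, Fin (Module.finrank k (v.V i)) => x p.1 p.2) a

theorem chartLift_comp_algebraMap {σ : k →+* A} {c : Chart v H}
    {x : ∀ i : H, Fin (Module.finrank k (v.V i)) → A} (h : IsPoint σ c x) :
    (chartLift h).comp (algebraMap k _) = σ :=
  RingHom.ext (chartLift_algebraMap h)

theorem chartRing_hom_ext {c : Chart v H} {f g : ChartRing c →+* A}
    (h : f.comp (algebraMap k _) = g.comp (algebraMap k _))
    (h' : ∀ i e, f (gen c i e) = g (gen c i e)) : f = g := by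
  have key : f.comp (chartMk c).toRingHom = g.comp (chartMk c).toRingHom := by
    refine MvPolynomial.ringHom_ext (fun a => ?_) (fun p => h' p.1 p.2)
    have hσ : chartMk c (MvPolynomial.C a) = algebraMap k (ChartRing c) a :=
      (chartMk c).commutes a
    change f (chartMk c _) = g (chartMk c _)
    rw [hσ]
    exact RingHom.congr_fun h a
  ext a
  obtain ⟨a, rfl⟩ := chartMk_surjective c a
  exact RingHom.congr_fun key a

variable {r : ℕ} {m n : ℤ} (C : v.Coords r m n)

/-- The coordinates, in the basis of `C`, of vectors given in the standard bases. -/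
noncomputable def Coords.vec (σ : k →+* A)
    (x : ∀ i : Finset.Icc m n, Fin (Module.finrank k (v.V i)) → A) (i : ℤ) (b : Fin r) : A :=
  if h : i ∈ Finset.Icc m n then stdEv σ ((C.basis i).coord b) (x ⟨i, h⟩) else 0

theorem Coords.vec_coe (σ : k →+* A)
    (x : ∀ i : Finset.Icc m n, Fin (Module.finrank k (v.V i)) → A) (i : Finset.Icc m n)
    (b : Fin r) : C.vec σ x i b = stdEv σ ((C.basis i).coord b) (x i) :=
  dif_pos i.2

theorem Coords.map_vec (f : A →+* B) (σ : k →+* A)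
    (x : ∀ i : Finset.Icc m n, Fin (Module.finrank k (v.V i)) → A) (i : ℤ) (b : Fin r) :
    f (C.vec σ x i b) = C.vec (f.comp σ) (fun i e => f (x i e)) i b := by
  rw [vec, vec]
  split_ifs
  · rw [map_ev]
  · rw [map_zero]

theorem Coords.ev_vec (σ : k →+* A)
    (x : ∀ i : Finset.Icc m n, Fin (Module.finrank k (v.V i)) → A) (i : Finset.Icc m n)
    (φ : v.V i →ₗ[k] k) : ev σ (C.basis i) φ (C.vec σ x i) = stdEv σ φ (x i) := by
  have : C.vec σ x i = fun b => stdEv σ ((C.basis i).coord b) (x i) := funext (C.vec_coe σ x i)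
  rw [this, ev_ev]

theorem Coords.path_coord (i j : ℤ) (b : Fin r) : (C.basis j).coord b ∘ₗ v.pathMap i j =
    if Carries (C.t b) i j then (C.basis i).coord b else 0 := by
  ext x
  rw [LinearMap.comp_apply, C.path]
  split_ifs <;> rfl

theorem ev_zero {ι V : Type*} [Fintype ι] [AddCommGroup V] [Module k V] (σ : k →+* A)
    (β : Module.Basis ι k V) (x : ι → A) : ev σ β 0 x = 0 := by
  simp [ev]

theorem Coords.stdEv_path (σ : k →+* A)
    (x : ∀ i : Finset.Icc m n, Fin (Module.finrank k (v.V i)) → A) (i j : Finset.Icc m n)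
    (b : Fin r) : stdEv σ ((C.basis j).coord b ∘ₗ v.pathMap i j) (x i) =
      if Carries (C.t b) i j then C.vec σ x i b else 0 := by
  rw [C.path_coord, C.vec_coe]
  split_ifs
  · rfl
  · exact ev_zero _ _ _

variable {σ : k →+* A} {c : Chart v (Finset.Icc m n)}
  {x : ∀ i : Finset.Icc m n, Fin (Module.finrank k (v.V i)) → A}

theorem IsPoint.minors_vec (h : IsPoint σ c x) : Minors C.t m n (C.vec σ x) := by
  intro i j hi hi' hj hj' b b'
  have key := minors_iff σ (Module.finBasis k (v.V i)) (Module.finBasis k (v.V j))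
    (Module.finBasis k (v.V j)) (C.basis j) (v.pathMap i j)
    (x ⟨i, by simp [hi, hi']⟩) (x ⟨j, by simp [hj, hj']⟩) (fun e e' => by
      rw [ev_coord, ev_coord]
      exact h.minors ⟨i, by simp [hi, hi']⟩ ⟨j, by simp [hj, hj']⟩ e e') b b'
  have e1 := C.stdEv_path σ x ⟨i, by simp [hi, hi']⟩ ⟨j, by simp [hj, hj']⟩
  have e2 := C.vec_coe σ x ⟨j, by simp [hj, hj']⟩
  simp only [stdEv] at e1 e2
  rw [e1, e1, ← e2, ← e2] at key
  exact key

theorem IsPoint.unimodular_vec (h : IsPoint σ c x) : Unimodular m n (C.vec σ x) := by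
  intro i hi hi'
  have hi : i ∈ Finset.Icc m n := by simp [hi, hi']
  have := C.ev_vec σ x ⟨i, hi⟩ ((Module.finBasis k (v.V i)).coord (c ⟨i, hi⟩))
  rw [stdEv, ev_coord, h.apply_eq_one] at this
  exact ⟨_, this⟩

/-- The vectors in the standard bases with given coordinates in the basis of `C`, normalized. -/
noncomputable def Coords.normalize (σ : k →+* A) (y : ℤ → Fin r → A) (ζ : Finset.Icc m n → Aˣ)
    (i : Finset.Icc m n) (e : Fin (Module.finrank k (v.V i))) : A :=
  (↑(ζ i)⁻¹ : A) * ev σ (C.basis i) ((Module.finBasis k (v.V i)).coord e) (y i)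

theorem Coords.stdEv_normalize (σ : k →+* A) (y : ℤ → Fin r → A) (ζ : Finset.Icc m n → Aˣ)
    (i : Finset.Icc m n) (φ : v.V i →ₗ[k] k) : stdEv σ φ (C.normalize σ y ζ i) =
      (↑(ζ i)⁻¹ : A) * ev σ (C.basis i) φ (y i) := by
  unfold Coords.normalize
  rw [stdEv, ev_mul, ev_ev]

theorem Coords.vec_normalize (σ : k →+* A) (y : ℤ → Fin r → A) (ζ : Finset.Icc m n → Aˣ)
    (i : Finset.Icc m n) (b : Fin r) :
    C.vec σ (C.normalize σ y ζ) i b = (↑(ζ i)⁻¹ : A) * y i b := by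
  rw [C.vec_coe, C.stdEv_normalize, ev_coord]

/-- The minors are homogeneous in each of the two vectors, so dividing every vector by a unit
preserves their vanishing. -/
theorem Coords.isPoint_normalize {y : ℤ → Fin r → A} (hy : Minors C.t m n y)
    (ζ : Finset.Icc m n → Aˣ)
    (hζ : ∀ i, (ζ i : A) = ev σ (C.basis i) ((Module.finBasis k (v.V i)).coord (c i)) (y i)) :
    IsPoint σ c (C.normalize σ y ζ) where
  apply_eq_one i := by rw [normalize, ← hζ, Units.inv_mul]
  minors i j b b' := by
    have key := minors_iff σ (Module.finBasis k (v.V i)) (Module.finBasis k (v.V j))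
      (C.basis j) (Module.finBasis k (v.V j)) (v.pathMap i j)
      (C.normalize σ y ζ i) (C.normalize σ y ζ j) (fun e e' => by
        have hi := Finset.mem_Icc.1 i.2
        have hj := Finset.mem_Icc.1 j.2
        have e1 := C.stdEv_path σ (C.normalize σ y ζ) i j
        have e2 := C.vec_coe σ (C.normalize σ y ζ) j
        simp only [stdEv] at e1 e2
        rw [e1, e1, ← e2, ← e2, C.vec_normalize, C.vec_normalize, C.vec_normalize, C.vec_normalize]
        have := hy i j hi.1 hi.2 hj.1 hj.2 e e'
        rw [← mul_zero (↑(ζ i)⁻¹ : A), ← mul_ite, ← mul_ite]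
        linear_combination (↑(ζ i)⁻¹ : A) * (↑(ζ j)⁻¹ : A) * this) b b'
    rw [ev_coord, ev_coord] at key
    exact key

/-- The coordinates of the universal vectors in the basis of `C`. -/
noncomputable abbrev Coords.genVec (c : Chart v (Finset.Icc m n)) : ℤ → Fin r → ChartRing c :=
  C.vec (algebraMap k _) (gen c)

theorem Coords.map_genVec (f : ChartRing c →+* A) (i : ℤ) (b : Fin r) :
    f (C.genVec c i b) = C.vec (f.comp (algebraMap k _)) (fun i e => f (gen c i e)) i b :=
  C.map_vec _ _ _ _ _

theorem Unimodular.eq_zero {y : ℤ → Fin r → A} (hu : Unimodular m n y) {i : ℤ} (hi : m ≤ i)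
    (hi' : i ≤ n) {a : A} (h : ∀ b, a * y i b = 0) : a = 0 := by
  obtain ⟨q, hq⟩ := hu i hi hi'
  calc a = ∑ b, q b * (a * y i b) := by
        conv_lhs => rw [← mul_one a, ← hq, Finset.mul_sum]
        exact Finset.sum_congr rfl fun b _ => by ring
    _ = 0 := by simp [h]

/-- At a minimal prime of the coordinate ring of a chart, one of the two maps between `e` and
`e + 1` is nonzero. -/
theorem Coords.exists_notMem_of_minimalPrimes (p : Ideal (ChartRing c))
    (hp : p ∈ minimalPrimes (ChartRing c)) {e : ℤ} (he : m ≤ e) (he' : e < n) :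
    (∃ b, e < C.t b ∧ C.genVec c e b ∉ p) ∨ (∃ b, C.t b ≤ e ∧ C.genVec c (e + 1) b ∉ p) := by
  by_contra! hcon
  obtain ⟨hcon1, hcon2⟩ := hcon
  have hprime : p.IsPrime := hp.1.1
  -- View `p` as a point over its residue field. Under the assumption to be refuted, both maps
  -- across the edge at `e` are zero there.
  let K := FractionRing (ChartRing c ⧸ p)
  let π : ChartRing c →+* K := (algebraMap (ChartRing c ⧸ p) K).comp (Ideal.Quotient.mk p)
  have hπ : ∀ a, π a = 0 ↔ a ∈ p := by
    intro a
    rw [← Ideal.Quotient.eq_zero_iff_mem]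
    exact map_eq_zero_iff _ (IsFractionRing.injective (ChartRing c ⧸ p) K)
  have hpt := (gen_isPoint c).map π
  set y := C.vec (π.comp (algebraMap k _)) (fun i e => π (gen c i e)) with hy
  have hyπ : ∀ i b, y i b = π (C.genVec c i b) := fun i b => (C.map_genVec π i b).symm
  have hu := hpt.unimodular_vec C
  obtain ⟨l, μ, hch⟩ := (hpt.minors_vec C).exists_chainRel hu
  have hl : l e = 0 := Unimodular.eq_zero hu (i := e + 1) (by omega) (by omega) fun b => by
    rw [← hch.up e he he' b]
    split_ifs with hb
    · rw [← hy, hyπ, hπ]; exact hcon1 b hb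
    · rfl
  have hμ : μ e = 0 := Unimodular.eq_zero hu he he'.le fun b => by
    rw [← hch.down e he he' b]
    split_ifs with hb
    · rw [← hy, hyπ, hπ]; exact hcon2 b hb
    · rfl
  -- Move the point along a formal arc on which the upward map at `e` becomes multiplication by the
  -- parameter.
  obtain ⟨κ, l', μ', hκ, hch'⟩ := hch.deform (B := PowerSeries K)
    (fun i hi hi' => hch.mul_eq_zero hu hi hi') he he' hl hμ PowerSeries.X
  let τ : k →+* PowerSeries K := (algebraMap K _).comp (π.comp (algebraMap k _))
  set y' : ℤ → Fin r → PowerSeries K := _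
  change ChainRel C.t m n y' l' μ' at hch'
  have hτ : (PowerSeries.constantCoeff (R := K)).comp τ = π.comp (algebraMap k _) := by
    ext a
    simp [τ]
  have hy'0 : ∀ i b, PowerSeries.constantCoeff (y' i b) = y i b := by
    intro i b
    simp only [y', map_add, PowerSeries.algebraMap_apply]
    split_ifs <;> simp [hy]
  have hev : ∀ (i : Finset.Icc m n) (φ : v.V i →ₗ[k] k), PowerSeries.constantCoeff
      (ev τ (C.basis i) φ (y' i)) = stdEv (π.comp (algebraMap k _)) φ (fun e => π (gen c i e)) := by
    intro i φ
    rw [map_ev, hτ]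
    simp only [hy'0]
    exact C.ev_vec _ (fun i e => π (gen c i e)) i φ
  have hunit : ∀ i : Finset.Icc m n, IsUnit
      (ev τ (C.basis i) ((Module.finBasis k (v.V i)).coord (c i)) (y' i)) := by
    intro i
    rw [PowerSeries.isUnit_iff_constantCoeff, hev, stdEv, ev_coord, hpt.apply_eq_one]
    exact isUnit_one
  choose ζ hζ using hunit
  have hpt' : IsPoint τ c (C.normalize τ y' ζ) := C.isPoint_normalize hch'.minors ζ hζ
  -- The arc has to be renormalized in the chart. The factors are `1` modulo the parameter, so the
  -- arc still starts at the given point.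
  have hζ0 : ∀ i, PowerSeries.constantCoeff (↑(ζ i)⁻¹ : PowerSeries K) = 1 := by
    intro i
    have h1 : PowerSeries.constantCoeff (ζ i : PowerSeries K) = 1 := by
      rw [hζ, hev, stdEv, ev_coord, hpt.apply_eq_one]
    have h2 := congrArg (PowerSeries.constantCoeff (R := K)) (ζ i).inv_mul
    rwa [map_mul, h1, mul_one, map_one] at h2
  have hcomp : (PowerSeries.constantCoeff (R := K)).comp (chartLift hpt') = π := by
    apply chartRing_hom_ext
    · rw [RingHom.comp_assoc, chartLift_comp_algebraMap, hτ]
    · intro i e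
      rw [RingHom.comp_apply, chartLift_gen, normalize, map_mul, hζ0, hev, stdEv, ev_coord, one_mul]
  -- The constant term of the arc is `π`, so the generic point of the arc is a prime inside `p`, and
  -- by minimality it equals `p`.
  have hker : RingHom.ker (chartLift hpt') ≤ p := by
    intro a ha
    rw [← hπ, ← hcomp, RingHom.comp_apply, RingHom.mem_ker.1 ha, map_zero]
  have hpk : p ≤ RingHom.ker (chartLift hpt') := hp.2 ⟨RingHom.ker_isPrime _, bot_le⟩ hker
  -- A coordinate present at `e + 1` has its peak above `e`, hence vanishes at `e` by assumption.
  -- Its function at `e` lies in `p`, yet on the arc the linear coefficient is the nonzero `y (e +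
  -- 1) b`.
  obtain ⟨b, hb⟩ : ∃ b, y (e + 1) b ≠ 0 := by
    by_contra! hall
    exact one_ne_zero (Unimodular.eq_zero hu (i := e + 1) (a := 1) (by omega) (by omega)
      fun b => by rw [one_mul]; exact hall b)
  have htb : e < C.t b := by
    by_contra hneg
    have := hcon2 b (not_lt.1 hneg)
    rw [← hπ, ← hyπ] at this
    exact hb this
  have hmem := hpk (hcon1 b htb)
  have hzero : y e b = 0 := by rw [hyπ, hπ]; exact hcon1 b htb
  rw [RingHom.mem_ker, C.map_genVec, chartLift_comp_algebraMap] at hmem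
  simp only [chartLift_gen] at hmem
  rw [C.vec_normalize τ y' ζ ⟨e, by simp [he, he'.le]⟩] at hmem
  have h3 : y' e b = 0 := by simpa using hmem
  simp only [y', ← hy] at h3
  rw [hzero, if_pos le_rfl, hκ, map_zero, zero_add, one_mul] at h3
  have h4 := congrArg (PowerSeries.coeff 1) h3
  rw [PowerSeries.algebraMap_apply, mul_comm, PowerSeries.coeff_succ_mul_X] at h4
  simp at h4
  exact hb h4

end Chart

end ZRep

/-! ### Parametrization of the points with nonzero maps along a flow -/

namespace ZRep

open LinkedChain

section Local

variable {k : Type u} [Field k] {v : ZRep.{u, w} k} {r : ℕ} {m n : ℤ} (C : v.Coords r m n)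
  {A B : Type*} [CommRing A] [CommRing B]

/-- The source of the arrow between `e` and `e + 1`, with the direction prescribed by `d`. -/
def src (d : ℤ → Bool) (e : ℤ) : ℤ := if d e = true then e else e + 1

theorem src_mem {d : ℤ → Bool} {e : ℤ} (he : e ∈ Finset.Ico m n) : src d e ∈ Finset.Icc m n := by
  rw [Finset.mem_Ico] at he
  rw [Finset.mem_Icc, src]
  split_ifs <;> omega

/-- The coordinate `b` is not killed by the arrow between `e` and `e + 1` with the direction
prescribed by `d`. -/
def Coords.Survives (d : ℤ → Bool) (e : ℤ) (b : Fin r) : Prop :=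
  if d e = true then e < C.t b else C.t b ≤ e

/-- The index set of the affine coordinates on the projective space with the coordinate `s`
normalized. -/
abbrev AffIdx (s : Fin r) : Type u := ULift.{u} {b : Fin r // b ≠ s}

open Classical in
/-- The homogeneous coordinates, with the coordinate `s` normalized. -/
noncomputable def affCoord (k : Type u) [Field k] (s b : Fin r) : MvPolynomial (AffIdx.{u} s) k :=
  if h : b = s then 1 else MvPolynomial.X ⟨b, h⟩

theorem affCoord_self (s : Fin r) : affCoord k s s = 1 := dif_pos rfl

open Classical in
/-- The truncation of a vector to the coordinates reached from the vertex `i` by the flow `d`. -/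
noncomputable def Coords.trunc (d : ℤ → Bool) (z : Fin r → A) (i : ℤ) (b : Fin r) : A :=
  if Reach d (C.t b) i then z b else 0

theorem Coords.map_trunc (f : A →+* B) (d : ℤ → Bool) (z : Fin r → A) (i : ℤ) (b : Fin r) :
    f (C.trunc d z i b) = C.trunc d (fun b => f (z b)) i b := by
  classical
  simp only [trunc, apply_ite f, map_zero]

theorem Coords.mul_trunc (d : ℤ → Bool) (a : A) (z : Fin r → A) (i : ℤ) (b : Fin r) :
    a * C.trunc d z i b = C.trunc d (fun b => a * z b) i b := by
  classical
  simp only [trunc, mul_ite, mul_zero]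

/-- The function whose nonvanishing defines the part of a stratum where given coordinates are
nonzero. -/
noncomputable def Coords.srcFun (c : Chart v (Finset.Icc m n)) (d : ℤ → Bool) (s : Fin r)
    (q : ℤ → Fin r) : ChartRing c :=
  C.genVec c (C.t s) s * ∏ e ∈ Finset.Ico m n, C.genVec c (src d e) (q e)

/-- The polynomial whose nonvanishing defines the parametrization of a part of a stratum. -/
noncomputable def Coords.affFun (c : Chart v (Finset.Icc m n)) (d : ℤ → Bool) (s : Fin r)
    (q : ℤ → Fin r) : MvPolynomial (AffIdx.{u} s) k :=
  (∏ e ∈ Finset.Ico m n, C.trunc d (affCoord k s) (src d e) (q e)) *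
    ∏ i : Finset.Icc m n, ev MvPolynomial.C (C.basis i)
      ((Module.finBasis k (v.V i)).coord (c i)) (C.trunc d (affCoord k s) i)

variable {c : Chart v (Finset.Icc m n)} {d : ℤ → Bool} {s : Fin r} {q : ℤ → Fin r}

theorem isUnit_finset_prod_iff {ι : Type*} {S : Finset ι} {f : ι → A} :
    IsUnit (∏ i ∈ S, f i) ↔ ∀ i ∈ S, IsUnit (f i) := by
  classical
  induction S using Finset.induction_on with
  | empty => simp
  | insert a S ha ih => simp [Finset.prod_insert ha, IsUnit.mul_iff, ih]

theorem Coords.isUnit_srcFun_iff (f : ChartRing c →+* A) : IsUnit (f (C.srcFun c d s q)) ↔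
    IsUnit (f (C.genVec c (C.t s) s)) ∧
      ∀ e ∈ Finset.Ico m n, IsUnit (f (C.genVec c (src d e) (q e))) := by
  rw [srcFun, map_mul, map_prod, IsUnit.mul_iff, isUnit_finset_prod_iff]

theorem Coords.isUnit_affFun_iff (f : MvPolynomial (AffIdx.{u} s) k →+* A) :
    IsUnit (f (C.affFun c d s q)) ↔
      (∀ e ∈ Finset.Ico m n, IsUnit (f (C.trunc d (affCoord k s) (src d e) (q e)))) ∧
      ∀ i : Finset.Icc m n, IsUnit (f (ev MvPolynomial.C (C.basis i)
      ((Module.finBasis k (v.V i)).coord (c i)) (C.trunc d (affCoord k s) i))) := by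
  rw [affFun, map_mul, map_prod, map_prod, IsUnit.mul_iff, isUnit_finset_prod_iff,
    isUnit_finset_prod_iff]
  simp

theorem Coords.trunc_chainRel (d : ℤ → Bool) (z : Fin r → A) :
    ∃ l μ : ℤ → A, ChainRel C.t m n (C.trunc d z) l μ :=
  ⟨_, _, chainRel_of_eq_reach (a := 1) (z := z) (d := d) fun i _ _ b => by simp [trunc]⟩

/-- The point of a chart given by the truncations of a vector. -/
theorem Coords.exists_isPoint_trunc (σ : k →+* A) (z : Fin r → A)
    (h : ∀ i : Finset.Icc m n, IsUnit (ev σ (C.basis i)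
      ((Module.finBasis k (v.V i)).coord (c i)) (C.trunc d z i))) :
    ∃ ζ : Finset.Icc m n → Aˣ, (∀ i, (ζ i : A) = ev σ (C.basis i)
      ((Module.finBasis k (v.V i)).coord (c i)) (C.trunc d z i)) ∧
      IsPoint σ c (C.normalize σ (C.trunc d z) ζ) := by
  choose ζ hζ using h
  obtain ⟨l, μ, hch⟩ := C.trunc_chainRel d z
  exact ⟨ζ, hζ, C.isPoint_normalize hch.minors ζ hζ⟩

/-- A point of a chart with nonzero maps along the flow `d` is given by the truncations of a
vector. -/
theorem Coords.exists_eq_trunc {σ : k →+* A}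
    {x : ∀ i : Finset.Icc m n, Fin (Module.finrank k (v.V i)) → A} (h : IsPoint σ c x)
    (hq : ∀ e ∈ Finset.Ico m n, C.Survives d e (q e))
    (hsrc : ∀ e ∈ Finset.Ico m n, IsUnit (C.vec σ x (src d e) (q e))) :
    ∃ (a : ℤ → Aˣ) (z : Fin r → A), ∀ i ∈ Finset.Icc m n, ∀ b,
      C.vec σ x i b = a i * C.trunc d z i b := by
  classical
  obtain ⟨l, μ, hch⟩ := (h.minors_vec C).exists_chainRel (h.unimodular_vec C)
  obtain ⟨a, z, haz⟩ := hch.exists_eq_reach C.le_t (d := d) (fun i hi hi' hd => by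
      have hi2 : i ∈ Finset.Ico m n := by simp [hi, hi']
      have h1 := hq i hi2
      have h2 := hsrc i hi2
      rw [Survives, if_pos hd] at h1
      rw [src, if_pos hd] at h2
      have := hch.up i hi hi' (q i)
      rw [if_pos h1] at this
      rw [this] at h2
      exact isUnit_of_mul_isUnit_left h2) (fun i hi hi' hd => by
      have hi2 : i ∈ Finset.Ico m n := by simp [hi, hi']
      have h1 := hq i hi2
      have h2 := hsrc i hi2
      rw [Survives, if_neg (by simp [hd])] at h1
      rw [src, if_neg (by simp [hd])] at h2
      have := hch.down i hi hi' (q i)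
      rw [if_pos h1] at this
      rw [this] at h2
      exact isUnit_of_mul_isUnit_left h2)
  refine ⟨a, z, fun i hi b => ?_⟩
  rw [Finset.mem_Icc] at hi
  exact haz i hi.1 hi.2 b

theorem Coords.reach_src_succ {d : ℤ → Bool} {e : ℤ} {b : Fin r} (hq : C.Survives d e b)
    (h : Reach d (C.t b) (src d e)) : Reach d (C.t b) e ∧ Reach d (C.t b) (e + 1) := by
  cases hd : d e with
  | true =>
    rw [Survives, if_pos hd] at hq
    rw [src, if_pos hd] at h
    exact ⟨h, (reach_succ_iff hd).2 ⟨hq, h⟩⟩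
  | false =>
    rw [Survives, if_neg (by simp [hd])] at hq
    rw [src, if_neg (by simp [hd])] at h
    exact ⟨(reach_iff_succ hd).2 ⟨hq, h⟩, h⟩

/-- The normalized homogeneous coordinates, `1` and the variables, are linearly independent over
`k`, so each coefficient can be isolated. The resulting condition does not involve `s`, which later
lets generic points of different cells be compared. -/
theorem Coords.ev_trunc_eq_zero_iff {i : ℤ} (φ : v.V i →ₗ[k] k) :
    ev MvPolynomial.C (C.basis i) φ (C.trunc d (affCoord k s) i) = 0 ↔
      ∀ b, Reach d (C.t b) i → φ (C.basis i b) = 0 := by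
  classical
  constructor
  · intro h b hb
    simp only [ev, trunc, mul_ite, mul_zero] at h
    by_cases hbs : b = s
    · have := congrArg MvPolynomial.constantCoeff h
      rw [map_sum, map_zero, Finset.sum_eq_single b] at this
      · rw [if_pos hb, hbs, affCoord_self, mul_one, MvPolynomial.constantCoeff_C] at this
        rw [hbs, this]
      · intro b' _ hb'
        split_ifs
        · rw [affCoord, dif_neg (by rw [← hbs]; exact hb')]
          simp
        · simp
      · simp
    · have := congrArg (MvPolynomial.coeff (Finsupp.single ⟨b, hbs⟩ 1)) h
      rw [MvPolynomial.coeff_sum, MvPolynomial.coeff_zero, Finset.sum_eq_single b] at this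
      · rw [if_pos hb, affCoord, dif_neg hbs, MvPolynomial.coeff_C_mul, MvPolynomial.coeff_X,
          if_pos rfl, mul_one] at this
        exact this
      · intro b' _ hb'
        split_ifs
        · rw [affCoord]
          split_ifs with h2
          · rw [mul_one, MvPolynomial.coeff_C, if_neg]
            intro h3
            simpa using DFunLike.congr_fun h3 ⟨b, hbs⟩
          · rw [MvPolynomial.coeff_C_mul, MvPolynomial.coeff_X, if_neg, mul_zero]
            intro h3
            have := Finsupp.single_left_injective one_ne_zero h3
            simp only [ULift.up.injEq, Subtype.mk.injEq] at this
            exact hb' this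
        · simp
      · simp
  · intro h
    rw [ev]
    refine Finset.sum_eq_zero fun b _ => ?_
    rw [trunc]
    split_ifs with hb
    · rw [h b hb, map_zero, zero_mul]
    · rw [mul_zero]

section Equiv

variable (hq : ∀ e ∈ Finset.Ico m n, C.Survives d e (q e))
include hq

/-- The part of a stratum in a chart where given coordinates are nonzero is an open subscheme of
an affine space. -/
theorem Coords.exists_algEquiv (A B : Type*) [CommRing A] [CommRing B] [Algebra k A] [Algebra k B]
    [Algebra (ChartRing c) A] [IsScalarTower k (ChartRing c) A]
    [IsLocalization.Away (C.srcFun c d s q) A]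
    [Algebra (MvPolynomial (AffIdx.{u} s) k) B] [IsScalarTower k (MvPolynomial (AffIdx.{u} s) k) B]
    [IsLocalization.Away (C.affFun c d s q) B] : ∃ f : A ≃ₐ[k] B,
    ∀ i : Finset.Icc m n, ∃ a : Bˣ,
      ∀ φ : v.V i →ₗ[k] k, f (algebraMap _ _ (stdEv (algebraMap k _) φ (gen c i))) =
      a * algebraMap _ _ (ev MvPolynomial.C (C.basis i) φ (C.trunc d (affCoord k s) i)) := by
  classical
  let σA : k →+* A := algebraMap k A
  let σB : k →+* B := algebraMap k B
  have hσA : (algebraMap (ChartRing c) A).comp (algebraMap k (ChartRing c)) = σA :=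
      (IsScalarTower.algebraMap_eq k (ChartRing c) A).symm
  have hσB : (algebraMap (MvPolynomial (AffIdx.{u} s) k) B).comp MvPolynomial.C = σB :=
      (IsScalarTower.algebraMap_eq k (MvPolynomial (AffIdx.{u} s) k) B).symm
  -- the homomorphism to `B`
  have hgB := (C.isUnit_affFun_iff (c := c) (d := d) (q :=
      q) (algebraMap (MvPolynomial (AffIdx.{u} s) k) B)).1 (IsLocalization.Away.algebraMap_isUnit _)
  have htr : ∀ i, (fun b => algebraMap (MvPolynomial (AffIdx.{u} s) k) B (C.trunc d (affCoord k s) i b)) =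
      C.trunc d (fun b => algebraMap (MvPolynomial (AffIdx.{u} s) k) B (affCoord k s b)) i :=
    fun i => funext fun b => C.map_trunc _ _ _ _ _
  have hgB2 := hgB.2
  simp only [map_ev, hσB, htr] at hgB2
  -- The truncations of the universal vector of the affine space form a point of the chart: the
  -- second product in `affFun` makes the normalizing coordinates invertible.
  obtain ⟨ζ, hζ, hptB⟩ := C.exists_isPoint_trunc σB _ hgB2
  let φ₀ : ChartRing c →+* B := chartLift hptB
  have hφσ : φ₀.comp (algebraMap k (ChartRing c)) = σB := chartLift_comp_algebraMap _
  have hφev : ∀ (i : Finset.Icc m n) (φ : v.V i →ₗ[k] k), φ₀ (stdEv (algebraMap k _) φ (gen c i)) =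
      (↑(ζ i)⁻¹ : B) * algebraMap (MvPolynomial (AffIdx.{u} s) k) B (ev MvPolynomial.C (C.basis i) φ
        (C.trunc d (affCoord k s) i)) := by
    intro i φ
    rw [map_ev, hφσ, map_ev, hσB, htr]
    simp only [φ₀, chartLift_gen]
    exact C.stdEv_normalize _ _ _ _ _
  have hφvec : ∀ i : Finset.Icc m n, ∀ b, φ₀ (C.genVec c i b) =
      (↑(ζ i)⁻¹ : B) * algebraMap (MvPolynomial (AffIdx.{u} s) k) B (C.trunc d (affCoord k s) i b) := by
    intro i b
    have := hφev i ((C.basis i).coord b)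
    rwa [ev_coord, ← C.vec_coe] at this
  have htm : ∀ b, C.t b ∈ Finset.Icc m n := fun b => Finset.mem_Icc.2 (C.le_t b)
  have hfB : IsUnit (φ₀ (C.srcFun c d s q)) := by
    rw [C.isUnit_srcFun_iff]
    constructor
    · rw [hφvec ⟨C.t s, htm s⟩, Coords.trunc, if_pos (reach_self _ _), affCoord_self, map_one,
        mul_one]
      exact Units.isUnit _
    · intro e he
      rw [hφvec ⟨src d e, src_mem he⟩]
      exact (Units.isUnit _).mul (hgB.1 e he)
  let f : A →+* B := IsLocalization.Away.lift (C.srcFun c d s q) hfB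
  have hf : ∀ a, f (algebraMap (ChartRing c) A a) = φ₀ a := IsLocalization.Away.lift_eq _ hfB
  -- the homomorphism to `A`
  have hptA := (gen_isPoint c).map (algebraMap (ChartRing c) A)
  have hfA := (C.isUnit_srcFun_iff (d := d) (s := s) (q :=
      q) (algebraMap (ChartRing c) A)).1 (IsLocalization.Away.algebraMap_isUnit _)
  simp only [C.map_genVec] at hfA
  -- The universal point of the chart becomes, over `A`, the family of truncations of a vector `z`
  -- with `z s` invertible. Dividing by `z s` gives the affine coordinates.
  obtain ⟨a, z, haz⟩ := C.exists_eq_trunc hptA hq hfA.2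
  have hzs : IsUnit (z s) := by
    have := hfA.1
    rw [haz _ (htm s), Coords.trunc, if_pos (reach_self _ _)] at this
    exact isUnit_of_mul_isUnit_right this
  obtain ⟨z₀, hz₀⟩ := hzs
  let ψ₀ : MvPolynomial (AffIdx.{u} s) k →+* A :=
      MvPolynomial.eval₂Hom σA (fun b => (↑z₀⁻¹ : A) * z b.down.1)
  have hψσ : ψ₀.comp MvPolynomial.C = σA := MvPolynomial.eval₂Hom_comp_C _ _
  have hψZ : ∀ b, ψ₀ (affCoord k s b) = (↑z₀⁻¹ : A) * z b := by
    intro b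
    rw [affCoord]
    split_ifs with h
    · rw [map_one, h, ← hz₀, Units.inv_mul]
    · exact MvPolynomial.eval₂Hom_X' _ _ _
  have hψtr : ∀ i ∈ Finset.Icc m n, ∀ b, ψ₀ (C.trunc d (affCoord k s) i b) =
      (↑(z₀ * a i)⁻¹ : A) * algebraMap (ChartRing c) A (C.genVec c i b) := by
    intro i hi b
    rw [C.map_trunc]
    simp only [hψZ]
    rw [← C.mul_trunc, C.map_genVec, haz i hi, mul_inv, Units.val_mul, mul_assoc,
      Units.inv_mul_cancel_left]
  have hψev : ∀ (i : Finset.Icc m n) (φ : v.V i →ₗ[k] k), ψ₀ (ev MvPolynomial.C (C.basis i) φ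
      (C.trunc d (affCoord k s) i)) = (↑(z₀ * a i)⁻¹ : A) *
        algebraMap (ChartRing c) A (stdEv (algebraMap k _) φ (gen c i)) := by
    intro i φ
    rw [map_ev, hψσ]
    simp only [hψtr i i.2]
    rw [ev_mul, ← hσA, ← map_ev, C.ev_vec]
  have hgA : IsUnit (ψ₀ (C.affFun c d s q)) := by
    rw [C.isUnit_affFun_iff]
    constructor
    · intro e he
      rw [hψtr _ (src_mem he), C.map_genVec]
      exact (Units.isUnit _).mul (hfA.2 e he)
    · intro i
      rw [hψev, stdEv, ev_coord, (gen_isPoint c).apply_eq_one, map_one, mul_one]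
      exact Units.isUnit _
  let g : B →+* A := IsLocalization.Away.lift (C.affFun c d s q) hgA
  have hg : ∀ a, g (algebraMap (MvPolynomial (AffIdx.{u} s) k) B a) = ψ₀ a :=
      IsLocalization.Away.lift_eq _ hgA
  have hfσ : f.comp σA = σB := by
    rw [← hφσ]
    ext a
    rw [RingHom.comp_apply, ← hσA, RingHom.comp_apply, hf, RingHom.comp_apply]
  have hgσ : g.comp σB = σA := by
    rw [← hψσ]
    ext a
    rw [RingHom.comp_apply, ← hσB, RingHom.comp_apply, hg, RingHom.comp_apply]
  have hgf : g.comp f = RingHom.id A := by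
    refine IsLocalization.ringHom_ext (Submonoid.powers (C.srcFun c d s q)) ?_
    refine chartRing_hom_ext ?_ ?_
    · rw [RingHom.comp_assoc, RingHom.comp_assoc, hσA, hfσ, hgσ, RingHom.id_comp, hσA]
    · intro i e
      simp only [RingHom.comp_apply, RingHom.id_apply, hf]
      -- The two rescalings cancel. Both are determined by the chart coordinate `c i`, which is `1`
      -- on the universal point.
      have hζg : g (ζ i) = (↑(z₀ * a i)⁻¹ : A) := by
        rw [hζ, ← htr, ← hσB, ← map_ev, hg, hψev, stdEv, ev_coord, (gen_isPoint c).apply_eq_one,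
          map_one, mul_one]
      have h1 := hφev i ((Module.finBasis k (v.V i)).coord e)
      rw [stdEv, ev_coord] at h1
      rw [h1, map_mul, hg, hψev, stdEv, ev_coord, ← hζg, ← mul_assoc, ← map_mul, Units.inv_mul,
        map_one, one_mul]
  have hfg : f.comp g = RingHom.id B := by
    -- That `q e` is reached by the flow is deduced from its truncation being a unit, which says
    -- nothing in the zero ring.
    cases subsingleton_or_nontrivial B with
    | inl h => exact RingHom.ext fun _ => Subsingleton.elim _ _
    | inr h =>
      -- The image of `z` and the universal affine vector have the same truncations up to units at
      -- each vertex, so they differ by one unit. Comparing the normalized coordinate `s` identifies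
      -- it with the image of `z s`.
      have hun : ∃ s' : Bˣ, ∀ b, f (z b) = s' * algebraMap (MvPolynomial (AffIdx.{u} s) k) B (affCoord k s b) := by
        let ζ' : ℤ → Bˣ := fun i => if h : i ∈ Finset.Icc m n then (ζ ⟨i, h⟩)⁻¹ else 1
        refine exists_unit_of_eq_reach C.le_t (d := d) (a := ζ')
          (a' := fun i => Units.map f.toMonoidHom (a i)) (fun i hi hi' b => ?_)
          (fun e he he' => ⟨q e, ?_⟩)
        · have hi2 : i ∈ Finset.Icc m n := by simp [hi, hi']
          have h1 := hφvec ⟨i, hi2⟩ b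
          rw [← hf, C.map_genVec, haz i hi2, map_mul, C.map_trunc, C.map_trunc] at h1
          have h2 : ζ' i = (ζ ⟨i, hi2⟩)⁻¹ := dif_pos hi2
          rw [h2]
          exact h1.symm
        · have he2 : e ∈ Finset.Ico m n := by simp [he, he']
          have h1 := hgB.1 e he2
          rw [C.map_trunc, Coords.trunc] at h1
          have h2 : Reach d (C.t (q e)) (src d e) := by
            by_contra hcon
            rw [if_neg hcon] at h1
            exact not_isUnit_zero h1
          rw [if_pos h2] at h1
          obtain ⟨h3, h4⟩ := C.reach_src_succ (hq e he2) h2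
          exact ⟨h3, h4, h1⟩
      obtain ⟨s', hs'⟩ := hun
      have hfz₀ : f z₀ = s' := by rw [hz₀, hs', affCoord_self, map_one, mul_one]
      have hfz₀' : f (↑z₀⁻¹ : A) = (↑s'⁻¹ : B) := by
        rw [← Units.mul_left_inj s', Units.inv_mul, ← hfz₀, ← map_mul, Units.inv_mul, map_one]
      refine IsLocalization.ringHom_ext (Submonoid.powers (C.affFun c d s q)) ?_
      refine MvPolynomial.ringHom_ext (fun a => ?_) (fun b => ?_)
      · simp only [RingHom.comp_apply, RingHom.id_apply, hg]
        have h1 := RingHom.congr_fun hψσ a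
        have h2 := RingHom.congr_fun hσB a
        have h3 := RingHom.congr_fun hfσ a
        simp only [RingHom.comp_apply] at h1 h2 h3
        rw [h1, h2, h3]
      · have h1 : (MvPolynomial.X b : MvPolynomial (AffIdx.{u} s) k) = affCoord k s b.down.1 := by
          rw [affCoord, dif_neg b.down.2]
        simp only [RingHom.comp_apply, RingHom.id_apply]
        rw [h1, hg, hψZ, map_mul, hfz₀', hs', Units.inv_mul_cancel_left]
  refine ⟨AlgEquiv.ofRingEquiv (f := RingEquiv.ofRingHom f g hfg hgf)
    (fun a => RingHom.congr_fun hfσ a), fun i => ⟨(ζ i)⁻¹, fun φ => ?_⟩⟩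
  exact (hf _).trans (hφev i φ)

end Equiv

end Local

end ZRep

/-! ### Morphisms into an affine open -/

namespace AlgebraicGeometry

theorem IsAffineOpen.fromSpec_appLE_self {X : Scheme.{u}} {U : X.Opens} (hU : IsAffineOpen U)
    (h : ⊤ ≤ hU.fromSpec ⁻¹ᵁ U) : hU.fromSpec.appLE U ⊤ h = (Scheme.ΓSpecIso Γ(X, U)).inv := by
  rw [Scheme.Hom.appLE, hU.fromSpec_app_self, Category.assoc, ← Functor.map_comp]
  exact (congrArg _ (CategoryTheory.Functor.map_id _ _)).trans (Category.comp_id _)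

theorem Scheme.Hom.top_le_preimage_top {X Y : Scheme.{u}} (f : X ⟶ Y) :
    (⊤ : X.Opens) ≤ f ⁻¹ᵁ ⊤ := fun _ _ => trivial

/-- Two morphisms into an affine open agree if they agree on its functions. -/
theorem IsAffineOpen.hom_ext {X T : Scheme.{u}} {U : X.Opens} (hU : IsAffineOpen U)
    {g₁ g₂ : T ⟶ X} (h₁ : ⊤ ≤ g₁ ⁻¹ᵁ U) (h₂ : ⊤ ≤ g₂ ⁻¹ᵁ U)
    (h : g₁.appLE U ⊤ h₁ = g₂.appLE U ⊤ h₂) : g₁ = g₂ := by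
  have key : ∀ (g : T ⟶ X) (hg : ⊤ ≤ g ⁻¹ᵁ U), ∃ ℓ : T ⟶ Spec Γ(X, U), g = ℓ ≫ hU.fromSpec ∧
      ℓ.appTop = (Scheme.ΓSpecIso _).hom ≫ g.appLE U ⊤ hg := by
    intro g hg
    have hr : Set.range g ⊆ Set.range hU.fromSpec := by
      rw [hU.range_fromSpec]
      rintro _ ⟨x, rfl⟩
      exact hg (show x ∈ (⊤ : T.Opens) from trivial)
    obtain ⟨ℓ, rfl⟩ : ∃ ℓ, ℓ ≫ hU.fromSpec = g :=
      ⟨IsOpenImmersion.lift hU.fromSpec g hr, IsOpenImmersion.lift_fac _ _ _⟩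
    refine ⟨ℓ, rfl, ?_⟩
    rw [← Scheme.Hom.appLE_comp_appLE ℓ hU.fromSpec U ⊤ ⊤ (hU.fromSpec_preimage_self).ge
      ℓ.top_le_preimage_top, fromSpec_appLE_self, Iso.hom_inv_id_assoc]
    exact Scheme.Hom.app_eq_appLE ℓ
  obtain ⟨ℓ₁, rfl, e₁⟩ := key g₁ h₁
  obtain ⟨ℓ₂, rfl, e₂⟩ := key g₂ h₂
  rw [ext_of_isAffine (e₁.trans ((congrArg _ h).trans e₂.symm))]

theorem IsAffineOpen.exists_hom {X T : Scheme.{u}} {U : X.Opens} (hU : IsAffineOpen U)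
    (φ : Γ(X, U) ⟶ Γ(T, ⊤)) : ∃ (g : T ⟶ X) (h : ⊤ ≤ g ⁻¹ᵁ U), g.appLE U ⊤ h = φ := by
  have h : ⊤ ≤ (T.toSpecΓ ≫ Spec.map φ ≫ hU.fromSpec) ⁻¹ᵁ U := by
    rw [Scheme.Hom.comp_preimage, Scheme.Hom.comp_preimage, hU.fromSpec_preimage_self]
    exact le_rfl
  refine ⟨_, h, ?_⟩
  rw [← Scheme.Hom.appLE_comp_appLE _ (Spec.map φ ≫ hU.fromSpec) U ⊤ ⊤
      (by rw [Scheme.Hom.comp_preimage, hU.fromSpec_preimage_self]; exact le_rfl)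
      (T.toSpecΓ).top_le_preimage_top,
    ← Scheme.Hom.appLE_comp_appLE _ hU.fromSpec U ⊤ ⊤ (hU.fromSpec_preimage_self).ge
      (Spec.map φ).top_le_preimage_top, fromSpec_appLE_self]
  have h1 : (Spec.map φ).appLE ⊤ ⊤ (Spec.map φ).top_le_preimage_top = (Spec.map φ).appTop :=
    (Scheme.Hom.app_eq_appLE _).symm
  have h2 : T.toSpecΓ.appLE ⊤ ⊤ (T.toSpecΓ).top_le_preimage_top = T.toSpecΓ.appTop :=
    (Scheme.Hom.app_eq_appLE _).symm
  rw [h1, h2, Scheme.toSpecΓ_appTop, Category.assoc, Scheme.ΓSpecIso_naturality,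
    Iso.inv_hom_id_assoc]

end AlgebraicGeometry

/-! ### Morphisms to projective space in terms of ratios of coordinates -/

namespace ProjSp

section

attribute [local instance] MvPolynomial.gradedAlgebra

open HomogeneousLocalization MvPolynomial

variable {k : Type u} [Field k] {n : ℕ}

local notation "𝒜" => homogeneousSubmodule (Fin n) k

/-- The ratio of two coordinates. -/
noncomputable def awayRatio (c b : Fin n) : Away 𝒜 (X c : MvPolynomial (Fin n) k) :=
  Away.mk 𝒜 (d := 1) (isHomogeneous_X k c) 1 (X b) (isHomogeneous_X k b)

noncomputable def awayScalar (c : Fin n) : k →+* Away 𝒜 (X c : MvPolynomial (Fin n) k) :=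
  (fromZeroRingHom 𝒜 _).comp (algebraMap k (𝒜 0))

theorem val_away_mk (c : Fin n) (N : ℕ) (p : MvPolynomial (Fin n) k) (hp : p ∈ 𝒜 (N • 1)) :
    (Away.mk 𝒜 (d := 1) (isHomogeneous_X k c) N p hp).val =
      Localization.mk p ⟨X c ^ N, (Submonoid.mem_powers_iff _ _).mpr ⟨N, rfl⟩⟩ :=
  rfl

theorem val_awayRatio (c b : Fin n) : (awayRatio (k := k) c b).val =
    Localization.mk (X b) ⟨X c, Submonoid.mem_powers _⟩ :=
  (val_away_mk c 1 _ _).trans (by simp only [pow_one])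

theorem val_awayScalar (c : Fin n) (a : k) : (awayScalar c a).val =
    algebraMap (MvPolynomial (Fin n) k) (Localization.Away (X c)) (C a) := by
  simp only [awayScalar, RingHom.comp_apply, fromZeroRingHom]
  erw [HomogeneousLocalization.val_mk]
  rw [← Localization.mk_one_eq_algebraMap]
  rfl

theorem X_mem (c : Fin n) : (X c : MvPolynomial (Fin n) k) ∈ 𝒜 1 := isHomogeneous_X k c

/-- Dehomogenization. It shows, through `away_mk_eq`, that scalars and ratios generate the ring of a
standard chart. -/
theorem map_eq_eval₂_mul {L : Type*} [CommRing L] (f : MvPolynomial (Fin n) k →+* L) (c : Fin n)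
    (y : Fin n → L) (h : ∀ b, f (X b) = f (X c) * y b) {N : ℕ} {p : MvPolynomial (Fin n) k}
    (hp : p.IsHomogeneous N) : f p = eval₂ (f.comp C) y p * f (X c) ^ N := by
  conv_lhs => rw [p.as_sum]
  rw [eval₂_eq', map_sum, Finset.sum_mul]
  refine Finset.sum_congr rfl fun d hd => ?_
  have hN : ∑ i, d i = N := by
    rw [← hp (mem_support_iff.1 hd), Finsupp.weight_apply, Finsupp.sum_fintype _ _ (by simp)]
    simp
  have hX : f (∏ i, X i ^ d i) = f (X c) ^ N * ∏ i, y i ^ d i := by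
    rw [map_prod, ← hN, ← Finset.prod_pow_eq_pow_sum, ← Finset.prod_mul_distrib]
    exact Finset.prod_congr rfl fun i _ => by rw [map_pow, h, mul_pow]
  rw [monomial_eq, map_mul, Finsupp.prod_fintype _ _ (by simp), hX, RingHom.comp_apply]
  ring

theorem away_mk_eq (c : Fin n) (N : ℕ) (p : MvPolynomial (Fin n) k) (hp : p ∈ 𝒜 (N • 1)) :
    Away.mk 𝒜 (d := 1) (isHomogeneous_X k c) N p hp = eval₂ (awayScalar c) (awayRatio c) p := by
  apply val_injective
  rw [val_away_mk]
  have h1 : (eval₂ (awayScalar c) (awayRatio c) p).val =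
      eval₂ ((algebraMap (MvPolynomial (Fin n) k) (Localization.Away (X c))).comp C)
        (fun b => Localization.mk (X b) ⟨X c, Submonoid.mem_powers _⟩) p := by
    rw [← HomogeneousLocalization.algebraMap_apply, ← MvPolynomial.coe_eval₂Hom,
      ← RingHom.comp_apply, MvPolynomial.comp_eval₂Hom, MvPolynomial.coe_eval₂Hom]
    exact congrArg₂ (fun f g => eval₂ f g p) (RingHom.ext fun a => val_awayScalar c a)
      (funext fun b => val_awayRatio c b)
  rw [h1, Localization.mk_eq_mk', IsLocalization.mk'_eq_iff_eq_mul]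
  have hp' : p.IsHomogeneous N := by simpa using (mem_homogeneousSubmodule _ _).1 hp
  simp only [map_pow]
  refine map_eq_eval₂_mul _ c _ (fun b => ?_) hp'
  rw [IsLocalization.mul_mk'_eq_mk'_of_mul,
    IsLocalization.eq_mk'_iff_mul_eq, ← map_mul, mul_comm]

theorem away_hom_ext {A : Type*} [CommRing A] (c : Fin n)
    {φ ψ : Away 𝒜 (X c : MvPolynomial (Fin n) k) →+* A}
    (h : ∀ a, φ (awayScalar c a) = ψ (awayScalar c a))
    (h' : ∀ b, φ (awayRatio c b) = ψ (awayRatio c b)) : φ = ψ := by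
  ext y
  obtain ⟨N, p, hp, rfl⟩ := Away.mk_surjective 𝒜 (d := 1) (isHomogeneous_X k c) y
  rw [away_mk_eq, ← coe_eval₂Hom, ← RingHom.comp_apply, ← RingHom.comp_apply]
  congr 1
  ext b
  · simpa using h _
  · simpa using h' _

theorem awayRatio_self (c : Fin n) : awayRatio (k := k) c c = 1 := by
  apply val_injective
  rw [val_awayRatio, Localization.mk_eq_mk', val_one]
  simp

/-- Evaluation of polynomials at `x` sends `X c` to `1`, hence extends to the localization and
restricts to its degree zero part. -/
theorem exists_away_hom {A : Type*} [CommRing A] (c : Fin n) (σ : k →+* A) (x : Fin n → A)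
    (hx : x c = 1) : ∃ φ : Away 𝒜 (X c : MvPolynomial (Fin n) k) →+* A,
      (∀ a, φ (awayScalar c a) = σ a) ∧ ∀ b, φ (awayRatio c b) = x b := by
  have hu : IsUnit (eval₂Hom σ x (X c)) := by simp [hx]
  refine ⟨(IsLocalization.Away.lift (S := Localization.Away (X c : MvPolynomial (Fin n) k))
    _ hu).comp (algebraMap (Away 𝒜 (X c : MvPolynomial (Fin n) k)) _), fun a => ?_, fun b => ?_⟩
  · rw [RingHom.comp_apply, HomogeneousLocalization.algebraMap_apply, val_awayScalar,
      IsLocalization.Away.lift_eq]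
    simp
  · rw [RingHom.comp_apply, HomogeneousLocalization.algebraMap_apply, val_awayRatio,
      Localization.mk_eq_mk']
    have h1 := IsLocalization.mk'_spec (Localization.Away (X c : MvPolynomial (Fin n) k))
      (X b : MvPolynomial (Fin n) k) ⟨X c, Submonoid.mem_powers _⟩
    have h2 := congrArg (fun z : Localization.Away (X c : MvPolynomial (Fin n) k) =>
      IsLocalization.Away.lift (X c : MvPolynomial (Fin n) k) hu z) h1
    simp only [map_mul, IsLocalization.Away.lift_eq] at h2
    simpa [hx] using h2

noncomputable def chartIso (c : Fin n) :
    CommRingCat.of (Away 𝒜 (X c : MvPolynomial (Fin n) k)) ≅ Γ(ProjSp k n, chart c) :=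
  Proj.basicOpenIsoAway 𝒜 (X c) (isHomogeneous_X k c) one_pos

theorem chartIso_hom_awayRatio (c b : Fin n) :
    (chartIso c).hom.hom (awayRatio (k := k) c b) = ratio c b := rfl

theorem isAffineOpen_chart (c : Fin n) : IsAffineOpen (chart (k := k) c) :=
  Proj.isAffineOpen_basicOpen 𝒜 (X c) (isHomogeneous_X k c) one_pos

theorem chart_ι_toSpec (c : Fin n) : (chart (k := k) c).ι ≫ toSpec k n =
    (chart c).toSpecΓ ≫ Spec.map (chartIso c).hom ≫ Spec.map (CommRingCat.ofHom (awayScalar c)) := by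
  have h : (Proj.basicOpen 𝒜 (X c)).ι ≫ Proj.toSpecZero 𝒜 = Proj.basicOpenToSpec 𝒜 (X c) ≫
      Spec.map (CommRingCat.ofHom (fromZeroRingHom 𝒜 _)) := by
    rw [← Proj.awayι_toSpecZero 𝒜 (f := X c) (X_mem c) one_pos,
      ← Proj.basicOpenIsoSpec_hom 𝒜 (X c) (X_mem c) one_pos,
      ← Proj.basicOpenIsoSpec_inv_ι, Category.assoc, Iso.hom_inv_id_assoc]
  change (Proj.basicOpen 𝒜 (X c)).ι ≫ Proj.toSpecZero 𝒜 ≫ _ = _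
  rw [reassoc_of% h, Proj.basicOpenToSpec, Category.assoc]
  rw [awayScalar, CommRingCat.ofHom_comp, Spec.map_comp]
  rfl

theorem scalar_eq {X : Scheme.{u}} (s : X ⟶ Spec (.of k)) (U : X.Opens) :
    scalar s U = ((Scheme.ΓSpecIso (.of k)).inv ≫ s.appLE ⊤ U le_top).hom := rfl

theorem coord_eq {X : Scheme.{u}} (g : X ⟶ ProjSp k n) (c : Fin n)
    (U : X.Opens) (h : U ≤ g ⁻¹ᵁ chart c) (b : Fin n) :
    coord g c U h b = (g.appLE (chart c) U h).hom (ratio c b) := rfl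

theorem appLE_scalar {X Y : Scheme.{u}} (f : Y ⟶ X) (s : X ⟶ Spec (.of k)) (U : X.Opens)
    (V : Y.Opens) (h : V ≤ f ⁻¹ᵁ U) (a : k) :
    (f.appLE U V h).hom (scalar s U a) = scalar (f ≫ s) V a := by
  rw [scalar_eq, scalar_eq, ← Scheme.Hom.appLE_comp_appLE f s ⊤ U V le_top h]
  rfl

theorem appLE_coord {X Y : Scheme.{u}} (f : Y ⟶ X) (g : X ⟶ ProjSp k n) (c : Fin n) (U : X.Opens)
    (hU : U ≤ g ⁻¹ᵁ chart c) (V : Y.Opens) (h : V ≤ f ⁻¹ᵁ U) (b : Fin n) :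
    (f.appLE U V h).hom (coord g c U hU b) =
      coord (f ≫ g) c V (h.trans (f.preimage_mono hU)) b := by
  rw [coord_eq, coord_eq, ← Scheme.Hom.appLE_comp_appLE f g (chart c) U V hU h]
  rfl

theorem map_scalar {X : Scheme.{u}} (s : X ⟶ Spec (.of k)) {U V : X.Opens}
    (h : V ≤ U) (a : k) :
    (X.presheaf.map (homOfLE h).op).hom (scalar s U a) = scalar s V a := by
  rw [scalar_eq, scalar_eq, ← Scheme.Hom.appLE_map s le_top (homOfLE h).op]
  rfl

theorem map_coord {X : Scheme.{u}} (g : X ⟶ ProjSp k n) (c : Fin n) {U V : X.Opens}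
    (hU : U ≤ g ⁻¹ᵁ chart c) (h : V ≤ U) (b : Fin n) :
    (X.presheaf.map (homOfLE h).op).hom (coord g c U hU b) = coord g c V (h.trans hU) b := by
  rw [coord_eq, coord_eq, ← Scheme.Hom.appLE_map g hU (homOfLE h).op]
  rfl

theorem scalar_eq_of_ι_comp {X : Scheme.{u}} (s : X ⟶ Spec (.of k)) (U : X.Opens)
    (ψ : CommRingCat.of k ⟶ Γ(X, U)) (h : U.ι ≫ s = U.toSpecΓ ≫ Spec.map ψ) :
    scalar s U = ψ.hom := by
  have h1 := congrArg (fun f => (Scheme.ΓSpecIso (.of k)).inv ≫ Scheme.Hom.appTop f ≫ U.topIso.hom) h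
  rw [Scheme.Hom.comp_appTop, Scheme.Hom.comp_appTop, Scheme.Opens.toSpecΓ_appTop] at h1
  simp only [Category.assoc, Iso.inv_hom_id, Category.comp_id] at h1
  rw [Scheme.ΓSpecIso_naturality, Iso.inv_hom_id_assoc] at h1
  have h2 : U.ι.appTop ≫ U.topIso.hom = X.presheaf.map (homOfLE le_top).op := by
    rw [Scheme.Opens.topIso_hom, Scheme.Opens.ι_appTop]
    exact (X.presheaf.map_comp _ _).symm
  rw [← h1, h2]
  rfl

theorem scalar_toSpec_chart (c : Fin n) (a : k) :
    scalar (toSpec k n) (chart c) a = (chartIso c).hom.hom (awayScalar c a) := by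
  have := scalar_eq_of_ι_comp (toSpec k n) (chart c)
    (CommRingCat.ofHom (awayScalar c) ≫ (chartIso c).hom)
    ((chart_ι_toSpec c).trans (by rw [Spec.map_comp]))
  rw [this]
  rfl

theorem coord_self {X : Scheme.{u}} (g : X ⟶ ProjSp k n) (c : Fin n)
    (U : X.Opens) (h : U ≤ g ⁻¹ᵁ chart c) : coord g c U h c = 1 := by
  rw [coord_eq, ← chartIso_hom_awayRatio, awayRatio_self, map_one, map_one]

theorem map_awayToSection (f g x : MvPolynomial (Fin n) k) (hg : g ∈ 𝒜 1) (hx : x = f * g)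
    (y : Away 𝒜 f) (V : (Proj 𝒜).Opens) (hV : V ≤ Proj.basicOpen 𝒜 x)
    (hV' : V ≤ Proj.basicOpen 𝒜 f) :
    ((Proj 𝒜).presheaf.map (homOfLE hV').op).hom ((Proj.awayToSection 𝒜 f).hom y) =
      ((Proj 𝒜).presheaf.map (homOfLE hV).op).hom
        ((Proj.awayToSection 𝒜 x).hom (awayMap 𝒜 hg hx y)) := by
  have h1 := congrArg (fun φ => (φ ≫ (Proj 𝒜).presheaf.map (homOfLE hV).op).hom y)
    (Proj.awayMap_awayToSection 𝒜 (f := f) hg hx)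
  simp only [Category.assoc, ← Functor.map_comp] at h1
  exact h1.symm

theorem val_awayMap_awayRatio (c c' b : Fin n) (x : MvPolynomial (Fin n) k)
    (hx : x = X c * X c') : (awayMap 𝒜 (X_mem c') hx (awayRatio c b)).val =
      Localization.mk (X b * X c') ⟨x, Submonoid.mem_powers _⟩ := by
  refine (val_awayMap_mk 𝒜 (X_mem c') hx 1 ⟨X b, X_mem b⟩ 1 (by simpa using X_mem c)).trans ?_
  simp only [pow_one]

theorem awayMap_mul_awayMap (c c' b : Fin n) :
    awayMap 𝒜 (X_mem c') rfl (awayRatio c c') * awayMap 𝒜 (X_mem c) (mul_comm _ _)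
      (awayRatio c' b) = awayMap 𝒜 (x := X c * X c') (X_mem c') rfl (awayRatio (k := k) c b) := by
  apply val_injective
  rw [val_mul, val_awayMap_awayRatio, val_awayMap_awayRatio, val_awayMap_awayRatio,
    Localization.mk_mul, Localization.mk_eq_mk_iff, Localization.r_iff_exists]
  refine ⟨1, ?_⟩
  simp only [OneMemClass.coe_one, Submonoid.coe_mul]
  ring

theorem map_awayToSection_mul (c c' b : Fin n) (V : (Proj 𝒜).Opens)
    (h : V ≤ Proj.basicOpen 𝒜 (X c)) (h' : V ≤ Proj.basicOpen 𝒜 (X c')) :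
    ((Proj 𝒜).presheaf.map (homOfLE h).op).hom
        ((Proj.awayToSection 𝒜 (X c)).hom (awayRatio c c')) *
      ((Proj 𝒜).presheaf.map (homOfLE h').op).hom
        ((Proj.awayToSection 𝒜 (X c')).hom (awayRatio c' b)) =
      ((Proj 𝒜).presheaf.map (homOfLE h).op).hom
        ((Proj.awayToSection 𝒜 (X c)).hom (awayRatio c b)) := by
  have hV : V ≤ Proj.basicOpen 𝒜 (X c * X c') := by
    rw [Proj.basicOpen_mul]; exact le_inf h h'
  rw [map_awayToSection _ _ _ (X_mem c') rfl _ V hV h,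
    map_awayToSection _ _ _ (X_mem c') rfl _ V hV h,
    map_awayToSection _ _ _ (X_mem c) (mul_comm _ _) _ V hV h', ← map_mul, ← map_mul,
    awayMap_mul_awayMap]

theorem ratio_mul_ratio (c c' b : Fin n) (V : (ProjSp k n).Opens) (h : V ≤ chart c)
    (h' : V ≤ chart c') : ((ProjSp k n).presheaf.map (homOfLE h).op).hom (ratio c c') *
      ((ProjSp k n).presheaf.map (homOfLE h').op).hom (ratio c' b) =
      ((ProjSp k n).presheaf.map (homOfLE h).op).hom (ratio c b) :=
  map_awayToSection_mul c c' b V h h'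

theorem coord_mul_coord {X : Scheme.{u}} (g : X ⟶ ProjSp k n) (c c' b : Fin n)
    (U : X.Opens) (h : U ≤ g ⁻¹ᵁ chart c) (h' : U ≤ g ⁻¹ᵁ chart c') :
    coord g c U h c' * coord g c' U h' b = coord g c U h b := by
  have := congrArg (g.appLE (chart c ⊓ chart c') U (le_inf h h')).hom
    (ratio_mul_ratio (k := k) c c' b (chart c ⊓ chart c') inf_le_left inf_le_right)
  rw [map_mul] at this
  have key : ∀ (d : Fin n) (hd : chart c ⊓ chart c' ≤ chart d) (hU : U ≤ g ⁻¹ᵁ chart d) (e : Fin n),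
      (g.appLE (chart c ⊓ chart c') U (le_inf h h')).hom
        (((ProjSp k n).presheaf.map (homOfLE hd).op).hom (ratio d e)) = coord g d U hU e :=
    fun d hd hU e => congrArg (fun f : Γ(ProjSp k n, chart d) ⟶ Γ(X, U) => f.hom (ratio d e))
      (g.map_appLE (le_inf h h') (homOfLE hd).op)
  rwa [key c inf_le_left h, key c' inf_le_right h', key c inf_le_left h] at this

theorem proj_basicOpen_awayToSection (c b : Fin n) :
    (Proj 𝒜).basicOpen ((Proj.awayToSection 𝒜 (X c)).hom (awayRatio c b)) =
      Proj.basicOpen 𝒜 (X c) ⊓ Proj.basicOpen 𝒜 (X b) := by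
  set U := Proj.basicOpen 𝒜 (X c : MvPolynomial (Fin n) k)
  have h1 : U.ι ⁻¹ᵁ (Proj 𝒜).basicOpen ((Proj.awayToSection 𝒜 (X c)).hom (awayRatio c b)) =
      U.ι ⁻¹ᵁ Proj.basicOpen 𝒜 (X b) := by
    have h2 : Proj.basicOpenToSpec 𝒜 (X c) ≫ Proj.awayι 𝒜 (X c) (X_mem c) one_pos = U.ι := by
      rw [← Proj.basicOpenIsoSpec_hom 𝒜 (X c) (X_mem c) one_pos,
        ← Proj.basicOpenIsoSpec_inv_ι, Iso.hom_inv_id_assoc]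
    have h3 : Away.isLocalizationElem (X_mem c) (X_mem b) = awayRatio (k := k) c b := by
      apply val_injective
      rw [val_awayRatio, Away.isLocalizationElem, Away.val_mk]
      simp only [pow_one]
    have h5 := Proj.awayι_preimage_basicOpen 𝒜 (X_mem (k := k) c) one_pos (X_mem b) one_pos
    rw [h3] at h5
    have h6 : Proj.basicOpenToSpec 𝒜 (X c) ⁻¹ᵁ Proj.awayι 𝒜 (X c) (X_mem c) one_pos ⁻¹ᵁ
        Proj.basicOpen 𝒜 (X b) = U.ι ⁻¹ᵁ Proj.basicOpen 𝒜 (X b) := by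
      rw [← h2]; rfl
    rw [← h6, h5]
    exact (Scheme.Opens.toSpecΓ_preimage_basicOpen U
      ((Proj.awayToSection 𝒜 (X c)).hom (awayRatio c b))).symm
  have h4 := congrArg (U.ι ''ᵁ ·) h1
  simp only [Scheme.Hom.image_preimage_eq_opensRange_inf, Scheme.Opens.opensRange_ι] at h4
  rw [← h4, right_eq_inf]
  exact Scheme.basicOpen_le _ _

theorem basicOpen_ratio (c b : Fin n) :
    (ProjSp k n).basicOpen (ratio c b) = chart c ⊓ chart b :=
  proj_basicOpen_awayToSection c b

theorem basicOpen_coord {X : Scheme.{u}} (g : X ⟶ ProjSp k n) (c b : Fin n)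
    (U : X.Opens) (h : U ≤ g ⁻¹ᵁ chart c) :
    X.basicOpen (coord g c U h b) = U ⊓ g ⁻¹ᵁ chart b := by
  have := Scheme.basicOpen_appLE g U (chart c) h (ratio c b)
  rw [basicOpen_ratio] at this
  refine this.trans (le_antisymm ?_ ?_)
  · exact inf_le_inf_left _ fun x hx => hx.2
  · exact le_inf inf_le_left fun x hx => ⟨h hx.1, hx.2⟩

theorem iSup_chart : ⨆ c, chart (k := k) (n := n) c = ⊤ := by
  refine Proj.iSup_basicOpen_eq_top' 𝒜 X (fun c => ⟨1, X_mem c⟩) (eq_top_iff.2 fun p _ => ?_)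
  induction p using MvPolynomial.induction_on with
  | C a =>
    have h : C a ∈ 𝒜 0 := isHomogeneous_C _ a
    exact (Algebra.adjoin (𝒜 0) (Set.range (X : Fin n → MvPolynomial (Fin n) k))).algebraMap_mem
      ⟨C a, h⟩
  | add p q hp hq => exact add_mem (hp trivial) (hq trivial)
  | mul_X p i hp => exact mul_mem (hp trivial) (Algebra.subset_adjoin ⟨i, rfl⟩)

theorem hom_ext {T : Scheme.{u}} {g₁ g₂ : T ⟶ ProjSp k n} (c : Fin n) (h₁ : ⊤ ≤ g₁ ⁻¹ᵁ chart c)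
    (h₂ : ⊤ ≤ g₂ ⁻¹ᵁ chart c) (h : g₁ ≫ toSpec k n = g₂ ≫ toSpec k n)
    (h' : ∀ b, coord g₁ c ⊤ h₁ b = coord g₂ c ⊤ h₂ b) : g₁ = g₂ := by
  refine (isAffineOpen_chart c).hom_ext h₁ h₂ ?_
  rw [← cancel_epi (chartIso c).hom]
  ext : 1
  refine away_hom_ext c (fun a => ?_) h'
  change (g₁.appLE (chart c) ⊤ h₁).hom ((chartIso c).hom.hom (awayScalar c a)) =
    (g₂.appLE (chart c) ⊤ h₂).hom ((chartIso c).hom.hom (awayScalar c a))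
  rw [← scalar_toSpec_chart, appLE_scalar, appLE_scalar, h]

theorem scalar_ext {T : Scheme.{u}} {s s' : T ⟶ Spec (.of k)}
    (h : ∀ a, scalar s ⊤ a = scalar s' ⊤ a) : s = s' := by
  apply ext_of_isAffine
  rw [← cancel_epi (Scheme.ΓSpecIso (.of k)).inv]
  ext a
  have := h a
  have key : ∀ t : T ⟶ Spec (.of k), t.appLE ⊤ ⊤ le_top = t.appTop := fun t =>
    t.app_eq_appLE.symm
  rwa [scalar_eq, scalar_eq, key, key] at this

theorem exists_hom {T : Scheme.{u}} (s : T ⟶ Spec (.of k)) (c : Fin n) (x : Fin n → Γ(T, ⊤))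
    (hx : x c = 1) : ∃ (g : T ⟶ ProjSp k n) (h : ⊤ ≤ g ⁻¹ᵁ chart c), g ≫ toSpec k n = s ∧
      ∀ b, coord g c ⊤ h b = x b := by
  obtain ⟨φ, h1, h2⟩ := exists_away_hom c (scalar s ⊤) x hx
  obtain ⟨g, h, hg⟩ := (isAffineOpen_chart c).exists_hom ((chartIso c).inv ≫ CommRingCat.ofHom φ)
  rw [Iso.eq_inv_comp] at hg
  refine ⟨g, h, ?_, fun b => ?_⟩
  · refine scalar_ext fun a => ?_
    rw [← h1 a, ← appLE_scalar g (toSpec k n) (chart c) ⊤ h, scalar_toSpec_chart]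
    exact congrArg (fun f => f.hom (awayScalar c a)) hg
  · have := congrArg (fun f => f.hom (awayRatio c b)) hg
    exact this.trans (h2 b)

end

end ProjSp

/-! ### Local vanishing and quasi-compact open immersions -/

namespace AlgebraicGeometry

theorem Scheme.eq_zero_of_locally {X : Scheme.{u}} {U : X.Opens} (s : Γ(X, U))
    (h : ∀ x ∈ U, ∃ (W : X.Opens) (hW : W ≤ U), x ∈ W ∧
      (X.presheaf.map (homOfLE hW).op).hom s = 0) : s = 0 := by
  choose W hW hx hs using h
  refine TopCat.Sheaf.eq_of_locally_eq' X.sheaf (fun x : U => W x.1 x.2) U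
    (fun x => homOfLE (hW x.1 x.2)) (fun x hxU => ?_) s 0 fun x => ?_
  · exact Opens.mem_iSup.2 ⟨⟨x, hxU⟩, hx x hxU⟩
  · rw [map_zero]
    exact hs x.1 x.2

theorem Scheme.exists_affineOpens_mem {X : Scheme.{u}} {x : X} {U : X.Opens} (hx : x ∈ U) :
    ∃ A : X.affineOpens, x ∈ A.1 ∧ A.1 ≤ U := by
  obtain ⟨A, hA, hx, h⟩ := exists_isAffineOpen_mem_and_subset hx
  exact ⟨⟨A, hA⟩, hx, h⟩

theorem quasiCompact_ι_preimage {X Y : Scheme.{u}} (f : X ⟶ Y) (U : Y.Opens) [QuasiCompact U.ι] :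
    QuasiCompact (f ⁻¹ᵁ U).ι :=
  MorphismProperty.of_isPullback (isPullback_morphismRestrict f U) ‹_›

/-- In this topological form the property passes to intersections. It is needed because the kernel
of a quasi-compact morphism can be computed on each affine open. -/
theorem quasiCompact_ι_iff {X : Scheme.{u}} (U : X.Opens) :
    QuasiCompact U.ι ↔ ∀ K : Set X, IsOpen K → IsCompact K → IsCompact ((U : Set X) ∩ K) := by
  have key : ∀ K : Set X, IsCompact (U.ι ⁻¹' K) ↔ IsCompact ((U : Set X) ∩ K) := by
    intro K
    rw [U.ι.isOpenEmbedding.isInducing.isCompact_iff, Set.image_preimage_eq_inter_range,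
      Scheme.Opens.range_ι, Set.inter_comm]
  exact ⟨fun h K hK hK' => (key K).1 (h.1 K hK hK'), fun h => ⟨fun K hK hK' =>
    (key K).2 (h K hK hK')⟩⟩

theorem quasiCompact_ι_inf {X : Scheme.{u}} (U V : X.Opens) (hU : QuasiCompact U.ι)
    (hV : QuasiCompact V.ι) : QuasiCompact (U ⊓ V).ι := by
  rw [quasiCompact_ι_iff] at *
  intro K hK hK'
  rw [Opens.coe_inf, Set.inter_assoc]
  exact hU _ (V.isOpen.inter hK) (hV K hK hK')

theorem Scheme.app_mem_ideal_of_mem_ker {X : Scheme.{u}} (U : X.Opens)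
    (I : U.toScheme.IdealSheafData) (A : X.affineOpens) (hA : IsAffineOpen (U.ι ⁻¹ᵁ A.1))
    (a : Γ(X, A.1)) (ha : a ∈ (I.subschemeι ≫ U.ι).ker.ideal A) :
    (U.ι.app A.1).hom a ∈ I.ideal ⟨U.ι ⁻¹ᵁ A.1, hA⟩ := by
  have ha := Scheme.Hom.ideal_ker_le _ _ ha
  rw [← Scheme.IdealSheafData.ker_subschemeι_app]
  exact ha

theorem _root_.Ideal.mem_of_map_mem {R S : Type*} [CommRing R] [CommRing S] {f : R →+* S}
    (hf : Function.Bijective f) {I : Ideal R} {a : R} (h : f a ∈ I.map f) : a ∈ I := by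
  rwa [← Ideal.mem_comap, Ideal.comap_map_of_bijective _ hf] at h

end AlgebraicGeometry

/-! ### The ideal sheaf of the incidence locus -/

namespace ProjSp

open LinkedChain

variable {k : Type u} [Field k]

instance (n : ℕ) (c : Fin n) : QuasiCompact (chart (k := k) c).ι := by
  let := MvPolynomial.gradedAlgebra (σ := Fin n) (R := k)
  have : (ProjSp k n).IsSeparated := inferInstanceAs
    (Proj (MvPolynomial.homogeneousSubmodule (Fin n) k)).IsSeparated
  have : IsAffine (chart (k := k) c).toScheme := isAffineOpen_chart c
  infer_instance

theorem quasiCompact_chart {X : Scheme.{u}} {n n' : ℕ} (g : X ⟶ ProjSp k n) (g' : X ⟶ ProjSp k n')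
    (c : Fin n) (d : Fin n') : QuasiCompact (g ⁻¹ᵁ chart c ⊓ g' ⁻¹ᵁ chart d).ι :=
  quasiCompact_ι_inf _ _ (quasiCompact_ι_preimage g _) (quasiCompact_ι_preimage g' _)

theorem exists_mem_chart {X : Scheme.{u}} {n : ℕ} (g : X ⟶ ProjSp k n) (x : X) :
    ∃ c, x ∈ g ⁻¹ᵁ chart c := by
  have : g x ∈ ⨆ c, chart (k := k) (n := n) c := by rw [iSup_chart]; trivial
  obtain ⟨c, hc⟩ := Opens.mem_iSup.1 this
  exact ⟨c, hc⟩

variable {V V' : Type w} [AddCommGroup V] [Module k V] [FiniteDimensional k V]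
  [AddCommGroup V'] [Module k V'] [FiniteDimensional k V'] (f : V →ₗ[k] V')

/-- The value of a functional at the normalized coordinate vector of a morphism to a projective
space. -/
noncomputable def coordEv {X : Scheme.{u}} (s : X ⟶ Spec (.of k))
    (g : X ⟶ ProjSp k (Module.finrank k V)) (c : Fin (Module.finrank k V)) (U : X.Opens)
    (h : U ≤ g ⁻¹ᵁ chart c) (φ : V →ₗ[k] k) : Γ(X, U) :=
  ev (scalar s U) (Module.finBasis k V) φ (coord g c U h)

section

variable {X Y : Scheme.{u}} (s : X ⟶ Spec (.of k)) (g : X ⟶ ProjSp k (Module.finrank k V))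
    (g' : X ⟶ ProjSp k (Module.finrank k V'))

theorem appLE_coordEv (p : Y ⟶ X) (c : Fin (Module.finrank k V)) (U : X.Opens)
    (hU : U ≤ g ⁻¹ᵁ chart c) (W : Y.Opens) (h : W ≤ p ⁻¹ᵁ U) (φ : V →ₗ[k] k) :
    (p.appLE U W h).hom (coordEv s g c U hU φ) =
      coordEv (p ≫ s) (p ≫ g) c W (h.trans (p.preimage_mono hU)) φ := by
  rw [coordEv, map_ev]
  congr 1
  · exact RingHom.ext fun a => appLE_scalar p s U W h a
  · exact funext fun b => appLE_coord p g c U hU W h b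

theorem map_coordEv (c : Fin (Module.finrank k V)) {U W : X.Opens}
    (hU : U ≤ g ⁻¹ᵁ chart c) (h : W ≤ U) (φ : V →ₗ[k] k) :
    (X.presheaf.map (homOfLE h).op).hom (coordEv s g c U hU φ) =
      coordEv s g c W (h.trans hU) φ := by
  rw [coordEv, map_ev]
  congr 1
  · exact RingHom.ext fun a => map_scalar s h a
  · exact funext fun b => map_coord g c hU h b

theorem coordEv_change (c c' : Fin (Module.finrank k V)) (U : X.Opens)
    (h : U ≤ g ⁻¹ᵁ chart c) (h' : U ≤ g ⁻¹ᵁ chart c') (φ : V →ₗ[k] k) :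
    coordEv s g c U h φ = coord g c U h c' * coordEv s g c' U h' φ := by
  rw [coordEv, coordEv, ← ev_mul]
  congr 1
  exact funext fun b => (coord_mul_coord g c c' b U h h').symm

theorem coordEv_coord (c : Fin (Module.finrank k V)) (U : X.Opens)
    (h : U ≤ g ⁻¹ᵁ chart c) (b : Fin (Module.finrank k V)) :
    coordEv s g c U h ((Module.finBasis k V).coord b) = coord g c U h b :=
  ev_coord _ _ _ _

/-- A minor of the matrix formed by the image of the first coordinate vector and the second
coordinate vector. -/
noncomputable def minor (c : Fin (Module.finrank k V)) (d : Fin (Module.finrank k V')) (U : X.Opens)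
    (h : U ≤ g ⁻¹ᵁ chart c) (h' : U ≤ g' ⁻¹ᵁ chart d)
    (b : Fin (Module.finrank k V') × Fin (Module.finrank k V')) : Γ(X, U) :=
  coordEv s g c U h ((Module.finBasis k V').coord b.1 ∘ₗ f) * coord g' d U h' b.2 -
    coordEv s g c U h ((Module.finBasis k V').coord b.2 ∘ₗ f) * coord g' d U h' b.1

theorem appLE_minor (p : Y ⟶ X) (c : Fin (Module.finrank k V)) (d : Fin (Module.finrank k V'))
    (U : X.Opens) (hU : U ≤ g ⁻¹ᵁ chart c) (hU' : U ≤ g' ⁻¹ᵁ chart d) (W : Y.Opens)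
    (h : W ≤ p ⁻¹ᵁ U) (b) : (p.appLE U W h).hom (minor f s g g' c d U hU hU' b) =
      minor f (p ≫ s) (p ≫ g) (p ≫ g') c d W (h.trans (p.preimage_mono hU))
        (h.trans (p.preimage_mono hU')) b := by
  simp only [minor, map_sub, map_mul, appLE_coordEv, appLE_coord]

theorem app_minor (p : Y ⟶ X) (c : Fin (Module.finrank k V)) (d : Fin (Module.finrank k V'))
    (U : X.Opens) (hU : U ≤ g ⁻¹ᵁ chart c) (hU' : U ≤ g' ⁻¹ᵁ chart d)
    (b) : (p.app U).hom (minor f s g g' c d U hU hU' b) =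
      minor f (p ≫ s) (p ≫ g) (p ≫ g') c d (p ⁻¹ᵁ U) (p.preimage_mono hU)
        (p.preimage_mono hU') b := by
  rw [p.app_eq_appLE, appLE_minor]

theorem map_minor (c : Fin (Module.finrank k V)) (d : Fin (Module.finrank k V'))
    {U : X.Opens} (hU : U ≤ g ⁻¹ᵁ chart c) (hU' : U ≤ g' ⁻¹ᵁ chart d) {W : X.Opens}
    (h : W ≤ U) (b) : (X.presheaf.map (homOfLE h).op).hom (minor f s g g' c d U hU hU' b) =
      minor f s g g' c d W (h.trans hU) (h.trans hU') b := by
  simp only [minor, map_sub, map_mul, map_coordEv, map_coord]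

theorem minor_change (c c' : Fin (Module.finrank k V)) (d d' : Fin (Module.finrank k V'))
    (U : X.Opens) (h : U ≤ g ⁻¹ᵁ chart c) (h' : U ≤ g' ⁻¹ᵁ chart d) (hc : U ≤ g ⁻¹ᵁ chart c')
    (hd : U ≤ g' ⁻¹ᵁ chart d') (b) : minor f s g g' c d U h h' b =
      coord g c U h c' * coord g' d U h' d' * minor f s g g' c' d' U hc hd b := by
  rw [minor, minor, coordEv_change s g c c' U h hc, coordEv_change s g c c' U h hc,
    ← coord_mul_coord g' d d' b.1 U h' hd, ← coord_mul_coord g' d d' b.2 U h' hd]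
  ring

/-- The image of the first coordinate vector is proportional to the second coordinate vector. -/
def Incident : Prop :=
  ∀ c d U h h' b, minor f s g g' c d U h h' b = 0

/-- A change of the normalizing coordinates multiplies the minors by ratios of coordinates, so one
choice of coordinates near each point is enough. -/
theorem incident_of_cover (H : ∀ x : X, ∃ (U : X.Opens) (c d : _) (h : U ≤ g ⁻¹ᵁ chart c)
    (h' : U ≤ g' ⁻¹ᵁ chart d), x ∈ U ∧ ∀ b, minor f s g g' c d U h h' b = 0) :
    Incident f s g g' := by
  intro c d U h h' b
  refine Scheme.eq_zero_of_locally _ fun x hx => ?_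
  obtain ⟨U', c', d', hc, hd, hx', hz⟩ := H x
  refine ⟨U ⊓ U', inf_le_left, ⟨hx, hx'⟩, ?_⟩
  rw [map_minor, minor_change f s g g' c c' d d' _ _ _ (inf_le_right.trans hc)
    (inf_le_right.trans hd), ← map_minor f s g g' c' d' hc hd inf_le_right, hz, map_zero, mul_zero]

/-- The ideal of the incidence locus on an open where two coordinates do not vanish. -/
noncomputable def minorIdeal (c : Fin (Module.finrank k V)) (d : Fin (Module.finrank k V'))
    (U : X.Opens) (h : U ≤ g ⁻¹ᵁ chart c) (h' : U ≤ g' ⁻¹ᵁ chart d) : Ideal Γ(X, U) :=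
  Ideal.span (Set.range (minor f s g g' c d U h h'))

theorem map_appLE_minorIdeal (p : Y ⟶ X) (c : Fin (Module.finrank k V))
    (d : Fin (Module.finrank k V'))
    (U : X.Opens) (hU : U ≤ g ⁻¹ᵁ chart c) (hU' : U ≤ g' ⁻¹ᵁ chart d) (W : Y.Opens)
    (h : W ≤ p ⁻¹ᵁ U) : (minorIdeal f s g g' c d U hU hU').map (p.appLE U W h).hom =
      minorIdeal f (p ≫ s) (p ≫ g) (p ≫ g') c d W (h.trans (p.preimage_mono hU))
        (h.trans (p.preimage_mono hU')) := by
  rw [minorIdeal, Ideal.map_span, ← Set.range_comp, minorIdeal]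
  congr 2
  exact funext fun b => appLE_minor ..

theorem map_minorIdeal (c : Fin (Module.finrank k V)) (d : Fin (Module.finrank k V'))
    {U : X.Opens} (hU : U ≤ g ⁻¹ᵁ chart c) (hU' : U ≤ g' ⁻¹ᵁ chart d) {W : X.Opens}
    (h : W ≤ U) : (minorIdeal f s g g' c d U hU hU').map (X.presheaf.map (homOfLE h).op).hom =
      minorIdeal f s g g' c d W (h.trans hU) (h.trans hU') := by
  rw [minorIdeal, Ideal.map_span, ← Set.range_comp, minorIdeal]
  congr 2
  exact funext fun b => map_minor ..

omit [FiniteDimensional k V] [FiniteDimensional k V'] in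
theorem le_ι_comp_preimage {Z : Scheme.{u}} {U : X.Opens} (p : X ⟶ Z) {W : Z.Opens}
    (h : U ≤ p ⁻¹ᵁ W) (A : U.toScheme.Opens) : A ≤ (U.ι ≫ p) ⁻¹ᵁ W :=
  fun x _ => h x.2

variable (c : Fin (Module.finrank k V)) (d : Fin (Module.finrank k V')) (U : X.Opens)
  (hU : U ≤ g ⁻¹ᵁ chart c) (hU' : U ≤ g' ⁻¹ᵁ chart d)

/-- The ideal sheaf on an open given by the minors. -/
noncomputable def localIdeal : U.toScheme.IdealSheafData :=
  .ofIdealTop (minorIdeal f (U.ι ≫ s) (U.ι ≫ g) (U.ι ≫ g') c d ⊤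
    (le_ι_comp_preimage g hU ⊤) (le_ι_comp_preimage g' hU' ⊤))

/-- The closed subscheme of an open given by the minors. -/
noncomputable def localSubscheme : (localIdeal f s g g' c d U hU hU').subscheme ⟶ X :=
  (localIdeal f s g g' c d U hU hU').subschemeι ≫ U.ι

instance [QuasiCompact U.ι] : QuasiCompact (localSubscheme f s g g' c d U hU hU') := by
  unfold localSubscheme
  infer_instance

theorem localIdeal_ideal (A : U.toScheme.affineOpens) :
    (localIdeal f s g g' c d U hU hU').ideal A = minorIdeal f (U.ι ≫ s) (U.ι ≫ g) (U.ι ≫ g') c d A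
      (le_ι_comp_preimage g hU A) (le_ι_comp_preimage g' hU' A) :=
  map_minorIdeal ..

theorem incident_localSubscheme : Incident f (localSubscheme f s g g' c d U hU hU' ≫ s)
    (localSubscheme f s g g' c d U hU hU' ≫ g) (localSubscheme f s g g' c d U hU hU' ≫ g') := by
  refine incident_of_cover _ _ _ _ fun x => ?_
  obtain ⟨A, hx, -⟩ := Scheme.exists_affineOpens_mem
    (x := (localIdeal f s g g' c d U hU hU').subschemeι x) (U := ⊤) trivial
  refine ⟨(localIdeal f s g g' c d U hU hU').subschemeι ⁻¹ᵁ A.1, c, d, ?_, ?_, hx, fun b => ?_⟩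
  · intro y _; exact hU ((localIdeal f s g g' c d U hU hU').subschemeι y).2
  · intro y _; exact hU' ((localIdeal f s g g' c d U hU hU').subschemeι y).2
  · have h1 := (localIdeal_ideal f s g g' c d U hU hU' A).ge (Ideal.subset_span ⟨b, rfl⟩)
    rw [← Scheme.IdealSheafData.ker_subschemeι_app, RingHom.mem_ker] at h1
    rw [app_minor] at h1
    simpa only [localSubscheme, Category.assoc] using h1

theorem ker_localSubscheme_le (A : X.affineOpens) (hA : A.1 ≤ U) :
    (localSubscheme f s g g' c d U hU hU').ker.ideal A ≤
      minorIdeal f s g g' c d A (hA.trans hU) (hA.trans hU') := by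
  intro a ha
  have hAU : A.1 ≤ U.ι.opensRange := by rwa [Scheme.Opens.opensRange_ι]
  have h1 := Scheme.app_mem_ideal_of_mem_ker U (localIdeal f s g g' c d U hU hU') A
    (A.2.preimage_of_isOpenImmersion U.ι hAU) a ha
  rw [localIdeal_ideal] at h1
  have h2 := map_appLE_minorIdeal f s g g' U.ι c d A (hA.trans hU) (hA.trans hU')
    (U.ι ⁻¹ᵁ A.1) le_rfl
  rw [← Scheme.Hom.app_eq_appLE] at h2
  replace h1 := h2.ge h1
  have : IsIso (U.ι.app A.1) := U.ι.isIso_app _ hAU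
  exact Ideal.mem_of_map_mem (ConcreteCategory.bijective_of_isIso (U.ι.app A.1)) h1

/-- The largest ideal sheaf contained in the ideals generated by the minors. -/
noncomputable def incidenceIdeal : X.IdealSheafData :=
  .ofIdeals fun A => ⨅ (c) (d) (hc : A.1 ≤ g ⁻¹ᵁ chart c) (hd : A.1 ≤ g' ⁻¹ᵁ chart d),
    minorIdeal f s g g' c d A.1 hc hd

/-- The largest ideal sheaf inside the given family could a priori be too small, so an actual ideal
sheaf containing the minors is exhibited: the intersection `J`, over all pairs of charts, of the
kernels of the local incidence subschemes. On an affine open inside a pair of charts it is contained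
in the ideal of the minors, and the minors belong to it because incidence on each local subscheme
holds in all coordinates. -/
theorem minor_mem_incidenceIdeal (A : X.affineOpens) (c : Fin (Module.finrank k V))
    (d : Fin (Module.finrank k V')) (h : A.1 ≤ g ⁻¹ᵁ chart c) (h' : A.1 ≤ g' ⁻¹ᵁ chart d) (b) :
    minor f s g g' c d A h h' b ∈ (incidenceIdeal f s g g').ideal A := by
  have hq := quasiCompact_chart g g'
  let J : X.IdealSheafData := ⨅ p : Fin (Module.finrank k V) × Fin (Module.finrank k V'),
    (localSubscheme f s g g' p.1 p.2 (g ⁻¹ᵁ chart p.1 ⊓ g' ⁻¹ᵁ chart p.2)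
      inf_le_left inf_le_right).ker
  have hJ : J ≤ incidenceIdeal f s g g' := by
    refine Scheme.IdealSheafData.le_ofIdeals_iff.2 fun A => ?_
    refine le_iInf fun c => le_iInf fun d => le_iInf fun hc => le_iInf fun hd => ?_
    exact le_trans ((iInf_le _ (c, d) : J ≤ _) A)
      (ker_localSubscheme_le f s g g' c d _ inf_le_left inf_le_right A (le_inf hc hd))
  refine hJ A ?_
  rw [Scheme.IdealSheafData.ideal_iInf, iInf_apply]
  refine (Submodule.mem_iInf _).2 fun p => ?_
  rw [Scheme.Hom.ker_apply, RingHom.mem_ker, app_minor]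
  exact incident_localSubscheme ..

theorem incident_of_incidenceIdeal_le {I : X.IdealSheafData} (hI : incidenceIdeal f s g g' ≤ I) :
    Incident f (I.subschemeι ≫ s) (I.subschemeι ≫ g) (I.subschemeι ≫ g') := by
  refine incident_of_cover _ _ _ _ fun x => ?_
  obtain ⟨c, hc⟩ := exists_mem_chart g (I.subschemeι x)
  obtain ⟨d, hd⟩ := exists_mem_chart g' (I.subschemeι x)
  obtain ⟨A, hx, hA⟩ := Scheme.exists_affineOpens_mem
    (U := g ⁻¹ᵁ chart c ⊓ g' ⁻¹ᵁ chart d) ⟨hc, hd⟩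
  refine ⟨I.subschemeι ⁻¹ᵁ A.1, c, d, I.subschemeι.preimage_mono (hA.trans inf_le_left),
    I.subschemeι.preimage_mono (hA.trans inf_le_right), hx, fun b => ?_⟩
  rw [← app_minor f s g g' _ _ _ _ (hA.trans inf_le_left) (hA.trans inf_le_right),
    ← RingHom.mem_ker, Scheme.IdealSheafData.ker_subschemeι_app]
  exact (show (incidenceIdeal f s g g').ideal A ≤ I.ideal A from hI A)
    (minor_mem_incidenceIdeal f s g g' A c d _ _ b)

/-- With `incident_of_incidenceIdeal_le`, this shows that the closed subscheme represents incidence.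
The vanishing is local: near a point where one coordinate of each vector is nonzero, the ideal is
contained in the one generated by the minors, and these pull back to zero. -/
theorem incidenceIdeal_le_ker (p : Y ⟶ X) (h : Incident f (p ≫ s) (p ≫ g) (p ≫ g')) :
    incidenceIdeal f s g g' ≤ p.ker := by
  refine Scheme.IdealSheafData.le_ofIdeals_iff.2 fun A a ha => ?_
  rw [RingHom.mem_ker]
  refine Scheme.eq_zero_of_locally _ fun y hy => ?_
  obtain ⟨c, hc⟩ := exists_mem_chart g (p y)
  obtain ⟨d, hd⟩ := exists_mem_chart g' (p y)
  obtain ⟨B, hx, hB⟩ := Scheme.exists_affineOpens_mem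
    (U := A.1 ⊓ (g ⁻¹ᵁ chart c ⊓ g' ⁻¹ᵁ chart d)) (x := p y) ⟨hy, hc, hd⟩
  have hBA : B ≤ A := hB.trans inf_le_left
  have hBc : B.1 ≤ g ⁻¹ᵁ chart c := (hB.trans inf_le_right).trans inf_le_left
  have hBd : B.1 ≤ g' ⁻¹ᵁ chart d := (hB.trans inf_le_right).trans inf_le_right
  refine ⟨p ⁻¹ᵁ B.1, p.preimage_mono hBA, hx, ?_⟩
  have h1 := (incidenceIdeal f s g g').ideal_le_comap_ideal hBA ha
  have h2 : (incidenceIdeal f s g g').ideal B ≤ minorIdeal f s g g' c d B hBc hBd :=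
    (Scheme.IdealSheafData.ideal_ofIdeals_le _ B).trans
      (iInf_le_of_le c (iInf_le_of_le d (iInf_le_of_le hBc (iInf_le _ hBd))))
  have h3 : minorIdeal f s g g' c d B hBc hBd ≤ RingHom.ker (p.app B.1).hom := by
    rw [minorIdeal, Ideal.span_le]
    rintro _ ⟨b, rfl⟩
    rw [SetLike.mem_coe, RingHom.mem_ker, app_minor]
    exact h ..
  have h4 := h3 (h2 h1)
  rw [RingHom.mem_ker] at h4
  have h5 := congrArg (fun φ => φ.hom a) (p.naturality (homOfLE hBA).op)
  exact h5.symm.trans h4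

end

end ProjSp

/-! ### The universal property of the linked projective space -/

namespace ZRep

open ProjSp LinkedChain

variable {k : Type u} [Field k] (v : ZRep.{u, w} k) (H : Finset ℤ)

theorem pathCoord_eq (i j : H) (c : Fin (Module.finrank k (v.V i))) (U : (v.prodProj H).Opens)
    (h : U ≤ v.prodProjπ H i ⁻¹ᵁ chart c) (b : Fin (Module.finrank k (v.V j))) :
    v.pathCoord H i j c U h b = coordEv (v.prodProjToSpec H) (v.prodProjπ H i) c U h
      ((Module.finBasis k (v.V j)).coord b ∘ₗ v.pathMap i j) := by
  refine Finset.sum_congr rfl fun e _ => ?_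
  rw [LinearMap.toMatrix_apply]
  rfl

theorem pairIdeal_eq (i j : H) : v.pairIdeal H i j = incidenceIdeal (v.pathMap i j)
    (v.prodProjToSpec H) (v.prodProjπ H i) (v.prodProjπ H j) := by
  unfold pairIdeal incidenceIdeal minorIdeal minor
  simp only [pathCoord_eq]

theorem incident_LPπ (i j : H) :
    Incident (v.pathMap i j) (v.LPToSpec H) (v.LPπ H i) (v.LPπ H j) :=
  incident_of_incidenceIdeal_le _ _ _ _
    ((v.pairIdeal_eq H i j).ge.trans (le_iSup₂_of_le (f := v.pairIdeal H) i j le_rfl))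

theorem prodProjπ_toSpec (i : H) :
    v.prodProjπ H i ≫ toSpec k (Module.finrank k (v.V i)) = v.prodProjToSpec H :=
  WidePullback.π_arrow _ i

theorem LPπ_toSpec (i : H) :
    v.LPπ H i ≫ toSpec k (Module.finrank k (v.V i)) = v.LPToSpec H := by
  rw [LPπ, Category.assoc, prodProjπ_toSpec, LPToSpec]

instance : IsClosedImmersion (v.LPι H) := by
  exact inferInstanceAs
    (IsClosedImmersion (⨆ (i : H) (j : H), v.pairIdeal H i j).subschemeι)

theorem ker_LPι : (v.LPι H).ker = ⨆ (i : H) (j : H), v.pairIdeal H i j :=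
  Scheme.IdealSheafData.ker_subschemeι _

theorem LPScheme_hom_ext {T : Scheme.{u}} {g₁ g₂ : T ⟶ v.LPScheme H}
    (h : g₁ ≫ v.LPToSpec H = g₂ ≫ v.LPToSpec H) (h' : ∀ i, g₁ ≫ v.LPπ H i = g₂ ≫ v.LPπ H i) :
    g₁ = g₂ := by
  rw [← cancel_mono (v.LPι H)]
  refine WidePullback.hom_ext _ _ _ (fun i => ?_) ?_
  · have := h' i
    simp only [LPπ, ← Category.assoc] at this
    exact this
  · simp only [LPToSpec, ← Category.assoc] at h
    exact h

/-- The morphism to the product factors through the closed subscheme as soon as its kernel contains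
the defining ideal, and this can be tested pair by pair since the defining ideal is a supremum. -/
theorem exists_hom_LPScheme {T : Scheme.{u}} (s : T ⟶ Spec (.of k))
    (g : ∀ i : H, T ⟶ ProjSp k (Module.finrank k (v.V i)))
    (hs : ∀ i, g i ≫ toSpec k (Module.finrank k (v.V i)) = s)
    (hg : ∀ i j : H, Incident (v.pathMap i j) s (g i) (g j)) :
    ∃ p : T ⟶ v.LPScheme H, p ≫ v.LPToSpec H = s ∧ ∀ i, p ≫ v.LPπ H i = g i := by
  let q : T ⟶ v.prodProj H := WidePullback.lift s g hs
  have h1 : q ≫ v.prodProjToSpec H = s := WidePullback.lift_base _ _ _ _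
  have h2 : ∀ i, q ≫ v.prodProjπ H i = g i := fun i => WidePullback.lift_π _ _ _ _ i
  have h3 : (v.LPι H).ker ≤ q.ker := by
    rw [ker_LPι]
    refine iSup₂_le fun i j => ?_
    rw [pairIdeal_eq]
    refine incidenceIdeal_le_ker _ _ _ _ _ ?_
    rw [h1, h2, h2]
    exact hg i j
  refine ⟨IsClosedImmersion.lift (v.LPι H) q h3, ?_, fun i => ?_⟩
  · rw [LPToSpec, IsClosedImmersion.lift_fac_assoc, h1]
  · rw [LPπ, IsClosedImmersion.lift_fac_assoc, h2]

end ZRep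

/-! ### Loci where a functional does not vanish on a line -/

namespace AlgebraicGeometry

theorem Scheme.toSpecΓ_comp_appTop {X : Scheme.{u}} (U : X.Opens) {R : Type u} [CommRing R]
    (ψ : R →+* Γ(X, U)) (a : R) : (U.toSpecΓ ≫ Spec.map (CommRingCat.ofHom ψ)).appTop.hom
      ((Scheme.ΓSpecIso (.of R)).inv.hom a) = (U.ι.appLE U ⊤ (by simp)).hom (ψ a) := by
  have h1 : (Scheme.ΓSpecIso (.of R)).inv ≫ (U.toSpecΓ ≫ Spec.map (CommRingCat.ofHom ψ)).appTop =
      CommRingCat.ofHom ψ ≫ U.topIso.inv := by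
    rw [Scheme.Hom.comp_appTop, Scheme.Opens.toSpecΓ_appTop, Iso.inv_comp_eq,
      ← Category.assoc, Scheme.ΓSpecIso_naturality, Category.assoc]
  have h2 : U.topIso.inv = U.ι.appLE U ⊤ (by simp) := by
    rw [Scheme.Hom.appLE, Scheme.Opens.ι_app]
    exact X.presheaf.map_comp _ _
  rw [← h2]
  exact congrArg (fun f => f.hom a) h1

end AlgebraicGeometry

namespace ProjSp

open LinkedChain

variable {k : Type u} [Field k]

section

variable {V : Type w} [AddCommGroup V] [Module k V] [FiniteDimensional k V]
  {X Y : Scheme.{u}} (s : X ⟶ Spec (.of k)) (g : X ⟶ ProjSp k (Module.finrank k V))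

/-- The open set where a functional does not vanish on the line given by a morphism to a
projective space. -/
noncomputable def nonvanishing (φ : V →ₗ[k] k) : X.Opens :=
  ⨆ c, X.basicOpen (coordEv s g c (g ⁻¹ᵁ chart c) le_rfl φ)

/-- On an overlap of charts the values of the functional differ by a ratio of coordinates, so
nonvanishing can be tested with any available normalization. -/
theorem inf_nonvanishing (c : Fin (Module.finrank k V)) (U : X.Opens) (h : U ≤ g ⁻¹ᵁ chart c)
    (φ : V →ₗ[k] k) : U ⊓ nonvanishing s g φ = X.basicOpen (coordEv s g c U h φ) := by
  have hbo : ∀ (c' : Fin (Module.finrank k V)) {U W : X.Opens} (hU : U ≤ g ⁻¹ᵁ chart c')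
      (hW : W ≤ U), X.basicOpen (coordEv s g c' W (hW.trans hU) φ) =
        W ⊓ X.basicOpen (coordEv s g c' U hU φ) := by
    intro c' U W hU hW
    rw [← map_coordEv s g c' hU hW]
    exact Scheme.basicOpen_res ..
  apply le_antisymm
  · rintro x ⟨hx, hx'⟩
    obtain ⟨c', hc'⟩ := Opens.mem_iSup.1 hx'
    have hxc' : x ∈ g ⁻¹ᵁ chart c' := X.basicOpen_le _ hc'
    have h1 : x ∈ X.basicOpen (coordEv s g c' (U ⊓ g ⁻¹ᵁ chart c') inf_le_right φ) := by
      rw [hbo c' (le_refl (g ⁻¹ᵁ chart c')) inf_le_right]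
      exact ⟨⟨hx, hxc'⟩, hc'⟩
    rw [coordEv_change s g c' c (U ⊓ g ⁻¹ᵁ chart c') _ (inf_le_left.trans h),
      Scheme.basicOpen_mul, hbo c h inf_le_left] at h1
    exact h1.2.2
  · intro x hx
    have hxU := X.basicOpen_le _ hx
    refine ⟨hxU, Opens.mem_iSup.2 ⟨c, ?_⟩⟩
    rw [hbo c (le_refl (g ⁻¹ᵁ chart c)) h] at hx
    exact hx.2

theorem preimage_nonvanishing (p : Y ⟶ X) (φ : V →ₗ[k] k) :
    p ⁻¹ᵁ nonvanishing s g φ = nonvanishing (p ≫ s) (p ≫ g) φ := by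
  rw [nonvanishing, Scheme.Hom.preimage_iSup, nonvanishing]
  congr 1
  funext c
  have := Scheme.basicOpen_appLE p (p ⁻¹ᵁ g ⁻¹ᵁ chart c) (g ⁻¹ᵁ chart c) le_rfl
    (coordEv s g c (g ⁻¹ᵁ chart c) le_rfl φ)
  rw [appLE_coordEv] at this
  refine Eq.trans ?_ this.symm
  exact (inf_eq_right.2 (p.preimage_mono (X.basicOpen_le _))).symm

theorem nonvanishing_coord (b : Fin (Module.finrank k V)) :
    nonvanishing s g ((Module.finBasis k V).coord b) = g ⁻¹ᵁ chart b := by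
  ext x
  obtain ⟨c, hc⟩ := exists_mem_chart g x
  have := inf_nonvanishing s g c (g ⁻¹ᵁ chart c) le_rfl ((Module.finBasis k V).coord b)
  rw [coordEv_coord, basicOpen_coord] at this
  have h2 := congrArg (x ∈ ·) this
  simp only [Opens.mem_inf, hc, true_and, eq_iff_iff] at h2
  exact h2

end

theorem scalar_SpecMap {A : CommRingCat.{u}} (σ : CommRingCat.of k ⟶ A) (a : k) :
    scalar (Spec.map σ) ⊤ a = (Scheme.ΓSpecIso A).inv.hom (σ.hom a) := by
  have h1 : (Spec.map σ).appLE ⊤ ⊤ le_top = (Spec.map σ).appTop := (Scheme.Hom.app_eq_appLE _).symm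
  have h2 : (Scheme.ΓSpecIso (.of k)).inv ≫ (Spec.map σ).appTop = σ ≫ (Scheme.ΓSpecIso A).inv := by
    rw [Iso.inv_comp_eq, ← Category.assoc, Iso.eq_comp_inv, Scheme.ΓSpecIso_naturality]
  rw [scalar_eq, h1, h2]
  rfl

end ProjSp

/-! ### Charts of the linked projective space as spectra -/

namespace ZRep

open ProjSp LinkedChain

variable {k : Type u} [Field k] {v : ZRep.{u, w} k} {H : Finset ℤ}

/-- The open set where the coordinates prescribed by `c` do not vanish. -/
noncomputable def chartOpen (c : Chart v H) : (v.LPScheme H).Opens :=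
  ⟨⋂ i, (v.LPπ H i ⁻¹ᵁ chart (c i) : (v.LPScheme H).Opens),
    isOpen_iInter_of_finite fun i : H => (v.LPπ H i ⁻¹ᵁ chart (c i)).isOpen⟩

theorem mem_chartOpen {c : Chart v H} {x : v.LPScheme H} :
    x ∈ chartOpen c ↔ ∀ i, x ∈ v.LPπ H i ⁻¹ᵁ chart (c i) :=
  Set.mem_iInter

theorem chartOpen_le (c : Chart v H) (i : H) : chartOpen c ≤ v.LPπ H i ⁻¹ᵁ chart (c i) :=
  fun _ hx => mem_chartOpen.1 hx i

theorem exists_mem_chartOpen (x : v.LPScheme H) : ∃ c : Chart v H, x ∈ chartOpen c := by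
  choose c hc using fun i => exists_mem_chart (v.LPπ H i) x
  exact ⟨c, mem_chartOpen.2 hc⟩

/-- The coordinates on an open where the coordinates prescribed by `c` do not vanish. -/
theorem isPoint_coord (c : Chart v H) (U : (v.LPScheme H).Opens)
    (h : ∀ i, U ≤ v.LPπ H i ⁻¹ᵁ chart (c i)) :
    IsPoint (scalar (v.LPToSpec H) U) c fun i b => coord (v.LPπ H i) (c i) U (h i) b where
  apply_eq_one _ := coord_self _ _ _ _
  minors i j b b' := sub_eq_zero.1
    (v.incident_LPπ H i j (c i) (c j) U (h i) (h j) (b, b'))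

theorem exists_hom_of_isPoint {T : Scheme.{u}} (s : T ⟶ Spec (.of k)) {c : Chart v H}
    {x : ∀ i : H, Fin (Module.finrank k (v.V i)) → Γ(T, ⊤)} (hx : IsPoint (scalar s ⊤) c x) :
    ∃ p : T ⟶ v.LPScheme H, p ≫ v.LPToSpec H = s ∧
      ∀ i, ∃ h : ⊤ ≤ (p ≫ v.LPπ H i) ⁻¹ᵁ chart (c i), ∀ b,
        coord (p ≫ v.LPπ H i) (c i) ⊤ h b = x i b := by
  choose g hg hs hgx using fun i => ProjSp.exists_hom s (c i) (x i) (hx.apply_eq_one i)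
  obtain ⟨p, hp, hp'⟩ := v.exists_hom_LPScheme H s g hs fun i j =>
    incident_of_cover _ _ _ _ fun y => ⟨⊤, c i, c j, hg i, hg j, trivial, fun b => by
      rw [minor, coordEv, coordEv, hgx, hgx, sub_eq_zero, funext (hgx i)]
      exact hx.minors i j b.1 b.2⟩
  refine ⟨p, hp, fun i => ?_⟩
  rw [hp']
  exact ⟨hg i, hgx i⟩

theorem exists_chartMap (c : Chart v H) :
    ∃ p : Spec (.of (ChartRing c)) ⟶ v.LPScheme H,
      p ≫ v.LPToSpec H = Spec.map (CommRingCat.ofHom (algebraMap k (ChartRing c))) ∧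
      ∀ i, ∃ h : ⊤ ≤ (p ≫ v.LPπ H i) ⁻¹ᵁ chart (c i), ∀ b,
        coord (p ≫ v.LPπ H i) (c i) ⊤ h b =
          (Scheme.ΓSpecIso (.of (ChartRing c))).inv.hom (gen c i b) := by
  refine exists_hom_of_isPoint _ ?_
  have h1 := (gen_isPoint c).map (Scheme.ΓSpecIso (.of (ChartRing c))).inv.hom
  convert h1 using 1
  exact RingHom.ext fun a => scalar_SpecMap _ a

/-- The parametrization of the part of the linked projective space where the coordinates
prescribed by `c` do not vanish. -/
noncomputable def chartMap (c : Chart v H) : Spec (.of (ChartRing c)) ⟶ v.LPScheme H :=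
  (exists_chartMap c).choose

theorem chartMap_toSpec (c : Chart v H) : chartMap c ≫ v.LPToSpec H =
    Spec.map (CommRingCat.ofHom (algebraMap k (ChartRing c))) :=
  (exists_chartMap c).choose_spec.1

theorem chartMap_le (c : Chart v H) (i : H) :
    ⊤ ≤ (chartMap c ≫ v.LPπ H i) ⁻¹ᵁ chart (c i) :=
  ((exists_chartMap c).choose_spec.2 i).choose

theorem coord_chartMap (c : Chart v H) (i : H) (b) :
    coord (chartMap c ≫ v.LPπ H i) (c i) ⊤ (chartMap_le c i) b =
      (Scheme.ΓSpecIso (.of (ChartRing c))).inv.hom (gen c i b) :=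
  ((exists_chartMap c).choose_spec.2 i).choose_spec b

theorem coordEv_chartMap (c : Chart v H) (i : H) (φ : v.V i →ₗ[k] k) :
    coordEv (chartMap c ≫ v.LPToSpec H) (chartMap c ≫ v.LPπ H i) (c i) ⊤ (chartMap_le c i) φ =
      (Scheme.ΓSpecIso (.of (ChartRing c))).inv.hom
        (stdEv (algebraMap k (ChartRing c)) φ (gen c i)) := by
  rw [stdEv, map_ev, coordEv]
  congr 1
  · rw [chartMap_toSpec]
    exact RingHom.ext fun a => scalar_SpecMap _ a
  · exact funext (coord_chartMap c i)

/-- A morphism to the spectrum is determined by the images of the scalars and of the generators `gen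
c`, and both are recovered from its composite with `chartMap c`. This makes the one-sided inverse
`chartInv c` an isomorphism. -/
instance (c : Chart v H) : Mono (chartMap c) := by
  refine ⟨fun {T} f g hfg => ?_⟩
  apply ext_of_isAffine
  rw [← cancel_epi (Scheme.ΓSpecIso (.of (ChartRing c))).inv]
  have htop : ∀ p : T ⟶ Spec (.of (ChartRing c)), p.appTop = p.appLE ⊤ ⊤ p.top_le_preimage_top :=
    fun p => p.app_eq_appLE
  apply CommRingCat.hom_ext
  refine chartRing_hom_ext ?_ fun i b => ?_
  · have h1 : f ≫ Spec.map (CommRingCat.ofHom (algebraMap k (ChartRing c))) =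
        g ≫ Spec.map (CommRingCat.ofHom (algebraMap k (ChartRing c))) := by
      rw [← chartMap_toSpec, reassoc_of% hfg]
    refine RingHom.ext fun a => ?_
    have key : ∀ p : T ⟶ Spec (.of (ChartRing c)), p.appTop.hom
        ((Scheme.ΓSpecIso (.of (ChartRing c))).inv.hom (algebraMap k (ChartRing c) a)) =
        scalar (p ≫ Spec.map (CommRingCat.ofHom (algebraMap k (ChartRing c)))) ⊤ a := by
      intro p
      rw [htop, ← appLE_scalar p _ ⊤ ⊤ p.top_le_preimage_top, scalar_SpecMap]
      rfl
    exact (key f).trans ((congrArg (fun s => scalar s ⊤ a) h1).trans (key g).symm)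
  · have key : ∀ p : T ⟶ Spec (.of (ChartRing c)), ∃ h, p.appTop.hom
        ((Scheme.ΓSpecIso (.of (ChartRing c))).inv.hom (gen c i b)) =
        coord ((p ≫ chartMap c) ≫ v.LPπ H i) (c i) ⊤ h b := by
      intro p
      refine ⟨?_, ?_⟩
      · rw [Category.assoc]
        exact p.top_le_preimage_top.trans (p.preimage_mono (chartMap_le c i))
      · rw [htop, ← coord_chartMap, appLE_coord]
        simp only [Category.assoc]
    obtain ⟨hf, ef⟩ := key f
    obtain ⟨hg, eg⟩ := key g
    refine ef.trans (Eq.trans ?_ eg.symm)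
    congr 1
    rw [hfg]

/-- The inverse of `chartMap`. -/
noncomputable def chartInv (c : Chart v H) :
    (chartOpen c).toScheme ⟶ Spec (.of (ChartRing c)) :=
  (chartOpen c).toSpecΓ ≫ Spec.map (CommRingCat.ofHom
    (chartLift (isPoint_coord c (chartOpen c) (chartOpen_le c))))

theorem chartInv_appTop (c : Chart v H) (a : ChartRing c) :
    (chartInv c).appTop.hom ((Scheme.ΓSpecIso (.of (ChartRing c))).inv.hom a) =
      ((chartOpen c).ι.appLE (chartOpen c) ⊤ (by simp)).hom
        (chartLift (isPoint_coord c (chartOpen c) (chartOpen_le c)) a) := by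
  rw [chartInv]
  exact Scheme.toSpecΓ_comp_appTop (chartOpen c)
    (chartLift (isPoint_coord c (chartOpen c) (chartOpen_le c))) a

theorem chartInv_chartMap (c : Chart v H) : chartInv c ≫ chartMap c = (chartOpen c).ι := by
  have htop : (chartInv c).appTop =
      (chartInv c).appLE ⊤ ⊤ (chartInv c).top_le_preimage_top := (chartInv c).app_eq_appLE
  have hs : (chartInv c ≫ chartMap c) ≫ v.LPToSpec H = (chartOpen c).ι ≫ v.LPToSpec H := by
    refine scalar_ext fun a => ?_
    rw [Category.assoc, chartMap_toSpec, ← appLE_scalar (chartInv c) _ ⊤ ⊤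
      (chartInv c).top_le_preimage_top, scalar_SpecMap, ← htop]
    refine (chartInv_appTop c _).trans ?_
    rw [CommRingCat.hom_ofHom, chartLift_algebraMap, appLE_scalar]
  refine v.LPScheme_hom_ext H hs fun i => ?_
  have h1 : ⊤ ≤ ((chartInv c ≫ chartMap c) ≫ v.LPπ H i) ⁻¹ᵁ chart (c i) := by
    rw [Category.assoc]
    exact (chartInv c).top_le_preimage_top.trans ((chartInv c).preimage_mono (chartMap_le c i))
  have h2 : ⊤ ≤ ((chartOpen c).ι ≫ v.LPπ H i) ⁻¹ᵁ chart (c i) :=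
    le_ι_comp_preimage (v.LPπ H i) (chartOpen_le c i) ⊤
  refine ProjSp.hom_ext (c i) h1 h2 ?_ fun b => ?_
  · rw [Category.assoc, Category.assoc _ _ (toSpec _ _), LPπ_toSpec, hs]
  · rw [← appLE_coord (chartOpen c).ι _ _ (chartOpen c) (chartOpen_le c i) ⊤ (by simp),
      ← chartLift_gen (isPoint_coord c (chartOpen c) (chartOpen_le c)), ← chartInv_appTop,
      ← coord_chartMap, htop, appLE_coord]
    simp only [Category.assoc]

theorem range_chartMap_subset (c : Chart v H) :
    Set.range (chartMap c) ⊆ Set.range (chartOpen c).ι := by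
  rw [Scheme.Opens.range_ι]
  rintro _ ⟨x, rfl⟩
  exact mem_chartOpen.2 fun i => chartMap_le c i trivial

instance (c : Chart v H) : IsIso (chartInv c) := by
  have h := IsOpenImmersion.lift_fac (chartOpen c).ι (chartMap c) (range_chartMap_subset c)
  refine ⟨IsOpenImmersion.lift (chartOpen c).ι (chartMap c) (range_chartMap_subset c), ?_, ?_⟩
  · rw [← cancel_mono (chartOpen c).ι, Category.assoc, h, chartInv_chartMap, Category.id_comp]
  · rw [← cancel_mono (chartMap c), Category.assoc, chartInv_chartMap, h, Category.id_comp]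

theorem chartMap_eq (c : Chart v H) : chartMap c = inv (chartInv c) ≫ (chartOpen c).ι := by
  rw [IsIso.eq_inv_comp, chartInv_chartMap]

instance (c : Chart v H) : IsOpenImmersion (chartMap c) := by
  rw [chartMap_eq]
  infer_instance

theorem opensRange_chartMap (c : Chart v H) : (chartMap c).opensRange = chartOpen c := by
  simp only [chartMap_eq]
  rw [Scheme.Hom.opensRange_comp_of_isIso, Scheme.Opens.opensRange_ι]

variable (v H) in
/-- The points where a functional does not vanish on the line at the vertex `i`. -/
noncomputable def LPnz (i : H) (φ : v.V i →ₗ[k] k) : (v.LPScheme H).Opens :=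
  nonvanishing (v.LPToSpec H) (v.LPπ H i) φ

theorem mem_LPnz_chartMap (c : Chart v H) (i : H) (φ : v.V i →ₗ[k] k)
    (x : Spec (.of (ChartRing c))) : chartMap c x ∈ LPnz v H i φ ↔
      stdEv (algebraMap k (ChartRing c)) φ (gen c i) ∉ x.asIdeal := by
  have h := preimage_nonvanishing (v.LPToSpec H) (v.LPπ H i) (chartMap c) φ
  have h2 := inf_nonvanishing (chartMap c ≫ v.LPToSpec H) (chartMap c ≫ v.LPπ H i) (c i) ⊤
    (chartMap_le c i) φ
  rw [← h, top_inf_eq, coordEv_chartMap] at h2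
  have h3 : x ∈ chartMap c ⁻¹ᵁ nonvanishing (v.LPToSpec H) (v.LPπ H i) φ ↔ _ :=
    Iff.of_eq (congrArg (x ∈ ·) h2)
  refine h3.trans ?_
  rw [basicOpen_eq_of_affine]
  rfl

end ZRep

/-! ### Cells, flow sets and their generic points -/

namespace ZRep

open ProjSp LinkedChain

variable {k : Type u} [Field k] {v : ZRep.{u, w} k} {r : ℕ} {m n : ℤ} (C : v.Coords r m n)
  {c : Chart v (Finset.Icc m n)} {d : ℤ → Bool} {s : Fin r} {q : ℤ → Fin r}

theorem Coords.t_mem (b : Fin r) : C.t b ∈ Finset.Icc m n := Finset.mem_Icc.2 (C.le_t b)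

/-- The points where the coordinate `b` in the basis of `C` does not vanish on the line at the
vertex `i`. -/
noncomputable def Coords.nz (i : Finset.Icc m n) (b : Fin r) :
    (v.LPScheme (Finset.Icc m n)).Opens :=
  LPnz v _ i ((C.basis i).coord b)

theorem Coords.mem_nz_chartMap (i : Finset.Icc m n) (b : Fin r)
    (x : Spec (.of (ChartRing c))) : chartMap c x ∈ C.nz i b ↔ C.genVec c i b ∉ x.asIdeal := by
  have h : C.genVec c i b = stdEv (algebraMap k (ChartRing c)) ((C.basis i).coord b) (gen c i) :=
    C.vec_coe _ _ _ _
  rw [h]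
  exact mem_LPnz_chartMap c i _ x

theorem Coords.srcFun_notMem_iff (x : PrimeSpectrum (ChartRing c)) :
    C.srcFun c d s q ∉ x.asIdeal ↔ C.genVec c (C.t s) s ∉ x.asIdeal ∧
      ∀ e ∈ Finset.Ico m n, C.genVec c (src d e) (q e) ∉ x.asIdeal := by
  rw [srcFun, x.2.mul_mem_iff_mem_or_mem, x.2.prod_mem_iff]
  push Not
  rfl

/-- The open set parametrized by an open subscheme of an affine space. -/
noncomputable def Coords.cell (c : Chart v (Finset.Icc m n)) (d : ℤ → Bool) (s : Fin r)
    (q : ℤ → Fin r) : Set (v.LPScheme (Finset.Icc m n)) :=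
  {x | x ∈ chartOpen c ∧ x ∈ C.nz ⟨C.t s, C.t_mem s⟩ s ∧
    ∀ e (he : e ∈ Finset.Ico m n), x ∈ C.nz ⟨src d e, src_mem he⟩ (q e)}

/-- Geometric form of `Coords.exists_algEquiv`: the cell is the basic open set of `srcFun` in the
chart. Functionals can be tested on the truncated affine vector, since the universal vector at each
vertex is a unit multiple of it. -/
theorem Coords.exists_param (hq : ∀ e ∈ Finset.Ico m n, C.Survives d e (q e)) :
    ∃ p : Spec (.of (Localization.Away (C.affFun c d s q))) ⟶ v.LPScheme (Finset.Icc m n),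
      IsOpenImmersion p ∧
      p ≫ v.LPToSpec _ = Spec.map (CommRingCat.ofHom (algebraMap k _)) ∧
      (∃ φ : ChartRing c →ₐ[k] Localization.Away (C.affFun c d s q),
        p = Spec.map (CommRingCat.ofHom φ.toRingHom) ≫ chartMap c) ∧
      Set.range p = C.cell c d s q ∧
      ∀ y i φ, p y ∈ LPnz v _ i φ ↔ algebraMap _ (Localization.Away (C.affFun c d s q))
        (ev MvPolynomial.C (C.basis i) φ (C.trunc d (affCoord k s) i)) ∉ y.asIdeal := by
  obtain ⟨f, hf⟩ := C.exists_algEquiv (c := c) (s := s) hq (Localization.Away (C.srcFun c d s q))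
    (Localization.Away (C.affFun c d s q))
  let g : CommRingCat.of (Localization.Away (C.srcFun c d s q)) ≅
    CommRingCat.of (Localization.Away (C.affFun c d s q)) := f.toRingEquiv.toCommRingCatIso
  let j : Spec (.of (Localization.Away (C.srcFun c d s q))) ⟶ Spec (.of (ChartRing c)) :=
    Spec.map (CommRingCat.ofHom (algebraMap _ _))
  refine ⟨Spec.map g.hom ≫ j ≫ chartMap c, inferInstance, ?_,
    ⟨f.toAlgHom.comp (IsScalarTower.toAlgHom k _ _), ?_⟩, ?_, ?_⟩
  · rw [Category.assoc, Category.assoc, chartMap_toSpec, ← Spec.map_comp, ← Spec.map_comp]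
    congr 1
    apply CommRingCat.hom_ext
    ext a
    change f (algebraMap _ _ (algebraMap k (ChartRing c) a)) = _
    rw [← IsScalarTower.algebraMap_apply, f.commutes]
    rfl
  · rw [← Category.assoc, ← Spec.map_comp]
    rfl
  · have h1 : Set.range (Spec.map g.hom) = Set.univ :=
      Set.range_eq_univ.2 (Spec.map g.hom).surjective
    have h2 : Set.range j = {x | C.srcFun c d s q ∉ x.asIdeal} :=
      PrimeSpectrum.localization_away_comap_range _ (C.srcFun c d s q)
    have h3 : Set.range (Spec.map g.hom ≫ j ≫ chartMap c) = chartMap c '' Set.range j := by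
      ext x
      constructor
      · rintro ⟨y, rfl⟩
        exact ⟨j (Spec.map g.hom y), ⟨_, rfl⟩, by simp⟩
      · rintro ⟨_, ⟨y, rfl⟩, rfl⟩
        obtain ⟨y, rfl⟩ := (Spec.map g.hom).surjective y
        exact ⟨y, by simp⟩
    rw [h3, h2]
    ext x
    constructor
    · rintro ⟨y, hy, rfl⟩
      obtain ⟨hy1, hy2⟩ := (C.srcFun_notMem_iff y).1 hy
      refine ⟨?_, (C.mem_nz_chartMap _ _ _).2 hy1,
          fun e he => (C.mem_nz_chartMap _ _ _).2 (hy2 e he)⟩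
      rw [← opensRange_chartMap]
      exact ⟨y, rfl⟩
    · rintro ⟨hx, hx1, hx2⟩
      rw [← opensRange_chartMap] at hx
      obtain ⟨y, rfl⟩ := hx
      exact ⟨y, (C.srcFun_notMem_iff y).2 ⟨(C.mem_nz_chartMap _ _ _).1 hx1,
        fun e he => (C.mem_nz_chartMap _ _ _).1 (hx2 e he)⟩, rfl⟩
  · intro y i φ
    obtain ⟨a, ha⟩ := hf i
    rw [Scheme.Hom.comp_apply, Scheme.Hom.comp_apply, mem_LPnz_chartMap]
    change f (algebraMap _ _ (stdEv (algebraMap k (ChartRing c)) φ (gen c i))) ∉ y.asIdeal ↔ _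
    rw [ha, Ideal.unit_mul_mem_iff_mem _ a.isUnit]

theorem isDomain_of_isLocalization_away {R : Type*} [CommRing R] [IsDomain R] {f : R} (hf : f ≠ 0)
    (S : Type*) [CommRing S] [Algebra R S] [IsLocalization.Away f S] : IsDomain S :=
  IsLocalization.isDomain_of_le_nonZeroDivisors S (powers_le_nonZeroDivisors_of_noZeroDivisors hf)

theorem Coords.affFun_ne_zero (hq : ∀ e ∈ Finset.Ico m n, C.Survives d e (q e))
    (h : (C.cell c d s q).Nonempty) : C.affFun c d s q ≠ 0 := by
  intro h0
  obtain ⟨p, -, -, -, hp, -⟩ := C.exists_param (c := c) (s := s) hq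
  rw [← hp] at h
  obtain ⟨_, y, rfl⟩ := h
  have : Subsingleton (Localization.Away (C.affFun c d s q)) :=
    IsLocalization.subsingleton (M := Submonoid.powers (C.affFun c d s q))
      ⟨1, by simp [h0]⟩
  exact y.2.ne_top (Subsingleton.elim _ _)

/-- The points of the linked projective space at which the maps along the flow `d` are nonzero. -/
def Coords.flow (d : ℤ → Bool) : Set (v.LPScheme (Finset.Icc m n)) :=
  {x | ∀ e (he : e ∈ Finset.Ico m n), ∃ b, C.Survives d e b ∧ x ∈ C.nz ⟨src d e, src_mem he⟩ b}

theorem Coords.isOpen_flow (d : ℤ → Bool) : IsOpen (C.flow d) := by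
  have : C.flow d = ⋂ e : Finset.Ico m n, ⋃ b : {b // C.Survives d e b},
      (C.nz ⟨src d e, src_mem e.2⟩ b : Set (v.LPScheme (Finset.Icc m n))) := by
    ext x
    simp [flow]
  rw [this]
  exact isOpen_iInter_of_finite fun e => isOpen_iUnion fun b => (C.nz _ _).isOpen

theorem Coords.cell_subset_flow (hq : ∀ e ∈ Finset.Ico m n, C.Survives d e (q e)) :
    C.cell c d s q ⊆ C.flow d :=
  fun _ hx e he => ⟨q e, hq e he, hx.2.2 e he⟩

/-- The flow condition supplies `q`. For `s`, take any coordinate that is nonzero at the vertex `m`: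
the vectors are truncations of one vector `z`, so this coordinate of `z` is nonzero and is seen at
its own peak. -/
theorem Coords.exists_mem_cell (hmn : m ≤ n) {x} (hx : x ∈ C.flow d)
    (hc : x ∈ chartOpen c) : ∃ s q, (∀ e ∈ Finset.Ico m n,
        C.Survives d e (q e)) ∧ x ∈ C.cell c d s q := by
  obtain ⟨y, rfl⟩ : x ∈ Set.range (chartMap c) := by
    rw [← opensRange_chartMap] at hc
    exact hc
  let K := FractionRing (ChartRing c ⧸ y.asIdeal)
  have := y.2
  let π : ChartRing c →+* K :=
    (algebraMap (ChartRing c ⧸ y.asIdeal) K).comp (Ideal.Quotient.mk y.asIdeal)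
  have hπ : ∀ a, π a = 0 ↔ a ∈ y.asIdeal := by
    intro a
    rw [← Ideal.Quotient.eq_zero_iff_mem]
    exact map_eq_zero_iff _ (IsFractionRing.injective (ChartRing c ⧸ y.asIdeal) K)
  have hpt := (gen_isPoint c).map π
  have hyπ : ∀ (i : Finset.Icc m n) b, C.vec (π.comp (algebraMap k _)) (fun i e => π (gen c i e)) i b ≠ 0 ↔
      chartMap c y ∈ C.nz i b := by
    intro i b
    rw [← C.map_genVec, C.mem_nz_chartMap, Ne, hπ]
  choose q' hq' hq'' using hx
  obtain ⟨b₀, hb₀⟩ : ∃ b₀, C.vec (π.comp (algebraMap k _)) (fun i e => π (gen c i e)) m b₀ ≠ 0 := by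
    obtain ⟨w, hw⟩ := hpt.unimodular_vec C m le_rfl hmn
    by_contra! hcon
    simp [hcon] at hw
  let q : ℤ → Fin r := fun e => if he : e ∈ Finset.Ico m n then q' e he else b₀
  have hqe : ∀ e (he : e ∈ Finset.Ico m n), q e = q' e he := fun e he => dif_pos he
  have hq : ∀ e ∈ Finset.Ico m n, C.Survives d e (q e) := fun e he => by
    rw [hqe e he]
    exact hq' e he
  have hqn : ∀ e (he : e ∈ Finset.Ico m n), chartMap c y ∈ C.nz ⟨src d e, src_mem he⟩ (q e) :=
    fun e he => by
      rw [hqe e he]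
      exact hq'' e he
  obtain ⟨a, z, haz⟩ := C.exists_eq_trunc hpt hq fun e he =>
    isUnit_iff_ne_zero.2 ((hyπ ⟨src d e, src_mem he⟩ _).2 (hqn e he))
  rw [haz m (by simp [hmn])] at hb₀
  refine ⟨b₀, q, hq, hc, ?_, hqn⟩
  rw [← hyπ, haz _ (C.t_mem b₀), Coords.trunc, if_pos (reach_self _ _)]
  refine mul_ne_zero (a _).ne_zero fun hz => ?_
  rw [Coords.trunc] at hb₀
  split_ifs at hb₀
  · exact hb₀ (by rw [hz, mul_zero])
  · exact hb₀ (mul_zero _)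

/-- The generic point of a cell lies on the open set where a functional does not vanish if and
only if the functional is nonzero on the span of the coordinates reached by the flow. -/
theorem Coords.exists_genericPoint_cell (hq : ∀ e ∈ Finset.Ico m n, C.Survives d e (q e))
    (h : (C.cell c d s q).Nonempty) : ∃ ξ ∈ C.cell c d s q, (∀ x ∈ C.cell c d s q, ξ ⤳ x) ∧
      ∀ i φ, ξ ∈ LPnz v _ i φ ↔ ∃ b, Reach d (C.t b) i ∧ φ (C.basis i b) ≠ 0 := by
  obtain ⟨p, _, -, -, hp, hnz⟩ := C.exists_param (c := c) (s := s) hq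
  have hne := C.affFun_ne_zero hq h
  have : IsDomain (Localization.Away (C.affFun c d s q)) := isDomain_of_isLocalization_away hne _
  let ζ : PrimeSpectrum (Localization.Away (C.affFun c d s q)) := ⊥
  refine ⟨p ζ, by rw [← hp]; exact ⟨_, rfl⟩, ?_, ?_⟩
  · rw [← hp]
    rintro _ ⟨y, rfl⟩
    have h1 : ζ ⤳ y := (PrimeSpectrum.le_iff_specializes _ _).1 bot_le
    exact h1.map p.continuous
  · intro i φ
    refine (hnz ζ i φ).trans ?_
    change algebraMap _ _ _ ∉ (⊥ : Ideal _) ↔ _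
    rw [Ideal.mem_bot, map_eq_zero_iff _ (IsLocalization.injective _
      (powers_le_nonZeroDivisors_of_noZeroDivisors hne)), C.ev_trunc_eq_zero_iff]
    push Not
    rfl

/-- Membership in a cell, including the chart condition, says that certain functionals do not
vanish. At the generic point of a cell this depends only on `d`, so that point lies in every
nonempty cell of the same flow and generizes all of them. -/
theorem Coords.exists_genericPoint_flow (hmn : m ≤ n) (h : (C.flow d).Nonempty) :
    ∃ ξ ∈ C.flow d, (∀ x ∈ C.flow d, ξ ⤳ x) ∧ ∀ c s (q : ℤ → Fin r),
      (∀ e ∈ Finset.Ico m n, C.Survives d e (q e)) → (C.cell c d s q).Nonempty →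
      ξ ∈ C.cell c d s q := by
  -- generic points of cells lie in all nonempty cells
  have key : ∀ c' s' q', (∀ e ∈ Finset.Ico m n, C.Survives d e (q' e)) →
      (C.cell c' d s' q').Nonempty →
      ∀ ξ : v.LPScheme (Finset.Icc m n),
      (∀ i φ, ξ ∈ LPnz v _ i φ ↔ ∃ b, Reach d (C.t b) i ∧ φ (C.basis i b) ≠ 0) →
      ξ ∈ C.cell c' d s' q' := by
    intro c' s' q' hq' hne ξ hξ
    obtain ⟨ξ', hξ'm, -, hξ'⟩ := C.exists_genericPoint_cell hq' hne
    have hiff : ∀ i φ, ξ ∈ LPnz v _ i φ ↔ ξ' ∈ LPnz v _ i φ := fun i φ =>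
      (hξ i φ).trans (hξ' i φ).symm
    refine ⟨mem_chartOpen.2 fun i => ?_, (hiff _ _).2 hξ'm.2.1, fun e he =>
      (hiff _ _).2 (hξ'm.2.2 e he)⟩
    rw [← nonvanishing_coord (v.LPToSpec _)]
    refine (hiff _ _).2 ?_
    rw [LPnz, nonvanishing_coord]
    exact mem_chartOpen.1 hξ'm.1 i
  obtain ⟨x, hx⟩ := h
  obtain ⟨c, hc⟩ := exists_mem_chartOpen x
  obtain ⟨s, q, hq, hxc⟩ := C.exists_mem_cell hmn hx hc
  obtain ⟨ξ, hξm, hsp, hξ⟩ := C.exists_genericPoint_cell hq ⟨x, hxc⟩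
  refine ⟨ξ, C.cell_subset_flow hq hξm, fun x hx => ?_, fun c' s' q' hq' hne =>
    key c' s' q' hq' hne ξ hξ⟩
  obtain ⟨c', hc'⟩ := exists_mem_chartOpen x
  obtain ⟨s', q', hq', hxc'⟩ := C.exists_mem_cell hmn hx hc'
  obtain ⟨ξ', -, hsp', hξ'⟩ := C.exists_genericPoint_cell hq' ⟨x, hxc'⟩
  exact (hsp ξ' (key c s q hq ⟨ξ, hξm⟩ ξ' hξ')).trans (hsp' x hxc')

end ZRep

/-! ### Irreducible components from open sets with generic points -/

section Topology

variable {X : Type*} [TopologicalSpace X]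

theorem exists_specializes_forall_eq [QuasiSober X] [T0Space X] (x : X) :
    ∃ ξ, ξ ⤳ x ∧ closure {ξ} ∈ irreducibleComponents X ∧ ∀ x', x' ⤳ ξ → x' = ξ := by
  obtain ⟨ξ, hξ⟩ := QuasiSober.sober (isIrreducible_irreducibleComponent (x := x))
    isClosed_irreducibleComponent
  have hcl : closure {ξ} = irreducibleComponent x := hξ
  have hmem : closure {ξ} ∈ irreducibleComponents X := by
    rw [hcl]
    exact irreducibleComponent_mem_irreducibleComponents x
  refine ⟨ξ, hξ.specializes mem_irreducibleComponent, hmem, fun x' hx' => ?_⟩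
  have h1 : closure {x'} ⊆ closure {ξ} :=
    hmem.2 isIrreducible_singleton.closure hx'.closure_subset
  exact (hx'.antisymm (specializes_iff_mem_closure.2 (h1 (subset_closure rfl)))).eq

/-- Irreducible components described by a family of open sets with generic points. -/
theorem irreducibleComponents_eq_of_genericPoint [QuasiSober X] [T0Space X] {ι : Type*}
    (F : ι → Set X) (hF : ∀ i, IsOpen (F i))
    (hgen : ∀ i, (F i).Nonempty → ∃ ξ ∈ F i, ∀ x ∈ F i, ξ ⤳ x)
    (hcov : ∀ x, (∀ x', x' ⤳ x → x' = x) → ∃ i, x ∈ F i) :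
    irreducibleComponents X = {Z | ∃ i, (F i).Nonempty ∧ Z = closure (F i)} := by
  have hcl : ∀ i, ∀ ξ ∈ F i, (∀ x ∈ F i, ξ ⤳ x) → closure (F i) = closure {ξ} :=
    fun i ξ hξ h => subset_antisymm
      (closure_minimal (fun x hx => (h x hx).mem_closure) isClosed_closure)
      (closure_mono (Set.singleton_subset_iff.2 hξ))
  ext Z
  constructor
  · intro hZ
    obtain ⟨ξ, hξ⟩ := QuasiSober.sober hZ.1 (isClosed_of_mem_irreducibleComponents Z hZ)
    obtain ⟨ξ', hsp, hmem, hmax⟩ := exists_specializes_forall_eq ξ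
    have hsub : closure {ξ} ⊆ closure {ξ'} := hsp.closure_subset
    have hZ' : Z = closure {ξ'} := by
      rw [hξ.def] at hsub
      exact subset_antisymm hsub (hZ.2 hmem.1 hsub)
    -- The generic point of the open set containing `ξ'` generizes `ξ'`, so it is `ξ'` itself by
    -- maximality.
    obtain ⟨i, hi⟩ := hcov ξ' hmax
    obtain ⟨η, hη, hη'⟩ := hgen i ⟨_, hi⟩
    refine ⟨i, ⟨_, hi⟩, ?_⟩
    rw [hcl i η hη hη', hmax η (hη' _ hi), hZ']
  · rintro ⟨i, hne, rfl⟩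
    obtain ⟨η, hη, hη'⟩ := hgen i hne
    obtain ⟨ξ, hsp, hmem, -⟩ := exists_specializes_forall_eq η
    have h1 : ξ = η := (hsp.antisymm (hη' ξ (hsp.mem_open (hF i) hη))).eq
    rw [hcl i η hη hη', ← h1]
    exact hmem

end Topology

namespace AlgebraicGeometry

theorem isReduced_toScheme_of_forall_exists {X : Scheme.{u}} (U : X.Opens)
    (h : ∀ x ∈ U, ∃ (Y : Scheme.{u}) (p : Y ⟶ X), IsOpenImmersion p ∧ IsReduced Y ∧
      x ∈ Set.range p) : IsReduced U.toScheme := by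
  have : ∀ x : U.toScheme, _root_.IsReduced (U.toScheme.presheaf.stalk x) := by
    intro x
    obtain ⟨Y, p, _, _, y, hy⟩ := h x.1 x.2
    have h1 : _root_.IsReduced (X.presheaf.stalk (p y)) :=
      isReduced_of_injective (p.stalkMap y).hom
        (asIso (p.stalkMap y)).commRingCatIsoToRingEquiv.injective
    rw [hy] at h1
    exact isReduced_of_injective (U.stalkIso x).hom.hom
      (U.stalkIso x).commRingCatIsoToRingEquiv.injective
  exact isReduced_of_isReduced_stalk _

end AlgebraicGeometry

/-! ### Irreducible components and generic reducedness -/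

namespace ZRep

open ProjSp LinkedChain

variable {k : Type u} [Field k] {v : ZRep.{u, w} k} {r : ℕ} {m n : ℤ} (C : v.Coords r m n)
  {d : ℤ → Bool}

/-- A point without proper generizations is a minimal prime of any chart containing it. One of the
two maps across each edge is nonzero there, and the directions are chosen edge by edge. -/
theorem Coords.exists_mem_flow (x : v.LPScheme (Finset.Icc m n)) (hx : ∀ x', x' ⤳ x → x' = x) :
    ∃ d, x ∈ C.flow d := by
  obtain ⟨c, hc⟩ := exists_mem_chartOpen x
  obtain ⟨y, rfl⟩ : x ∈ Set.range (chartMap c) := by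
    rw [← opensRange_chartMap] at hc
    exact hc
  have hmin : (y : PrimeSpectrum (ChartRing c)).asIdeal ∈ minimalPrimes (ChartRing c) := by
    refine ⟨⟨y.2, bot_le⟩, fun q hq hqy => ?_⟩
    let y' : PrimeSpectrum (ChartRing c) := ⟨q, hq.1⟩
    have h1 : y' ⤳ y := (PrimeSpectrum.le_iff_specializes _ _).1 hqy
    have h2 := hx _ (h1.map (chartMap c).continuous)
    have h3 : y' = y := (chartMap c).isOpenEmbedding.injective h2
    rw [← h3]
  have key : ∀ e : ℤ, ∃ δ : Bool, ∀ (he : e ∈ Finset.Ico m n),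
      ∃ b, C.Survives (fun _ => δ) e b ∧
        chartMap c y ∈ C.nz ⟨src (fun _ => δ) e, src_mem he⟩ b := by
    intro e
    by_cases he : e ∈ Finset.Ico m n
    · have he' := Finset.mem_Ico.1 he
      rcases C.exists_notMem_of_minimalPrimes _ hmin he'.1 he'.2 with ⟨b, hb, hb'⟩ | ⟨b, hb, hb'⟩
      · exact ⟨true, fun _ => ⟨b, by simpa [Survives] using hb,
          (C.mem_nz_chartMap _ _ _).2 (by simpa [src] using hb')⟩⟩
      · exact ⟨false, fun _ => ⟨b, by simpa [Survives] using hb,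
          (C.mem_nz_chartMap _ _ _).2 (by simpa [src] using hb')⟩⟩
    · exact ⟨true, fun h => absurd h he⟩
  choose d hd using key
  exact ⟨d, fun e he => hd e he⟩

theorem Coords.irreducibleComponents_eq (hmn : m ≤ n) :
    irreducibleComponents (v.LPScheme (Finset.Icc m n)) =
      {Z | ∃ d, (C.flow d).Nonempty ∧ Z = closure (C.flow d)} :=
  irreducibleComponents_eq_of_genericPoint C.flow C.isOpen_flow (fun _ h => by
    obtain ⟨ξ, h1, h2, -⟩ := C.exists_genericPoint_flow hmn h
    exact ⟨ξ, h1, h2⟩) C.exists_mem_flow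

/-- The union of the flow sets contains all generic points, hence is dense, and it is covered by the
cells, which are spectra of domains. -/
theorem Coords.isGenericallyReduced (C : v.Coords r m n) (hmn : m ≤ n) :
    (v.LPScheme (Finset.Icc m n)).IsGenericallyReduced := by
  refine ⟨⟨⋃ d, C.flow d, isOpen_iUnion C.isOpen_flow⟩, fun x => ?_, ?_⟩
  · obtain ⟨ξ, hξ, -, hmax⟩ := exists_specializes_forall_eq x
    obtain ⟨d, hd⟩ := C.exists_mem_flow ξ hmax
    exact closure_mono (Set.singleton_subset_iff.2 (Set.mem_iUnion.2 ⟨d, hd⟩)) hξ.mem_closure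
  · refine isReduced_toScheme_of_forall_exists _ fun x hx => ?_
    obtain ⟨d, hd⟩ := Set.mem_iUnion.1 hx
    obtain ⟨c, hc⟩ := exists_mem_chartOpen x
    obtain ⟨s, q, hq, hxc⟩ := C.exists_mem_cell hmn hd hc
    obtain ⟨p, hp, -, -, hr, -⟩ := C.exists_param (c := c) (s := s) hq
    have : IsDomain (Localization.Away (C.affFun c d s q)) :=
      isDomain_of_isLocalization_away (C.affFun_ne_zero hq ⟨x, hxc⟩) _
    refine ⟨_, p, hp, inferInstance, ?_⟩
    rw [hr]
    exact hxc

end ZRep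

/-! ### One-dimensional subrepresentations over a field -/

namespace ZRep

open LinkedChain

section Lines

variable {k : Type u} [Field k] {v : ZRep.{u, w} k} {r : ℕ} {m n : ℤ} (C : v.Coords r m n)

theorem Coords.coord_equivFun_symm (i : ℤ) (y : Fin r → k) (b : Fin r) :
    (C.basis i).coord b ((C.basis i).equivFun.symm y) = y b := by
  rw [Module.Basis.coord_apply, Module.Basis.equivFun_symm_apply, Module.Basis.repr_sum_self]

theorem Coords.ext_coord {i : ℤ} {x y : v.V i}
    (h : ∀ b, (C.basis i).coord b x = (C.basis i).coord b y) : x = y :=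
  (C.basis i).ext_elem h

theorem Coords.up_equivFun_symm (i : ℤ) (y : Fin r → k) :
    v.up i ((C.basis i).equivFun.symm y) =
      (C.basis (i + 1)).equivFun.symm fun b => if i < C.t b then y b else 0 := by
  refine C.ext_coord fun b => ?_
  rw [C.up, C.coord_equivFun_symm, C.coord_equivFun_symm]

theorem Coords.down_equivFun_symm (i : ℤ) (y : Fin r → k) :
    v.down i ((C.basis (i + 1)).equivFun.symm y) =
      (C.basis i).equivFun.symm fun b => if C.t b ≤ i then y b else 0 := by
  refine C.ext_coord fun b => ?_
  rw [C.down, C.coord_equivFun_symm, C.coord_equivFun_symm]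

theorem Coords.up_injective (C : v.Coords r m n) {i : ℤ} (hi : i < m) :
    Function.Injective (v.up i) := by
  intro x y hxy
  refine C.ext_coord fun b => ?_
  have := congrArg ((C.basis (i + 1)).coord b) hxy
  rwa [C.up, C.up, if_pos (hi.trans_le (C.le_t b).1), if_pos (hi.trans_le (C.le_t b).1)] at this

theorem Coords.down_injective (C : v.Coords r m n) {i : ℤ} (hi : n ≤ i) :
    Function.Injective (v.down i) := by
  intro x y hxy
  refine C.ext_coord fun b => ?_
  have := congrArg ((C.basis i).coord b) hxy
  rwa [C.down, C.down, if_pos ((C.le_t b).2.trans hi), if_pos ((C.le_t b).2.trans hi)] at this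

theorem Coords.up_eq_zero (C : v.Coords r m n) {i : ℤ} (hi : n ≤ i) : v.up i = 0 := by
  ext x
  refine C.ext_coord fun b => ?_
  rw [C.up, if_neg (by have := (C.le_t b).2; omega)]
  simp

theorem Coords.down_eq_zero (C : v.Coords r m n) {i : ℤ} (hi : i < m) : v.down i = 0 := by
  ext x
  refine C.ext_coord fun b => ?_
  rw [C.down, if_neg (by have := (C.le_t b).1; omega)]
  simp

theorem equivFun_symm_eq_zero_iff {V : Type*} [AddCommGroup V] [Module k V]
    (β : Module.Basis (Fin r) k V) (y : Fin r → k) : β.equivFun.symm y = 0 ↔ y = 0 :=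
  map_eq_zero_iff _ β.equivFun.symm.injective

/-- The set of arrows with nonzero maps, for the lines spanned by the vectors with given
coordinates. -/
structure Coords.IsArrowFun (y : ℤ → Fin r → k) (a : ZArrow → Fin 2) : Prop where
  up e : a (.up e) = 1 ↔ e < m ∨ ((m ≤ e ∧ e < n) ∧ ∃ b, e < C.t b ∧ y e b ≠ 0)
  down e : a (.down e) = 1 ↔ n ≤ e ∨ ((m ≤ e ∧ e < n) ∧ ∃ b, C.t b ≤ e ∧ y (e + 1) b ≠ 0)

/-- Outside the interval nothing depends on the lines: maps towards the interval are injective and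
maps away from it are zero. -/
theorem Coords.isArrowFun_arrowFun {W : ∀ i, Submodule k (v.V i)} (hW : W ∈ v.LP)
    {y : ℤ → Fin r → k}
    (h : ∀ i, m ≤ i → i ≤ n → W i = Submodule.span k {(C.basis i).equivFun.symm (y i)}) :
    C.IsArrowFun y (v.arrowFun W) := by
  have hne : ∀ i, W i ≠ ⊥ := fun i h0 => by
    have := hW.2 i
    rw [h0, finrank_bot] at this
    exact zero_ne_one this
  constructor
  · intro e
    have h1 : v.arrowFun W (.up e) = 1 ↔ (W e).map (v.up e) ≠ ⊥ := by
      simp only [arrowFun]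
      split_ifs with h0 <;> simp [h0]
    rw [h1]
    rcases lt_or_ge e m with he | he
    · simp only [he, true_or, iff_true]
      exact ((Submodule.map_injective_of_injective (C.up_injective he)).ne_iff'
        (Submodule.map_bot _)).2 (hne e)
    rcases lt_or_ge e n with he' | he'
    · rw [h e he he'.le, Submodule.map_span, Set.image_singleton, C.up_equivFun_symm, Ne,
        Submodule.span_singleton_eq_bot, equivFun_symm_eq_zero_iff, funext_iff]
      simp [he, he', he.not_gt]
    · rw [C.up_eq_zero he']
      simp [he.not_gt, he'.not_gt]
  · intro e
    have h1 : v.arrowFun W (.down e) = 1 ↔ (W (e + 1)).map (v.down e) ≠ ⊥ := by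
      simp only [arrowFun]
      split_ifs with h0 <;> simp [h0]
    rw [h1]
    rcases le_or_gt n e with he | he
    · simp only [he, true_or, iff_true]
      exact ((Submodule.map_injective_of_injective (C.down_injective he)).ne_iff'
        (Submodule.map_bot _)).2 (hne (e + 1))
    rcases le_or_gt m e with he' | he'
    · rw [h (e + 1) (by omega) he, Submodule.map_span, Set.image_singleton, C.down_equivFun_symm,
        Ne,
        Submodule.span_singleton_eq_bot, equivFun_symm_eq_zero_iff, funext_iff]
      simp [he, he', he.not_ge]
    · rw [C.down_eq_zero he']
      simp [he.not_ge, he'.not_ge]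

/-- Outside the interval the line is given by the coordinate vector of the nearest end, through the
clamped index `cl`. There, in adapted coordinates, maps towards the interval are identities and maps
away from it are zero. -/
theorem Coords.exists_mem_LP (hmn : m ≤ n) {y : ℤ → Fin r → k} {l μ : ℤ → k}
    (hy : ∀ i, m ≤ i → i ≤ n → y i ≠ 0) (h : ChainRel C.t m n y l μ) :
    ∃ W ∈ v.LP, ∀ i, m ≤ i → i ≤ n → W i = Submodule.span k {(C.basis i).equivFun.symm (y i)} := by
  let cl : ℤ → ℤ := fun i => max m (min i n)
  have hcl : ∀ i, m ≤ i → i ≤ n → cl i = i := fun i hi hi' => by simp only [cl]; omega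
  refine ⟨fun i => Submodule.span k {(C.basis i).equivFun.symm (y (cl i))}, ⟨fun i => ?_,
      fun i => ?_⟩,
    fun i hi hi' => by simp only [hcl i hi hi']⟩
  · simp only [Submodule.map_span, Set.image_singleton, C.up_equivFun_symm, C.down_equivFun_symm]
    rw [Submodule.span_singleton_le_iff_mem, Submodule.span_singleton_le_iff_mem,
      Submodule.mem_span_singleton, Submodule.mem_span_singleton]
    have ht := C.le_t
    rcases lt_or_ge i m with hi | hi
    · have e : cl (i + 1) = cl i := by simp only [cl]; omega
      refine ⟨⟨1, ?_⟩, ⟨0, ?_⟩⟩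
      · rw [one_smul, e]
        congr 1
        ext b
        rw [if_pos (hi.trans_le (ht b).1)]
      · rw [zero_smul, eq_comm, equivFun_symm_eq_zero_iff]
        ext b
        rw [if_neg (by have := (ht b).1; omega)]
        rfl
    rcases lt_or_ge i n with hi' | hi'
    · rw [hcl i hi hi'.le, hcl (i + 1) (by omega) hi']
      refine ⟨⟨l i, ?_⟩, ⟨μ i, ?_⟩⟩
      · rw [← map_smul]
        congr 1
        ext b
        rw [h.up i hi hi']
        rfl
      · rw [← map_smul]
        congr 1
        ext b
        rw [h.down i hi hi']
        rfl
    · have e : cl (i + 1) = cl i := by simp only [cl]; omega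
      refine ⟨⟨0, ?_⟩, ⟨1, ?_⟩⟩
      · rw [zero_smul, eq_comm, equivFun_symm_eq_zero_iff]
        ext b
        rw [if_neg (by have := (ht b).2; omega)]
        rfl
      · rw [one_smul, e]
        congr 1
        ext b
        rw [if_pos ((ht b).2.trans hi')]
  · refine finrank_span_singleton fun h0 => ?_
    rw [equivFun_symm_eq_zero_iff] at h0
    exact hy (cl i) (by simp only [cl]; omega) (by simp only [cl]; omega) h0

theorem Coords.exists_mem_LP_iff (hmn : m ≤ n) {y : ℤ → Fin r → k} {l μ : ℤ → k}
    (hy : ∀ i, m ≤ i → i ≤ n → y i ≠ 0) (h : ChainRel C.t m n y l μ) (a : ZArrow → Fin 2) :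
    (∃ W ∈ v.LP, (∀ i : Finset.Icc m n,
      W i = Submodule.span k {(C.basis i).equivFun.symm (y i)}) ∧ v.arrowFun W = a) ↔
      C.IsArrowFun y a := by
  constructor
  · rintro ⟨W, hW, hWy, rfl⟩
    exact C.isArrowFun_arrowFun hW fun i hi hi' => hWy ⟨i, Finset.mem_Icc.2 ⟨hi, hi'⟩⟩
  · intro ha
    obtain ⟨W, hW, hWy⟩ := C.exists_mem_LP hmn hy h
    refine ⟨W, hW, fun i => hWy i (Finset.mem_Icc.1 i.2).1 (Finset.mem_Icc.1 i.2).2, ?_⟩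
    have hW' := C.isArrowFun_arrowFun hW hWy
    have h2 : ∀ x y : Fin 2, (x = 1 ↔ y = 1) → x = y := by decide
    ext1 (e | e)
    · exact h2 _ _ ((hW'.up e).trans (ha.up e).symm)
    · exact h2 _ _ ((hW'.down e).trans (ha.down e).symm)

theorem coord_baseChange {K : Type*} [Field K] [Algebra k K] {V V' : Type*} [AddCommGroup V]
    [Module k V] [AddCommGroup V'] [Module k V'] (β : Module.Basis (Fin r) k V)
    (β' : Module.Basis (Fin r) k V') (f : V →ₗ[k] V') (p : Prop) [Decidable p] (b : Fin r)
    (h : ∀ x, β'.coord b (f x) = if p then β.coord b x else 0) (x : K ⊗[k] V) :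
    (β'.baseChange K).coord b (f.baseChange K x) = if p then (β.baseChange K).coord b x else 0 := by
  induction x with
  | zero => simp
  | add x y hx hy =>
    rw [map_add, map_add, map_add, hx, hy]
    split_ifs <;> simp
  | tmul a x =>
    rw [LinearMap.baseChange_tmul, Module.Basis.coord_apply, Module.Basis.coord_apply,
      Module.Basis.baseChange_repr_tmul, Module.Basis.baseChange_repr_tmul,
      ← Module.Basis.coord_apply, h]
    split_ifs <;> simp

/-- The coordinates after an extension of scalars. -/
noncomputable def Coords.baseChange (K : Type u) [Field K] [Algebra k K] :
    (v.baseChange K).Coords r m n :=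
  have hup : ∀ i (x : (v.baseChange K).V i) b, ((C.basis (i + 1)).baseChange K).coord b
      ((v.baseChange K).up i x) = if i < C.t b then ((C.basis i).baseChange K).coord b x else 0 :=
    fun i x b => coord_baseChange (C.basis i) (C.basis (i + 1)) (v.up i) (i < C.t b) b
      (fun x => C.up i x b) x
  have hdown : ∀ i (x : (v.baseChange K).V (i + 1)) b, ((C.basis i).baseChange K).coord b
      ((v.baseChange K).down i x) =
        if C.t b ≤ i then ((C.basis (i + 1)).baseChange K).coord b x else 0 :=
    fun i x b => coord_baseChange (C.basis (i + 1)) (C.basis i) (v.down i) (C.t b ≤ i) b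
      (fun x => C.down i x b) x
  { t := C.t
    basis := fun i => (C.basis i).baseChange K
    le_t := C.le_t
    up := hup
    down := hdown
    path := coordinates_pathMap (v := v.baseChange K)
      (ξ := fun i => ((C.basis i).baseChange K).equivFun) hup hdown }

end Lines

end ZRep

/-! ### The line parametrized by a point, in coordinates -/

namespace AlgebraicGeometry

theorem Scheme.evaluation_res {X : Scheme.{u}} {U W : X.Opens} (h : W ≤ U) (x : X) (hx : x ∈ W)
    (f : Γ(X, U)) : (X.evaluation W x hx).hom ((X.presheaf.map (homOfLE h).op).hom f) =
      (X.evaluation U x (h hx)).hom f := by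
  have h1 : X.presheaf.map (homOfLE h).op ≫ X.evaluation W x hx = X.evaluation U x (h hx) := by
    rw [← Scheme.germ_residue, ← Scheme.germ_residue, TopCat.Presheaf.germ_res_assoc]
  exact congrArg (fun g => g.hom f) h1

end AlgebraicGeometry

namespace ProjSp

open LinkedChain

variable {k : Type u} [Field k] {X : Scheme.{u}} (s : X ⟶ Spec (.of k))

theorem evaluation_scalar (U : X.Opens) (x : X) (hx : x ∈ U) :
    letI := residueAlgebra s x
    (X.evaluation U x hx).hom.comp (scalar s U) = algebraMap k (X.residueField x) := by
  refine RingHom.ext fun a => ?_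
  have h1 : (X.presheaf.map (homOfLE (le_top : U ≤ ⊤)).op).hom (scalar s ⊤ a) = scalar s U a :=
    map_scalar _ _ _
  change (X.evaluation U x hx).hom (scalar s U a) = (X.evaluation ⊤ x trivial).hom (scalar s ⊤ a)
  rw [← h1, Scheme.evaluation_res]

variable {V : Type w} [AddCommGroup V] [Module k V] [FiniteDimensional k V]
  (g : X ⟶ ProjSp k (Module.finrank k V))

omit [FiniteDimensional k V] in
theorem evaluation_coord (c : Fin (Module.finrank k V)) (U : X.Opens) (h : U ≤ g ⁻¹ᵁ chart c)
    (x : X) (hx : x ∈ U) (b) : (X.evaluation (g ⁻¹ᵁ chart c) x (h hx)).hom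
      (coord g c _ le_rfl b) = (X.evaluation U x hx).hom (coord g c U h b) := by
  rw [← map_coord g c le_rfl h, Scheme.evaluation_res]

omit [FiniteDimensional k V] in
theorem evaluation_coord_change (c c' : Fin (Module.finrank k V)) (x : X)
    (hx : x ∈ g ⁻¹ᵁ chart c) (hx' : x ∈ g ⁻¹ᵁ chart c') (b) :
    (X.evaluation (g ⁻¹ᵁ chart c) x hx).hom (coord g c _ le_rfl b) =
      (X.evaluation (g ⁻¹ᵁ chart c) x hx).hom (coord g c _ le_rfl c') *
      (X.evaluation (g ⁻¹ᵁ chart c') x hx').hom (coord g c' _ le_rfl b) := by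
  have hU : x ∈ g ⁻¹ᵁ chart c ⊓ g ⁻¹ᵁ chart c' := ⟨hx, hx'⟩
  rw [evaluation_coord g c (g ⁻¹ᵁ chart c ⊓ g ⁻¹ᵁ chart c') inf_le_left x hU,
    evaluation_coord g c (g ⁻¹ᵁ chart c ⊓ g ⁻¹ᵁ chart c') inf_le_left x hU,
    evaluation_coord g c' (g ⁻¹ᵁ chart c ⊓ g ⁻¹ᵁ chart c') inf_le_right x hU,
    ← map_mul, coord_mul_coord]

/-- The line given by a point is spanned by its coordinate vector in any chart. -/
theorem span_coord_eq (x : X) (c : Fin (Module.finrank k V)) (hx : x ∈ g ⁻¹ᵁ chart c) :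
    letI := residueAlgebra s x
    Submodule.span (X.residueField x)
      {z : X.residueField x ⊗[k] V | ∃ (c : Fin (Module.finrank k V)) (hc : x ∈ g ⁻¹ᵁ chart c),
        z = ∑ b, (X.evaluation (g ⁻¹ᵁ chart c) x hc).hom
            (coord g c _ le_rfl b) ⊗ₜ[k] Module.finBasis k V b} =
    Submodule.span (X.residueField x) {∑ b, (X.evaluation (g ⁻¹ᵁ chart c) x hx).hom
            (coord g c _ le_rfl b) ⊗ₜ[k] Module.finBasis k V b} := by
  let := residueAlgebra s x
  apply le_antisymm
  · rw [Submodule.span_le]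
    rintro _ ⟨c', hc', rfl⟩
    refine Submodule.mem_span_singleton.2
      ⟨(X.evaluation (g ⁻¹ᵁ chart c') x hc').hom (coord g c' _ le_rfl c), ?_⟩
    rw [Finset.smul_sum]
    refine Finset.sum_congr rfl fun b _ => ?_
    rw [TensorProduct.smul_tmul', smul_eq_mul, ← evaluation_coord_change]
  · exact Submodule.span_mono (Set.singleton_subset_iff.2 ⟨c, hx, rfl⟩)

theorem sum_tmul_eq {K : Type*} [Field K] [Algebra k K] {r : ℕ} (β : Module.Basis (Fin r) k V)
    (z : Fin (Module.finrank k V) → K) : ∑ b, z b ⊗ₜ[k] Module.finBasis k V b =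
      (β.baseChange K).equivFun.symm
        fun b => ev (algebraMap k K) (Module.finBasis k V) (β.coord b) z := by
  refine (β.baseChange K).ext_elem fun b => ?_
  rw [Module.Basis.equivFun_symm_apply, Module.Basis.repr_sum_self, map_sum,
      Finsupp.finsetSum_apply,
    ev]
  refine Finset.sum_congr rfl fun e _ => ?_
  rw [Module.Basis.baseChange_repr_tmul, Algebra.smul_def]
  rfl

end ProjSp

/-! ### Exact strata and flow sets -/

namespace ZRep

open ProjSp LinkedChain

variable {k : Type u} [Field k] {v : ZRep.{u, w} k} {r : ℕ} {m n : ℤ} (C : v.Coords r m n)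
  {c : Chart v (Finset.Icc m n)}

/-- The coordinates of the vectors at a point of a chart. -/
noncomputable def evalPt (x : v.LPScheme (Finset.Icc m n)) (hx : x ∈ chartOpen c)
    (i : Finset.Icc m n) (b : Fin (Module.finrank k (v.V i))) :
    (v.LPScheme (Finset.Icc m n)).residueField x :=
  ((v.LPScheme (Finset.Icc m n)).evaluation (chartOpen c) x hx).hom
    (coord (v.LPπ _ i) (c i) (chartOpen c) (chartOpen_le c i) b)

theorem isPoint_evalPt (x : v.LPScheme (Finset.Icc m n)) (hx : x ∈ chartOpen c) :
    letI := residueAlgebra (v.LPToSpec (Finset.Icc m n)) x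
    IsPoint (algebraMap k _) c (evalPt x hx) := by
  let := residueAlgebra (v.LPToSpec (Finset.Icc m n)) x
  have h1 := (isPoint_coord c (chartOpen c) (chartOpen_le c)).map
    ((v.LPScheme (Finset.Icc m n)).evaluation (chartOpen c) x hx).hom
  have h2 := evaluation_scalar (v.LPToSpec (Finset.Icc m n)) (chartOpen c) x hx
  rw [h2] at h1
  exact h1

theorem Coords.mem_nz_iff (x : v.LPScheme (Finset.Icc m n)) (hx : x ∈ chartOpen c)
    (i : Finset.Icc m n) (b : Fin r) :
    letI := residueAlgebra (v.LPToSpec (Finset.Icc m n)) x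
    x ∈ C.nz i b ↔ C.vec (algebraMap k _) (evalPt x hx) i b ≠ 0 := by
  let := residueAlgebra (v.LPToSpec (Finset.Icc m n)) x
  have h1 := inf_nonvanishing (v.LPToSpec _) (v.LPπ (Finset.Icc m n) i) (c i) (chartOpen c)
    (chartOpen_le c i) ((C.basis i).coord b)
  have h2 : x ∈ C.nz i b ↔ x ∈ (v.LPScheme (Finset.Icc m n)).basicOpen (coordEv (v.LPToSpec _)
      (v.LPπ _ i) (c i) (chartOpen c) (chartOpen_le c i) ((C.basis i).coord b)) := by
    rw [← h1]
    exact ⟨fun h => ⟨hx, h⟩, fun h => h.2⟩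
  have h3 := evaluation_scalar (v.LPToSpec (Finset.Icc m n)) (chartOpen c) x hx
  have h4 : ((v.LPScheme (Finset.Icc m n)).evaluation (chartOpen c) x hx).hom
      (coordEv (v.LPToSpec _) (v.LPπ _ i) (c i) (chartOpen c) (chartOpen_le c i)
        ((C.basis i).coord b)) = C.vec (algebraMap k _) (evalPt x hx) i b := by
    rw [C.vec_coe, coordEv, map_ev, h3]
    rfl
  rw [h2, ← h4]
  exact (Scheme.evaluation_ne_zero_iff_mem_basicOpen _ x hx _).symm

theorem Coords.tautLine_eq (x : v.LPScheme (Finset.Icc m n)) (hx : x ∈ chartOpen c)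
    (i : Finset.Icc m n) :
    letI := residueAlgebra (v.LPToSpec (Finset.Icc m n)) x
    v.tautLine _ x i = Submodule.span ((v.LPScheme (Finset.Icc m n)).residueField x)
      {((C.baseChange _).basis i).equivFun.symm (C.vec (algebraMap k _) (evalPt x hx) i)} := by
  let := residueAlgebra (v.LPToSpec (Finset.Icc m n)) x
  have hc := chartOpen_le c i hx
  have h1 := span_coord_eq (V := v.V i) (v.LPToSpec (Finset.Icc m n)) (v.LPπ _ i) x (c i) hc
  have h2 := sum_tmul_eq (C.basis i) fun b =>
    ((v.LPScheme (Finset.Icc m n)).evaluation (v.LPπ (Finset.Icc m n) i ⁻¹ᵁ chart (c i)) x hc).hom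
      (coord (v.LPπ _ i) (c i) _ le_rfl b)
  have h3 : (fun b => ((v.LPScheme (Finset.Icc m n)).evaluation
      (v.LPπ (Finset.Icc m n) i ⁻¹ᵁ chart (c i)) x hc).hom
      (coord (v.LPπ _ i) (c i) _ le_rfl b)) = evalPt x hx i :=
    funext fun b => evaluation_coord (V := v.V i) _ _ _ (chartOpen_le c i) x hx b
  have h4 : C.vec (algebraMap k _) (evalPt x hx) i = fun b =>
      ev (algebraMap k _) (Module.finBasis k (v.V i)) ((C.basis i).coord b) (evalPt x hx i) :=
    funext fun b => C.vec_coe _ _ _ _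
  rw [h4]
  rw [h3] at h2
  refine h1.trans ?_
  refine congrArg (fun z => Submodule.span _ {z}) (h2 : _)

/-- Membership in a stratum in terms of the coordinates in the basis of `C`. -/
theorem Coords.mem_stratum_iff (hmn : m ≤ n) (x : v.LPScheme (Finset.Icc m n))
    (hx : x ∈ chartOpen c) (a : ZArrow → Fin 2) :
    letI := residueAlgebra (v.LPToSpec (Finset.Icc m n)) x
    x ∈ v.stratum (Finset.Icc m n) a ↔
      (C.baseChange _).IsArrowFun (C.vec (algebraMap k _) (evalPt x hx)) a := by
  let := residueAlgebra (v.LPToSpec (Finset.Icc m n)) x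
  have hpt := isPoint_evalPt x hx
  have hu := hpt.unimodular_vec C
  obtain ⟨l, μ, hch⟩ := (hpt.minors_vec C).exists_chainRel hu
  have hy : ∀ i, m ≤ i → i ≤ n → C.vec (algebraMap k _) (evalPt x hx) i ≠ 0 := by
    intro i hi hi' h0
    obtain ⟨w, hw⟩ := hu i hi hi'
    simp [h0] at hw
  refine Iff.trans ?_ ((C.baseChange _).exists_mem_LP_iff hmn hy hch a)
  have ht := C.tautLine_eq x hx
  constructor
  · rintro ⟨W, hW, hWt, hWa⟩
    exact ⟨W, hW, fun i => (hWt i).trans (ht i), hWa⟩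
  · rintro ⟨W, hW, hWt, hWa⟩
    exact ⟨W, hW, fun i => (hWt i).trans (ht i).symm, hWa⟩

theorem Coords.not_both_arrows (x : v.LPScheme (Finset.Icc m n)) {e : ℤ}
    (he : e ∈ Finset.Ico m n) (he₀ : e ∈ Finset.Icc m n) (he₁ : e + 1 ∈ Finset.Icc m n)
    (h : ∃ b, e < C.t b ∧ x ∈ C.nz ⟨e, he₀⟩ b) : ¬ ∃ b, C.t b ≤ e ∧ x ∈ C.nz ⟨e + 1, he₁⟩ b := by
  rintro ⟨b', hb', hxb'⟩
  obtain ⟨b, hb, hxb⟩ := h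
  obtain ⟨c, hx⟩ := exists_mem_chartOpen x
  let := residueAlgebra (v.LPToSpec (Finset.Icc m n)) x
  have hpt := isPoint_evalPt x hx
  have hu := hpt.unimodular_vec C
  obtain ⟨l, μ, hch⟩ := (hpt.minors_vec C).exists_chainRel hu
  have he' := Finset.mem_Ico.1 he
  have h1 := hch.up e he'.1 he'.2 b
  have h2 := hch.down e he'.1 he'.2 b'
  rw [C.mem_nz_iff x hx] at hxb hxb'
  rw [if_pos hb] at h1
  rw [if_pos hb'] at h2
  rcases mul_eq_zero.1 (hch.mul_eq_zero hu he'.1 he'.2) with h0 | h0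
  · rw [h0, zero_mul] at h1
    exact hxb h1
  · rw [h0, zero_mul] at h2
    exact hxb' h2

/-- A flow set only asks that the chosen maps be nonzero; the opposite ones then vanish by
`Coords.not_both_arrows`. This is why an exact stratum is open. Without the conditions on the two
tails the stratum is empty, by `Coords.tails_of_mem_stratum`. -/
theorem Coords.stratum_eq_flow (hmn : m ≤ n) {a : ZArrow → Fin 2} (ha : ZArrow.IsExact a)
    (ham : ∀ e < m, a (.up e) = 1) (han : ∀ e, n ≤ e → a (.down e) = 1) {d : ℤ → Bool}
    (hd : ∀ e ∈ Finset.Ico m n, d e = true ↔ a (.up e) = 1) :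
    v.stratum (Finset.Icc m n) a = C.flow d := by
  have hex : ∀ e, a (.down e) = 1 ↔ ¬ a (.up e) = 1 := by
    intro e
    rcases ha e with h | h <;> simp [h]
  ext x
  obtain ⟨c, hx⟩ := exists_mem_chartOpen x
  rw [C.mem_stratum_iff hmn x hx]
  let := residueAlgebra (v.LPToSpec (Finset.Icc m n)) x
  have hflow : x ∈ C.flow d ↔ ∀ e ∈ Finset.Ico m n, ∃ b, C.Survives d e b ∧
      C.vec (algebraMap k _) (evalPt x hx) (src d e) b ≠ 0 := by
    refine forall₂_congr fun e he => exists_congr fun b => and_congr_right fun _ => ?_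
    exact C.mem_nz_iff x hx ⟨_, src_mem he⟩ b
  have hnot : ∀ e ∈ Finset.Ico m n,
      (∃ b, e < C.t b ∧ C.vec (algebraMap k _) (evalPt x hx) e b ≠ 0) →
      ¬ ∃ b, C.t b ≤ e ∧ C.vec (algebraMap k _) (evalPt x hx) (e + 1) b ≠ 0 := by
    intro e he
    have he' := Finset.mem_Ico.1 he
    have h0 : e ∈ Finset.Icc m n := by simp; omega
    have h1 : e + 1 ∈ Finset.Icc m n := by simp; omega
    have := C.not_both_arrows x he h0 h1
    simp only [C.mem_nz_iff x hx] at this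
    exact this
  rw [hflow]
  constructor
  · intro h e he
    have he' := Finset.mem_Ico.1 he
    by_cases hde : d e = true
    · obtain h1 | ⟨-, b, hb, hb'⟩ := (h.up e).1 ((hd e he).1 hde)
      · omega
      · exact ⟨b, (if_pos hde).mpr hb, by simpa [src, hde] using hb'⟩
    · obtain h1 | ⟨-, b, hb, hb'⟩ := (h.down e).1 ((hex e).2 fun h0 => hde ((hd e he).2 h0))
      · omega
      · exact ⟨b, (if_neg hde).mpr hb, by simpa [src, hde] using hb'⟩
  · intro h
    have hup : ∀ e ∈ Finset.Ico m n, d e = true →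
        ∃ b, e < C.t b ∧ C.vec (algebraMap k _) (evalPt x hx) e b ≠ 0 := by
      intro e he hde
      obtain ⟨b, hb, hb'⟩ := h e he
      exact ⟨b, by simpa [Survives, hde] using hb, by simpa [src, hde] using hb'⟩
    have hdown : ∀ e ∈ Finset.Ico m n, ¬ d e = true →
        ∃ b, C.t b ≤ e ∧ C.vec (algebraMap k _) (evalPt x hx) (e + 1) b ≠ 0 := by
      intro e he hde
      obtain ⟨b, hb, hb'⟩ := h e he
      exact ⟨b, by simpa [Survives, hde] using hb, by simpa [src, hde] using hb'⟩
    constructor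
    · intro e
      rcases lt_or_ge e m with he | he
      · simp [he, ham e he]
      rcases lt_or_ge e n with he' | he'
      · have hI := Finset.mem_Ico.2 ⟨he, he'⟩
        rw [← hd e hI]
        constructor
        · exact fun hde => Or.inr ⟨⟨he, he'⟩, hup e hI hde⟩
        · rintro (h1 | ⟨-, h1⟩)
          · omega
          · by_contra hde
            exact hnot e hI h1 (hdown e hI hde)
      · have := (hex e).1 (han e he')
        simp only [this, false_iff]
        omega
    · intro e
      rcases le_or_gt n e with he | he
      · simp [he, han e he]
      rcases le_or_gt m e with he' | he'
      · have hI := Finset.mem_Ico.2 ⟨he', he⟩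
        rw [hex, ← hd e hI]
        constructor
        · exact fun hde => Or.inr ⟨⟨he', he⟩, hdown e hI hde⟩
        · rintro (h1 | ⟨-, h1⟩)
          · omega
          · exact fun hde => hnot e hI (hup e hI hde) h1
      · have : ¬ a (.down e) = 1 := fun h0 => (hex e).1 h0 (ham e he')
        simp only [this, false_iff]
        omega

theorem Coords.tails_of_mem_stratum (hmn : m ≤ n) {a : ZArrow → Fin 2}
    (h : (v.stratum (Finset.Icc m n) a).Nonempty) (C : v.Coords r m n) :
    (∀ e < m, a (.up e) = 1) ∧ ∀ e, n ≤ e → a (.down e) = 1 := by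
  obtain ⟨x, hxa⟩ := h
  obtain ⟨c, hx⟩ := exists_mem_chartOpen x
  have := (C.mem_stratum_iff hmn x hx a).1 hxa
  exact ⟨fun e he => (this.up e).2 (Or.inl he), fun e he => (this.down e).2 (Or.inl he)⟩

/-- The closures of the nonempty exact strata are those of the nonempty open sets `C.flow d`. -/
theorem Coords.exists_stratum_iff (hmn : m ≤ n) (C : v.Coords r m n)
    (Z : Set (v.LPScheme (Finset.Icc m n))) :
    (∃ d, (C.flow d).Nonempty ∧ Z = closure (C.flow d)) ↔
      ∃ a : ZArrow → Fin 2, ZArrow.IsExact a ∧ (v.stratum (Finset.Icc m n) a).Nonempty ∧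
        Z = closure (v.stratum (Finset.Icc m n) a) := by
  classical
  constructor
  · rintro ⟨d, hd⟩
    -- `p e` tells whether the nonzero arrow at the edge goes up: outside the interval it points
    -- towards the interval, inside it follows `d`.
    let p : ℤ → Prop := fun e => e < m ∨ (e < n ∧ d e = true)
    let a : ZArrow → Fin 2
      | .up e => if p e then 1 else 0
      | .down e => if p e then 0 else 1
    have h1 : ∀ e, a (.up e) = if p e then 1 else 0 := fun _ => rfl
    have h2 : ∀ e, a (.down e) = if p e then 0 else 1 := fun _ => rfl
    have hex : ZArrow.IsExact a := by
      intro e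
      rw [h1, h2]
      by_cases hp : p e <;> simp [hp]
    have := C.stratum_eq_flow hmn hex (fun e he => by rw [h1, if_pos (Or.inl he)])
      (fun e he => by rw [h2, if_neg (by simp only [p]; omega)]) (d := d) (fun e he => by
        have he' := Finset.mem_Ico.1 he
        rw [h1]
        simp [p, he'.2, he'.1.not_gt])
    refine ⟨a, hex, ?_⟩
    rw [this]
    exact hd
  · rintro ⟨a, hex, hne, rfl⟩
    obtain ⟨h1, h2⟩ := Coords.tails_of_mem_stratum hmn hne C
    have := C.stratum_eq_flow hmn hex h1 h2 (d := fun e => decide (a (.up e) = 1)) (by simp)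
    rw [this] at hne ⊢
    exact ⟨_, hne, rfl⟩

end ZRep

/-! ### Dimension bounds through localized polynomial rings -/

section Dimension

open Algebra

/-- Dimension is a supremum of coheights of irreducible closed sets. A chain going up from `T`
consists of sets that all meet any open set meeting `T`, so it can be restricted to that open set.
-/
theorem topologicalKrullDim_le_of_isOpenEmbedding {Y : Type*} [TopologicalSpace Y]
    {N : WithBot ℕ∞} (h : ∀ y : Y, ∃ (W : Type u) (_ : TopologicalSpace W) (f : W → Y),
      Topology.IsOpenEmbedding f ∧ y ∈ Set.range f ∧ topologicalKrullDim W ≤ N) :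
    topologicalKrullDim Y ≤ N := by
  rw [topologicalKrullDim, Order.krullDim_eq_iSup_coheight]
  refine iSup_le fun T => ?_
  obtain ⟨y, hy⟩ := T.2.nonempty
  obtain ⟨W, _, f, hf, ⟨x, rfl⟩, hN⟩ := h y
  let T' := (IrreducibleCloseds.orderIsoOfIsOpenEmbedding f hf).symm ⟨T, ⟨x, hy⟩⟩
  have hT : IrreducibleCloseds.map f hf.continuous T' = T :=
    congrArg Subtype.val ((IrreducibleCloseds.orderIsoOfIsOpenEmbedding f hf).apply_symm_apply
      ⟨T, ⟨x, hy⟩⟩)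
  rw [← hT, hf.coheight_map]
  refine le_trans ?_ hN
  rw [topologicalKrullDim, Order.krullDim_eq_iSup_coheight]
  exact le_iSup (fun a => ((Order.coheight a : ℕ∞) : WithBot ℕ∞)) T'

/-- Induction on the number of variables: a maximal ideal contracts to a maximal ideal, because
polynomial rings over a field are Jacobson, and the extra variable raises the height by one. -/
theorem MvPolynomial.height_of_isMaximal_fin {k : Type*} [Field k] {N : ℕ}
    (P : Ideal (MvPolynomial (Fin N) k)) [hP : P.IsMaximal] : P.height = N := by
  induction N with
  | zero =>
    have h1 := Ideal.height_le_ringKrullDim_of_isPrime (I := P)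
    rw [MvPolynomial.ringKrullDim_of_isNoetherianRing, ringKrullDim_eq_zero_of_field] at h1
    simpa using h1
  | succ N ih =>
    let e := (finSuccEquiv k N).toRingEquiv
    let P' := P.comap e.symm
    have hP' : P'.IsMaximal := Ideal.comap_isMaximal_of_surjective _ e.symm.surjective
    have h1 : P'.height = P.height := RingEquiv.height_comap _ _
    have : P'.LiesOver (P'.under (MvPolynomial (Fin N) k)) := ⟨rfl⟩
    have h2 := Polynomial.height_eq_height_add_one (P'.under (MvPolynomial (Fin N) k)) P'
    have : (P'.under (MvPolynomial (Fin N) k)).IsMaximal :=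
      Polynomial.isMaximal_comap_C_of_isJacobsonRing P'
    rw [← h1, h2, ih]
    simp

theorem MvPolynomial.height_of_isMaximal {k : Type*} [Field k] {ι : Type*} [Finite ι]
    (P : Ideal (MvPolynomial ι k)) [hP : P.IsMaximal] : P.height = Nat.card ι := by
  let e := (renameEquiv k (Finite.equivFin ι)).toRingEquiv
  have hP' : (P.comap e.symm).IsMaximal :=
    Ideal.comap_isMaximal_of_surjective _ e.symm.surjective
  have h1 : (P.comap e.symm).height = P.height := RingEquiv.height_comap _ _
  rw [← h1, height_of_isMaximal_fin]

/-- By the Jacobson property some maximal ideal avoids `f`; its height is the number of variables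
and is unchanged by the localization. -/
theorem MvPolynomial.card_le_ringKrullDim_away {k : Type*} [Field k] {ι : Type*} [Finite ι]
    {f : MvPolynomial ι k} (hf : f ≠ 0) (B : Type*) [CommRing B] [Algebra (MvPolynomial ι k) B]
    [IsLocalization.Away f B] : (Nat.card ι : WithBot ℕ∞) ≤ ringKrullDim B := by
  have hj : f ∉ (⊥ : Ideal (MvPolynomial ι k)).jacobson := by
    rwa [IsJacobsonRing.out inferInstance (Ideal.isRadical_bot), Ideal.mem_bot]
  obtain ⟨P, hP, hfP⟩ : ∃ P : Ideal (MvPolynomial ι k), P.IsMaximal ∧ f ∉ P := by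
    by_contra! hcon
    exact hj ((Ideal.mem_sInf).2 fun {P} hP => hcon P hP.2)
  have hdisj : Disjoint (Submonoid.powers f : Set (MvPolynomial ι k)) P := by
    rw [Set.disjoint_left]
    rintro _ ⟨l, rfl⟩ h
    exact hfP (hP.isPrime.mem_of_pow_mem l h)
  have h1 := IsLocalization.height_map_of_disjoint (S := B) (Submonoid.powers f) P hdisj
  have h2 := IsLocalization.isPrime_of_isPrime_disjoint (Submonoid.powers f) B P inferInstance hdisj
  rw [height_of_isMaximal] at h1
  have h3 := Ideal.height_le_ringKrullDim_of_isPrime (I := P.map (algebraMap _ B))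
  rw [h1] at h3
  exact_mod_cast h3

theorem ringKrullDim_le_of_isIntegral {R S : Type*} [CommRing R] [CommRing S] [Algebra R S]
    [Algebra.IsIntegral R S] : ringKrullDim S ≤ ringKrullDim R := by
  refine Order.krullDim_le_of_strictMono (PrimeSpectrum.comap (algebraMap R S)) ?_
  intro p q hpq
  obtain ⟨h, x, hx, hx'⟩ := SetLike.lt_iff_le_and_exists.1 (show p.asIdeal < q.asIdeal from hpq)
  exact Ideal.comap_lt_comap_of_integral_mem_sdiff h ⟨hx, hx'⟩ (Algebra.IsIntegral.isIntegral x)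

/-- By Noether normalization `A` is finite over a polynomial ring whose number of variables bounds
its dimension. That polynomial ring embeds in `B`, so this number is at most the transcendence
degree of `B`. -/
theorem MvPolynomial.ringKrullDim_le_of_injective_away {k : Type u} [Field k] {ι : Type u} [Finite ι]
    {f : MvPolynomial ι k} (hf : f ≠ 0) (B : Type u) [CommRing B] [Algebra (MvPolynomial ι k) B]
    [IsLocalization.Away f B] [Algebra k B] [IsScalarTower k (MvPolynomial ι k) B]
    {A : Type u} [CommRing A] [Algebra k A] [Algebra.FiniteType k A] (g : A →ₐ[k] B)
    (hg : Function.Injective g) : ringKrullDim A ≤ (Nat.card ι : WithBot ℕ∞) := by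
  have hle := powers_le_nonZeroDivisors_of_noZeroDivisors hf
  have : IsDomain B := IsLocalization.isDomain_of_le_nonZeroDivisors B hle
  have : Nontrivial A := g.toRingHom.domain_nontrivial
  have : FaithfulSMul (MvPolynomial ι k) B :=
    (faithfulSMul_iff_algebraMap_injective _ _).2 (IsLocalization.injective B hle)
  have hB : Algebra.trdeg k B = Cardinal.mk ι := by
    have : Algebra.IsAlgebraic (MvPolynomial ι k) B :=
      IsLocalization.isAlgebraic B (Submonoid.powers f)
    rw [← trdeg_add_eq k (MvPolynomial ι k) (A := B), MvPolynomial.trdeg_of_isDomain,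
      trdeg_eq_zero, add_zero, Cardinal.lift_id]
  obtain ⟨l, φ, hφ, hfin⟩ := exists_finite_inj_algHom_of_fg k A
  have h1 := lift_trdeg_le_of_injective (g.comp φ) (hg.comp hφ)
  rw [hB, MvPolynomial.trdeg_of_isDomain] at h1
  have h2 : l ≤ Nat.card ι := by
    have : (l : Cardinal.{u}) ≤ Cardinal.mk ι := by simpa using h1
    rw [← Nat.cast_card (α := ι)] at this
    exact_mod_cast this
  algebraize [φ.toRingHom]
  have : Module.Finite (MvPolynomial (Fin l) k) A := hfin
  refine (ringKrullDim_le_of_isIntegral (R := MvPolynomial (Fin l) k)).trans ?_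
  rw [MvPolynomial.ringKrullDim_of_isNoetherianRing, ringKrullDim_eq_zero_of_field, zero_add,
    Nat.card_fin]
  exact_mod_cast h2

end Dimension

/-! ### Lifting to the reduced structure, and rationality -/

namespace AlgebraicGeometry

/-- An open subscheme which is reduced and dense in a closed set lifts to the reduced structure on
this closed set. -/
theorem Scheme.exists_lift_vanishingIdeal {X Y : Scheme.{u}} (p : Y ⟶ X) [IsOpenImmersion p]
    [IsReduced Y] (Z : Closeds X) (hp : Set.range p ⊆ Z) (hd : (Z : Set X) ⊆ closure (Set.range p)) :
    ∃ f : Y ⟶ (IdealSheafData.vanishingIdeal Z).subscheme,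
      f ≫ (IdealSheafData.vanishingIdeal Z).subschemeι = p ∧ IsOpenImmersion f ∧ IsDominant f := by
  let ι := (IdealSheafData.vanishingIdeal Z).subschemeι
  have hι : Set.range ι = Z := by
    rw [IdealSheafData.range_subschemeι, IdealSheafData.coe_support_vanishingIdeal]
  -- The base change of the closed immersion to the reduced scheme `Y` is a surjective closed
  -- immersion, hence an isomorphism, and its inverse gives the lift.
  have : Surjective (pullback.fst p ι) := by
    refine ⟨Set.range_eq_univ.1 ?_⟩
    rw [Scheme.Pullback.range_fst, hι]
    exact Set.eq_univ_of_forall fun y => hp ⟨y, rfl⟩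
  have : IsIso (pullback.fst p ι) := isIso_of_isClosedImmersion_of_surjective _
  have hf : (inv (pullback.fst p ι) ≫ pullback.snd p ι) ≫ ι = p := by
    rw [Category.assoc, ← pullback.condition, IsIso.inv_hom_id_assoc]
  refine ⟨inv (pullback.fst p ι) ≫ pullback.snd p ι, hf, inferInstance, ⟨fun x => ?_⟩⟩
  rw [ι.isEmbedding.isInducing.closure_eq_preimage_closure_image, ← Set.range_comp]
  have h1 : (ι ∘ (inv (pullback.fst p ι) ≫ pullback.snd p ι)) = p := by
    funext y
    rw [Function.comp_apply, ← Scheme.Hom.comp_apply, hf]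
  rw [h1]
  refine hd ?_
  rw [← hι]
  exact ⟨x, rfl⟩

theorem isRationalOver_away {k : Type u} [Field k] {ι : Type u} {f : MvPolynomial ι k}
    (hf : f ≠ 0) : Scheme.IsRationalOver
      (Spec.map (CommRingCat.ofHom (algebraMap k (Localization.Away f)))) := by
  let j : Spec (.of (Localization.Away f)) ⟶ Spec (.of (MvPolynomial ι k)) :=
    Spec.map (CommRingCat.ofHom (algebraMap _ _))
  have hdom : IsDomain (Localization.Away f) :=
    IsLocalization.isDomain_of_le_nonZeroDivisors _ (powers_le_nonZeroDivisors_of_noZeroDivisors hf)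
  let g := j ≫ (AffineSpace.SpecIso ι (.of k)).inv
  have : IsDominant g := ⟨(g.isOpenEmbedding.isOpen_range).dense (Set.range_nonempty _)⟩
  refine Scheme.BirationalOver.isRationalOver _ (𝔸(ι; Spec (.of k)) ↘ Spec (.of k))
    (g.birationalOver _ _ ?_)
  rw [Category.assoc, AffineSpace.SpecIso_inv_over, ← Spec.map_comp]
  rfl

end AlgebraicGeometry

/-! ### Rationality and dimension of the components -/

namespace ZRep

open ProjSp LinkedChain

variable {k : Type u} [Field k] {v : ZRep.{u, w} k} {r : ℕ} {m n : ℤ}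

/-- A component meeting a chart contains a dense open subscheme of an affine space. -/
theorem Coords.exists_param_component (C : v.Coords r m n) (hmn : m ≤ n)
    {Z : Set (v.LPScheme (Finset.Icc m n))} (hZ : Z ∈ irreducibleComponents _)
    (c : Chart v (Finset.Icc m n)) (hc : (Z ∩ chartOpen c).Nonempty) :
    ∃ (s : Fin r) (f : MvPolynomial (AffIdx.{u} s) k) (φ : ChartRing c →ₐ[k] Localization.Away f),
      f ≠ 0 ∧ IsOpenImmersion (Spec.map (CommRingCat.ofHom φ.toRingHom) ≫ chartMap c) ∧
      Z = closure (Set.range (Spec.map (CommRingCat.ofHom φ.toRingHom) ≫ chartMap c)) ∧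
      ∃ P : PrimeSpectrum (ChartRing c), P.asIdeal = RingHom.ker φ ∧
        Z = closure {(chartMap c) P} := by
  rw [C.irreducibleComponents_eq hmn] at hZ
  obtain ⟨d, hne, rfl⟩ := hZ
  obtain ⟨ξ, hξ, hgen, -⟩ := C.exists_genericPoint_flow hmn hne
  obtain ⟨x, hx, hxc⟩ := hc
  have hξx : ξ ⤳ x := by
    rw [specializes_iff_mem_closure]
    exact closure_minimal (fun y hy => (hgen y hy).mem_closure) isClosed_closure hx
  -- The generic point of the component lies in every chart that the component meets, so a cell can
  -- be found in the prescribed chart.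
  have hξc : ξ ∈ chartOpen c := hξx.mem_open (chartOpen c).isOpen hxc
  obtain ⟨s, q, hq, hcell⟩ := C.exists_mem_cell hmn hξ hξc
  obtain ⟨p, hp, hps, ⟨φ, rfl⟩, hr, -⟩ := C.exists_param (c := c) (s := s) hq
  have hf := C.affFun_ne_zero hq ⟨ξ, hcell⟩
  have hdom : IsDomain (Localization.Away (C.affFun c d s q)) :=
    isDomain_of_isLocalization_away hf _
  have hcl : closure (C.flow d) = closure {ξ} := subset_antisymm
    (closure_minimal (fun y hy => (hgen y hy).mem_closure) isClosed_closure)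
    (closure_mono (Set.singleton_subset_iff.2 hξ))
  have hcl2 : closure (C.flow d) = closure (C.cell c d s q) := subset_antisymm
    (hcl.trans_subset (closure_mono (Set.singleton_subset_iff.2 hcell)))
    (closure_mono (C.cell_subset_flow hq))
  let ζ : PrimeSpectrum (Localization.Away (C.affFun c d s q)) := ⊥
  refine ⟨s, _, φ, hf, hp, by rw [hr, hcl2], PrimeSpectrum.comap φ.toRingHom ζ, rfl, ?_⟩
  rw [hcl2, ← hr]
  refine subset_antisymm (closure_minimal ?_ isClosed_closure)
    (closure_mono (Set.singleton_subset_iff.2 ⟨ζ, rfl⟩))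
  rintro _ ⟨y, rfl⟩
  have h2 : ζ ⤳ y := (PrimeSpectrum.le_iff_specializes _ _).1 bot_le
  exact (h2.map (Spec.map (CommRingCat.ofHom φ.toRingHom) ≫ chartMap c).continuous).mem_closure

theorem card_affIdx (s : Fin r) : Nat.card (AffIdx.{u} s) = r - 1 := by
  rw [Nat.card_congr Equiv.ulift, Nat.card_eq_fintype_card, Fintype.card_subtype_compl]
  simp

instance (s : Fin r) : Finite (AffIdx.{u} s) := inferInstanceAs (Finite (ULift _))

theorem Coords.hasRationalComponents (C : v.Coords r m n) (hmn : m ≤ n) :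
    Scheme.HasRationalComponents (v.LPToSpec (Finset.Icc m n)) := by
  intro Z hZ
  obtain ⟨x, hx⟩ := hZ.1.nonempty
  obtain ⟨c, hc⟩ := exists_mem_chartOpen x
  obtain ⟨s, f, φ, hf, _, hr, -⟩ := C.exists_param_component hmn hZ c ⟨x, hx, hc⟩
  have hdom : IsDomain (Localization.Away f) := isDomain_of_isLocalization_away hf _
  obtain ⟨g, hg, _, _⟩ := Scheme.exists_lift_vanishingIdeal
    (Spec.map (CommRingCat.ofHom φ.toRingHom) ≫ chartMap c) Z
    (subset_closure.trans_eq hr.symm) hr.subset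
  have := isRationalOver_away hf
  refine Scheme.BirationalOver.isRationalOver _
    (Spec.map (CommRingCat.ofHom (algebraMap k (Localization.Away f))))
    (Scheme.BirationalOver.symm (g.birationalOver _ _ ?_))
  rw [reassoc_of% hg, chartMap_toSpec, ← Spec.map_comp]
  congr 1
  apply CommRingCat.hom_ext
  exact φ.comp_algebraMap

/-- In each chart the component is the spectrum of a quotient that embeds in a localized polynomial
ring in `r - 1` variables, which bounds the dimension from above; a dense cell bounds it from below.
A component provides an index `s : Fin r`, so the truncated subtraction does no harm: for `r = 0`
there are no components. -/
theorem Coords.hasPureDimension (C : v.Coords r m n) (hmn : m ≤ n) :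
    (v.LPScheme (Finset.Icc m n)).HasPureDimension (((r - 1 : ℕ) : ℕ∞) : WithBot ℕ∞) := by
  intro Z hZ
  obtain ⟨x, hx⟩ := hZ.1.nonempty
  apply le_antisymm
  · refine topologicalKrullDim_le_of_isOpenEmbedding.{u} fun ⟨y, hy⟩ => ?_
    obtain ⟨c, hc⟩ := exists_mem_chartOpen y
    obtain ⟨s, f, φ, hf, -, -, P, hP, hZP⟩ := C.exists_param_component hmn hZ c ⟨y, hy, hc⟩
    let π : ChartRing c →+* ChartRing c ⧸ RingHom.ker φ := Ideal.Quotient.mk _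
    let i : PrimeSpectrum (ChartRing c ⧸ RingHom.ker φ) → v.LPScheme (Finset.Icc m n) :=
      chartMap c ∘ PrimeSpectrum.comap π
    have hi : Topology.IsEmbedding i := (chartMap c).isOpenEmbedding.isEmbedding.comp
      (PrimeSpectrum.isClosedEmbedding_comap_of_surjective _ _
        Ideal.Quotient.mk_surjective).isEmbedding
    have hri : Set.range i = Z ∩ chartOpen c := by
      have h1 : Set.range (PrimeSpectrum.comap π) = {y | P ⤳ y} := by
        rw [range_comap_of_surjective _ _ Ideal.Quotient.mk_surjective]
        ext y
        rw [Ideal.mk_ker, ← hP, PrimeSpectrum.mem_zeroLocus, Set.mem_ofPred_eq,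
          ← PrimeSpectrum.le_iff_specializes]
        rfl
      have h2 : Set.range i = chartMap c '' {y | P ⤳ y} :=
        (Set.range_comp (chartMap c) (PrimeSpectrum.comap π)).trans
          (congrArg (fun S => chartMap c '' S) h1)
      rw [h2, hZP, ← opensRange_chartMap]
      ext z
      constructor
      · rintro ⟨y, hy, rfl⟩
        exact ⟨(hy.map (chartMap c).continuous).mem_closure, y, rfl⟩
      · rintro ⟨hz, y, rfl⟩
        exact ⟨y, (chartMap c).isOpenEmbedding.isInducing.specializes_iff.1
          (specializes_iff_mem_closure.2 hz), rfl⟩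
    have hiZ : ∀ y, i y ∈ Z := fun y => (hri.subset ⟨y, rfl⟩).1
    refine ⟨_, inferInstance, Set.codRestrict i Z hiZ, ⟨hi.codRestrict _ _, ?_⟩, ?_, ?_⟩
    · have h2 : Set.range (Set.codRestrict i Z hiZ) = Subtype.val ⁻¹' (chartOpen c : Set _) := by
        ext ⟨z, hz⟩
        have h3 := Set.ext_iff.1 hri z
        simp only [Set.mem_range, Set.mem_inter_iff, hz, true_and] at h3
        simpa [Subtype.ext_iff] using h3
      rw [h2]
      exact (chartOpen c).isOpen.preimage continuous_subtype_val
    · obtain ⟨z, hz⟩ := hri.superset ⟨hy, hc⟩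
      exact ⟨z, Subtype.ext hz⟩
    · have : Algebra.FiniteType k (ChartRing c) :=
        Algebra.FiniteType.of_surjective (chartMk c) (chartMk_surjective c)
      rw [PrimeSpectrum.topologicalKrullDim_eq_ringKrullDim, ← card_affIdx s]
      exact MvPolynomial.ringKrullDim_le_of_injective_away hf (Localization.Away f)
        (Ideal.kerLiftAlg φ) (Ideal.kerLiftAlg_injective φ)
  · obtain ⟨c, hc⟩ := exists_mem_chartOpen x
    obtain ⟨s, f, φ, hf, _, hr, -⟩ := C.exists_param_component hmn hZ c ⟨x, hx, hc⟩
    let p := Spec.map (CommRingCat.ofHom φ.toRingHom) ≫ chartMap c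
    have hp : ∀ y, p y ∈ Z := fun y => hr.superset (subset_closure ⟨y, rfl⟩)
    have h1 : Topology.IsInducing (Set.codRestrict p Z hp) :=
      p.isOpenEmbedding.isInducing.codRestrict _
    refine le_trans ?_ h1.topologicalKrullDim_le
    rw [← card_affIdx s]
    refine (MvPolynomial.card_le_ringKrullDim_away hf (Localization.Away f)).trans_eq ?_
    exact (PrimeSpectrum.topologicalKrullDim_eq_ringKrullDim (Localization.Away f)).symm

end ZRep

theorem mainTheorem2 {k : Type u} [Field k] (v : ZRep.{u, w} k)
    (hexact : v.IsExact) (hcolinked : v.IsColinkedChain) (hfin : v.HasFiniteCosupport)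
    (r : ℕ) (hdim : v.HasPureDim r)
    (m n : ℤ) (hcosupp : v.HasCosupport (Finset.Icc m n : Finset ℤ)) :
    (v.LPScheme (Finset.Icc m n)).IsGenericallyReduced ∧
    (v.LPScheme (Finset.Icc m n)).HasPureDimension (((r - 1 : ℕ) : ℕ∞) : WithBot ℕ∞) ∧
    Scheme.HasRationalComponents (v.LPToSpec (Finset.Icc m n)) ∧
    irreducibleComponents (v.LPScheme (Finset.Icc m n)) =
      {Z | ∃ a : ZArrow → Fin 2, ZArrow.IsExact a ∧
        (v.stratum (Finset.Icc m n) a).Nonempty ∧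
        Z = closure (v.stratum (Finset.Icc m n) a)} := by
  obtain ⟨C⟩ := ZRep.exists_coords hexact hcolinked hdim hcosupp
  have hmn : m ≤ n := hcosupp.le
  refine ⟨C.isGenericallyReduced hmn, C.hasPureDimension hmn, C.hasRationalComponents hmn, ?_⟩
  rw [C.irreducibleComponents_eq hmn]
  exact Set.ext (C.exists_stratum_iff hmn)
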